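/- Let $\beta>0$. For compactly supported $C^1$ initial data on $(0,\infty)$ consider the system $$\omega_t+u\,\omega_x=\frac{\rho}{x^\beta},\qquad \rho_t+u\,\rho_x=0,\qquad u(x,t)=-x\int_x^\infty\frac{\omega(y,t)}{y}\,dy\qquad(x>0).$$ A smooth solution on $[0,T)$ is a pair $(\omega,\rho)$ solving the system classically on $[0,T)\times(0,\infty)$ such that, for every $T'<T$, both components belong to $C([0,T'],C^1_0(0,\infty))\cap C^1([0,T'],C(0,\infty))$, with supports contained in one compact subset of $(0,\infty)$ for all $t\in[0,T']$. Given positive numbers $p,q,\phi,\psi,\delta,m$ and $0<\varepsilon<A_0<1$, a pair $\omega_0,\rho_0\in C^1_0(0,\infty)$ is called suitably prepared if $\omega_0,\rho_0\ge 0$, $\operatorname{supp}\omega_0\subset[\varepsilon,4]$, $\operatorname{supp}\rho_0\subset[\varepsilon,3]$, and $$\phi x^{-p}<\omega_0(x)<\psi x^{-q}\ \ (A_0\le x\le 1),\qquad \omega_0(x)<\psi-\delta\ \ (1\le x\le 4),\qquad \phi<\omega_0(x)\ \ (1\le x\le 3),$$ $$\rho_0(x)\le m\ \ (x>0),\qquad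 m^{-1}\le\rho_0(x)\ \ (A_0\le x\le 2).$$ Theorem. For every $\beta>0$ and every $m\ge 1$ there exist $A_0\in(0,1)$ and positive $p,q,\phi,\psi,\delta$ with $$0<p<q,\qquad p+q=\beta,\qquad \phi<\psi-\delta,$$ such that for every $\varepsilon\in(0,A_0)$ the class of suitably prepared initial data with these parameters is nonempty, and for each $(\omega_0,\rho_0)$ in this class the following holds. (i) There are a finite $T_s>0$ and a smooth solution $(\omega,\rho)$ on $[0,T_s)$ with initial data $(\omega_0,\rho_0)$ that is unique and maximal: every smooth solution on some $[0,T)$ with the same initial data satisfies $T\le T_s$ and coincides with $(\omega,\rho)$ on $[0,T)$. Moreover $$\lim_{t\to T_s}\int_0^t\|\omega(\cdot,s)\|_{L^\infty(0,\infty)}\,ds=\infty.$$ (ii) Let $A(t)$ be the particle trajectory $\dot A(t)=u(A(t),t)$, $A(0)=A_0$; it exists on $[0,T_s)$ and is positive. The solution is controlled: for all $t\in[0,T_s)$, $$\phi x^{-p}<\omega(x,t)<\psi x^{-q}\quad (A(t)\le x\le 1),$$ and $\omega(x,t)<\psi$ for $1\le x\le 3$, $\omega(x,t)>\phi$ for $1\le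 x\le 2$. (iii) Put $T_1=\dfrac{A_0^{p}}{\phi\, b_0\, p}$ with $b_0=\dfrac{\min\{1,p\log 2\}}{p}$. Then $A(t)^p\le A_0^p\,(1-t/T_1)$ for all $t\in[0,T_s)$; in particular $T_s\le T_1$, and if the solution stays smooth on $[0,T_1)$, then $\lim_{t\to T_1}A(t)=0$. -/

import Mathlib

open Set Filter Topology MeasureTheory

noncomputable section

namespace NonlocalTransport

/-- `C¹` functions with compact support in the open half-line `(0, ∞)`.  Such a function is
identified with its extension by zero to `ℝ`, which is again `C¹`. -/
structure MemC1c (f : ℝ → ℝ) : Prop where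
  contDiff : ContDiff ℝ 1 f
  compactSupport : HasCompactSupport f
  tsupport_subset : tsupport f ⊆ Ioi 0

/-- `Q(x) = ∫_x^∞ w(y) / y dy`. -/
def Q (w : ℝ → ℝ) (x : ℝ) : ℝ := ∫ y in Ioi x, w y / y

/-- The velocity `u(x) = - x ∫_x^∞ w(y) / y dy` generated by a vorticity profile `w`. -/
def velocity (w : ℝ → ℝ) (x : ℝ) : ℝ := -x * Q w x

/-- The supremum norm of a (bounded) function on `(0, ∞)`. -/
def supNorm (w : ℝ → ℝ) : ℝ := ⨆ x : Ioi (0 : ℝ), |w x|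

/-- `f` (written `f t x`, `t` time, `x` position) restricted to every `[0, T'] ⊂ [0, T)` belongs to
`C([0, T'], C¹_0(0, ∞)) ∩ C¹([0, T'], C(0, ∞))`: the supports at times in `[0, T']` lie in one
compact subset of `(0, ∞)`, and `f`, `f_x`, `f_t` exist and are jointly continuous
(`f_t` is one-sided at `t = 0`). -/
structure InSolutionSpace (T : ℝ) (f : ℝ → ℝ → ℝ) : Prop where
  contDiff_space : ∀ t ∈ Ico 0 T, ContDiff ℝ 1 (f t)
  support_subset : ∀ T' ∈ Ico 0 T, ∃ a b : ℝ, 0 < a ∧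
    ∀ t ∈ Icc 0 T', Function.support (f t) ⊆ Icc a b
  continuous_self : ContinuousOn (fun z : ℝ × ℝ => f z.1 z.2) (Ico 0 T ×ˢ univ)
  continuous_dx : ContinuousOn (fun z : ℝ × ℝ => deriv (f z.1) z.2) (Ico 0 T ×ˢ univ)
  differentiable_time : ∀ x : ℝ, DifferentiableOn ℝ (fun s => f s x) (Ico 0 T)
  continuous_dt : ContinuousOn
    (fun z : ℝ × ℝ => derivWithin (fun s => f s z.2) (Ico 0 T) z.1) (Ico 0 T ×ˢ univ)

/-- `(ω, ρ)` is a smooth (classical `C¹`) solution on `[0, T) × (0, ∞)` of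
`ω_t + u ω_x = ρ / x ^ β`, `ρ_t + u ρ_x = 0`, `u = - x ∫_x^∞ ω(y, t) / y dy`,
with initial data `(ω₀, ρ₀)`. -/
structure IsSmoothSolution (β T : ℝ) (ω₀ ρ₀ : ℝ → ℝ) (ω ρ : ℝ → ℝ → ℝ) : Prop where
  mem_ω : InSolutionSpace T ω
  mem_ρ : InSolutionSpace T ρ
  init_ω : ω 0 = ω₀
  init_ρ : ρ 0 = ρ₀
  eq_ω : ∀ t ∈ Ico 0 T, ∀ x : ℝ, 0 < x →
    derivWithin (fun s => ω s x) (Ico 0 T) t + velocity (ω t) x * deriv (ω t) x = ρ t x / x ^ β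
  eq_ρ : ∀ t ∈ Ico 0 T, ∀ x : ℝ, 0 < x →
    derivWithin (fun s => ρ s x) (Ico 0 T) t + velocity (ω t) x * deriv (ρ t) x = 0

/-- `(ω, ρ)` is the maximal smooth solution with the given data, with lifetime `Ts`: every smooth
solution with the same data lives on a smaller interval and is a restriction of `(ω, ρ)`. -/
structure IsMaximalSolution (β Ts : ℝ) (ω₀ ρ₀ : ℝ → ℝ) (ω ρ : ℝ → ℝ → ℝ) : Prop where
  pos : 0 < Ts
  isSolution : IsSmoothSolution β Ts ω₀ ρ₀ ω ρ
  maximal : ∀ (T : ℝ) (ω' ρ' : ℝ → ℝ → ℝ), IsSmoothSolution β T ω₀ ρ₀ ω' ρ' →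
    T ≤ Ts ∧ ∀ t ∈ Ico 0 T, ω' t = ω t ∧ ρ' t = ρ t

/-- `A` is the particle trajectory on `[0, T)` started at `A₀`: `A(0) = A₀`, `A' = u(A, t)`. -/
structure IsTrajectory (T A₀ : ℝ) (ω : ℝ → ℝ → ℝ) (A : ℝ → ℝ) : Prop where
  init : A 0 = A₀
  hasDeriv : ∀ t ∈ Ico 0 T, HasDerivWithinAt A (velocity (ω t) (A t)) (Ico 0 T) t

/-- The suitably prepared initial data with parameters `p, q, φ, ψ, δ, m, A₀, ε`. -/
structure SuitablyPrepared (p q φ ψ δ m A₀ ε : ℝ) (ω₀ ρ₀ : ℝ → ℝ) : Prop where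
  mem_ω : MemC1c ω₀
  mem_ρ : MemC1c ρ₀
  nonneg_ω : ∀ x, 0 < x → 0 ≤ ω₀ x
  nonneg_ρ : ∀ x, 0 < x → 0 ≤ ρ₀ x
  supp_ω : tsupport ω₀ ⊆ Icc ε 4
  supp_ρ : tsupport ρ₀ ⊆ Icc ε 3
  ω_lt_pow : ∀ x ∈ Icc A₀ 1, ω₀ x < ψ * x ^ (-q)
  ω_lt : ∀ x ∈ Icc (1 : ℝ) 4, ω₀ x < ψ - δ
  pow_lt_ω : ∀ x ∈ Icc A₀ 1, φ * x ^ (-p) < ω₀ x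
  lt_ω : ∀ x ∈ Icc (1 : ℝ) 3, φ < ω₀ x
  ρ_le : ∀ x, 0 < x → ρ₀ x ≤ m
  le_ρ : ∀ x ∈ Icc A₀ 2, m⁻¹ ≤ ρ₀ x

/-- The control conditions on `[0, T)` for a vorticity `ω` and the trajectory `A`. -/
structure Controlled (p q φ ψ T : ℝ) (ω : ℝ → ℝ → ℝ) (A : ℝ → ℝ) : Prop where
  lt_pow : ∀ t ∈ Ico 0 T, ∀ x ∈ Icc (A t) 1, ω t x < ψ * x ^ (-q)
  lt_const : ∀ t ∈ Ico 0 T, ∀ x ∈ Icc (1 : ℝ) 3, ω t x < ψ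
  pow_lt : ∀ t ∈ Ico 0 T, ∀ x ∈ Icc (A t) 1, φ * x ^ (-p) < ω t x
  const_lt : ∀ t ∈ Ico 0 T, ∀ x ∈ Icc (1 : ℝ) 2, φ < ω t x

/-- The time `A₀ ^ p / (φ b₀ p)` with `b₀ = min {1, p log 2} / p`, by which a trajectory with
`A(0) = A₀` and `-A' ≥ φ b₀ A ^ (1 - p)` reaches the origin. -/
def reachTime (p φ A₀ : ℝ) : ℝ := A₀ ^ p / (φ * (min 1 (p * Real.log 2) / p) * p)

end NonlocalTransport

end

open NonlocalTransport

/-! In the variable `η = log x` the velocity becomes `v = u / x`, with `v_η = ω`, and it vanishes to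
the right of the support. Let `Y(t, ζ)` be the logarithmic position of the particle with label `ζ`.
Then `L = log Y_ζ` satisfies `L_t = Ω`, where `Ω` is the vorticity along the trajectory. Since `ρ`
is transported, `Ω_t = P e^{-βY}`, and `Y` is recovered from `L` by integrating `e^L` from the fixed
particle `R = log 4`. The problem is therefore an ordinary differential equation for `(L, Ω)` in a
Banach space of bounded continuous functions, with a right-hand side Lipschitz on bounded sets. This
yields existence and a blow-up alternative (`exists_lagrangianSolution`). Because `L = ∫ Ω`, a bound
on `∫ ‖Ω‖` bounds `L`, hence the source, hence `Ω`, so the alternative is exactly divergence of `∫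
‖Ω‖`. Inverting the flow map gives a classical Eulerian solution (`isSmoothSolution`). Uniqueness
comes from comparing two solutions along the flow of one of them (`IsSmoothSolution.eq_of_isFlow`).

Blow-up comes from two barriers, `φ x^{-p}` and `ψ x^{-q}` with `p + q = β`. While both hold,
integrating them gives `φ b₀ e^{-pY} ≤ -Y_t ≤ ψ (1/q + log 4) e^{-qY}` for the labels followed with
`Y ≤ 0`. If `Ω e^{qY}` reached `ψ`, its derivative would be `P e^{-pY} + qψ Y_t ≤ (m - qψφ b₀)
e^{-pY} < 0`. If `Ω e^{pY}` reached `φ`, its derivative would be `P e^{-qY} + pφ Y_t ≥ (1/m -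
pφψ(1/q + log 4)) e^{-qY} > 0`. Both are impossible at a first contact. The choice `p + q = β` is
what makes source and transport scale alike in each case. The first inequality needs `φψ` large, the
second needs `p` small.

In `x ≥ 1` the bounds hold because little happens before the time `T₁`, which is short when `A₀` is
small. The lower velocity bound also gives `(A^p)' ≤ -pφ b₀`. Since `A > 0`, the lifetime is at most
`T₁`, and the alternative then forces divergence of the vorticity integral. -/

noncomputable section

namespace NonlocalTransport

open Metric
open scoped NNReal Interval BoundedContinuousFunction

/-! ### Maximal solutions of autonomous equations in a Banach space -/

section MaximalCurve

variable {E : Type*} [NormedAddCommGroup E] [NormedSpace ℝ E]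

/-- Solutions of an autonomous equation whose right-hand side is Lipschitz on bounded sets are
unique on open intervals. -/
theorem eqOn_of_hasDerivAt_of_lipschitzOnWith_closedBall {F : E → E}
    (hF : ∀ B : ℝ, ∃ K : ℝ≥0, LipschitzOnWith K F (closedBall 0 B)) {f g : ℝ → E} {a b t₀ : ℝ}
    (ht₀ : t₀ ∈ Ioo a b) (hf : ∀ t ∈ Ioo a b, HasDerivAt f (F (f t)) t)
    (hg : ∀ t ∈ Ioo a b, HasDerivAt g (F (g t)) t) (h : f t₀ = g t₀) : EqOn f g (Ioo a b) := by
  intro t ht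
  obtain ⟨a', ha, ha'⟩ := exists_between (lt_min ht₀.1 ht.1)
  obtain ⟨b', hb', hb⟩ := exists_between (max_lt ht₀.2 ht.2)
  rw [lt_min_iff] at ha'
  rw [max_lt_iff] at hb'
  have hsub : Icc a' b' ⊆ Ioo a b := fun s hs => ⟨ha.trans_le hs.1, hs.2.trans_lt hb⟩
  have hfc : ContinuousOn f (Icc a' b') := fun s hs =>
    (hf s (hsub hs)).continuousAt.continuousWithinAt
  have hgc : ContinuousOn g (Icc a' b') := fun s hs =>
    (hg s (hsub hs)).continuousAt.continuousWithinAt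
  obtain ⟨B₁, hB₁⟩ := isCompact_Icc.exists_bound_of_continuousOn hfc
  obtain ⟨B₂, hB₂⟩ := isCompact_Icc.exists_bound_of_continuousOn hgc
  obtain ⟨K, hK⟩ := hF (max B₁ B₂)
  -- Both curves are bounded on the compact interval, so a single ball and a single Lipschitz
  -- constant serve for both.
  refine ODE_solution_unique_of_mem_Icc (v := fun _ => F) (s := fun _ => closedBall 0 (max B₁ B₂))
    (K := K) (fun _ _ => hK) (t₀ := t₀) ⟨ha'.1, hb'.1⟩ hfc
    (fun s hs => hf s (hsub (Ioo_subset_Icc_self hs))) (fun s hs => ?_) hgc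
    (fun s hs => hg s (hsub (Ioo_subset_Icc_self hs))) (fun s hs => ?_) h ⟨ha'.2.le, hb'.2.le⟩
  · simpa using Or.inl (hB₁ s (Ioo_subset_Icc_self hs))
  · simpa using Or.inr (hB₂ s (Ioo_subset_Icc_self hs))

variable [CompleteSpace E]

/-- The existence time is uniform for initial values in a bounded set. -/
theorem exists_uniform_existence_time {F : E → E}
    (hF : ∀ B : ℝ, ∃ K : ℝ≥0, LipschitzOnWith K F (closedBall 0 B)) (B : ℝ) :
    ∃ δ > 0, ∀ x : E, ‖x‖ ≤ B → ∀ t₀ : ℝ, ∃ α : ℝ → E, α t₀ = x ∧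
      ∀ t ∈ Ioo (t₀ - δ) (t₀ + δ), HasDerivAt α (F (α t)) t := by
  obtain ⟨K, hK⟩ := hF (max B 0 + 1)
  have hB0 : 0 ≤ max B 0 := le_max_right _ _
  set L : ℝ≥0 := ‖F 0‖₊ + K * ⟨max B 0 + 1, by positivity⟩ with hL
  -- `L` bounds `‖F‖` on the unit ball around `x`, so a solution stays in that ball for time `1 / (L
  -- + 1)`. The summand `1` covers `L = 0`.
  refine ⟨1 / (L + 1), by positivity, fun x hx t₀ => ?_⟩
  have hd : (0 : ℝ) < 1 / (L + 1) := by positivity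
  have hsub : closedBall x 1 ⊆ closedBall 0 (max B 0 + 1) := by
    refine closedBall_subset_closedBall' ?_
    rw [dist_zero_right]
    linarith [le_max_left B 0]
  have hpl : IsPicardLindelof (fun _ : ℝ => F) (tmin := t₀ - 1 / (L + 1))
      (tmax := t₀ + 1 / (L + 1)) ⟨t₀, by linarith, by linarith⟩ x 1 0 L K := by
    refine IsPicardLindelof.of_time_independent (fun y hy => ?_) (hK.mono (by simpa using hsub)) ?_
    · have hy' := hsub (by simpa using hy)
      have h0 : (0 : E) ∈ closedBall (0 : E) (max B 0 + 1) := by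
        simp only [mem_closedBall, dist_self]; positivity
      have h1 := hK.dist_le_mul y hy' 0 h0
      rw [dist_eq_norm, dist_zero_right] at h1
      rw [mem_closedBall, dist_zero_right] at hy'
      have h2 : ‖F y‖ ≤ ‖F 0‖ + ‖F y - F 0‖ := by
        simpa using norm_add_le (F 0) (F y - F 0)
      have h3 : (K : ℝ) * ‖y‖ ≤ K * (max B 0 + 1) := by gcongr
      have h4 : ((L : ℝ≥0) : ℝ) = ‖F 0‖ + K * (max B 0 + 1) := by
        rw [hL]; push_cast; rfl
      rw [h4]; linarith
    · simp only [add_sub_cancel_left, sub_sub_cancel, max_self, NNReal.coe_one, NNReal.coe_zero,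
        sub_zero]
      rw [mul_one_div, div_le_one (by positivity)]
      linarith
  obtain ⟨α, h0, hα⟩ := hpl.exists_eq_forall_mem_Icc_hasDerivWithinAt₀
  exact ⟨α, h0, fun t ht => (hα t (Ioo_subset_Icc_self ht)).hasDerivAt (Icc_mem_nhds ht.1 ht.2)⟩

/-- An autonomous equation whose right-hand side is Lipschitz on bounded sets has a solution that
either lives up to the prescribed time `T` or is unbounded. -/
theorem exists_maximal_solution {F : E → E}
    (hF : ∀ B : ℝ, ∃ K : ℝ≥0, LipschitzOnWith K F (closedBall 0 B)) (x₀ : E) {T : ℝ} (hT : 0 < T) :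
    ∃ τ > 0, ∃ S > 0, S ≤ T ∧ ∃ γ : ℝ → E, γ 0 = x₀ ∧
      (∀ t ∈ Ioo (-τ) S, HasDerivAt γ (F (γ t)) t) ∧
      (S = T ∨ ∀ B : ℝ, ∃ t ∈ Ico 0 S, B < ‖γ t‖) := by
  obtain ⟨δ, hδ, hloc⟩ := exists_uniform_existence_time hF ‖x₀‖
  set τ := min δ T
  have hτ : 0 < τ := lt_min hδ hT
  -- The intervals start at `-τ`, so that time `0` is interior and all derivatives are two-sided.
  set 𝒮 : Set ℝ := {s | s ∈ Icc τ T ∧ ∃ γ : ℝ → E, γ 0 = x₀ ∧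
    ∀ t ∈ Ioo (-τ) s, HasDerivAt γ (F (γ t)) t} with h𝒮
  have hτ𝒮 : τ ∈ 𝒮 := by
    obtain ⟨α, h0, hα⟩ := hloc x₀ le_rfl 0
    refine ⟨⟨le_rfl, min_le_right _ _⟩, α, h0, fun t ht => hα t ⟨?_, ?_⟩⟩
    · linarith [ht.1, min_le_left δ T]
    · linarith [ht.2, min_le_left δ T]
  have hbdd : BddAbove 𝒮 := ⟨T, fun s hs => hs.1.2⟩
  set S := sSup 𝒮
  have hτS : τ ≤ S := le_csSup hbdd hτ𝒮
  have hST : S ≤ T := csSup_le ⟨τ, hτ𝒮⟩ fun s hs => hs.1.2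
  -- `G t` is a solution living beyond `t`. The diagonal `t ↦ G t t` glues these solutions,
  -- consistently by uniqueness.
  have hex : ∀ t : ℝ, ∃ g : ℝ → E, t < S → ∃ s, t < s ∧ g 0 = x₀ ∧ s ∈ Icc τ T ∧
      ∀ t ∈ Ioo (-τ) s, HasDerivAt g (F (g t)) t := by
    intro t
    by_cases ht : t < S
    · obtain ⟨s, hs, hts⟩ := exists_lt_of_lt_csSup ⟨τ, hτ𝒮⟩ ht
      obtain ⟨h1, g, h2, h3⟩ := hs
      exact ⟨g, fun _ => ⟨s, hts, h2, h1, h3⟩⟩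
    · exact ⟨0, fun h => absurd h ht⟩
  choose G hG using hex
  have hGeq : ∀ s ∈ 𝒮, ∀ g : ℝ → E, g 0 = x₀ → (∀ t ∈ Ioo (-τ) s, HasDerivAt g (F (g t)) t) →
      EqOn (fun t => G t t) g (Ioo (-τ) s) := by
    intro s hs g hg0 hg t ht
    obtain ⟨s', hts', h0, hs', hd⟩ := hG t (ht.2.trans_le (le_csSup hbdd hs))
    have hpos : (0 : ℝ) < min s s' := lt_min (hτ.trans_le hs.1.1) (hτ.trans_le hs'.1)
    exact eqOn_of_hasDerivAt_of_lipschitzOnWith_closedBall hF (a := -τ) (b := min s s') (t₀ := 0)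
      ⟨by linarith, hpos⟩
      (fun r hr => hd r ⟨hr.1, hr.2.trans_le (min_le_right _ _)⟩)
      (fun r hr => hg r ⟨hr.1, hr.2.trans_le (min_le_left _ _)⟩) (h0.trans hg0.symm)
      ⟨ht.1, lt_min ht.2 hts'⟩
  have hderiv : ∀ t ∈ Ioo (-τ) S, HasDerivAt (fun t => G t t) (F (G t t)) t := by
    intro t ht
    obtain ⟨s, hts, h0, hs, hd⟩ := hG t ht.2
    have heq := hGeq s ⟨hs, G t, h0, hd⟩ (G t) h0 hd
    exact (hd t ⟨ht.1, hts⟩).congr_of_eventuallyEq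
      (heq.eventuallyEq_of_mem (Ioo_mem_nhds ht.1 hts))
  have h0 : G 0 0 = x₀ := by
    obtain ⟨s, -, h0, -⟩ := hG 0 (hτ.trans_le hτS)
    exact h0
  refine ⟨τ, hτ, S, hτ.trans_le hτS, hST, fun t => G t t, h0, hderiv, ?_⟩
  by_contra! hcon
  obtain ⟨hne, B, hB⟩ := hcon
  have hlt : S < T := lt_of_le_of_ne hST hne
  obtain ⟨d, hd, hloc'⟩ := exists_uniform_existence_time hF B
  -- If the norm stays below `B`, the existence time `d` is uniform. Restarting within `d / 2` of
  -- `S` carries the solution past `S`, against the choice of `S` as supremum.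
  set t₁ := max 0 (S - d / 2)
  have hS0 : 0 < S := hτ.trans_le hτS
  have ht₁ : t₁ ∈ Ico 0 S := ⟨le_max_left _ _, max_lt hS0 (by linarith)⟩
  have ht₁' : S - d / 2 ≤ t₁ := le_max_right _ _
  obtain ⟨α, hα0, hα⟩ := hloc' (G t₁ t₁) (hB t₁ ht₁) t₁
  have heq : EqOn (fun t => G t t) α (Ioo (max (t₁ - d) (-τ)) S) := by
    refine eqOn_of_hasDerivAt_of_lipschitzOnWith_closedBall hF (t₀ := t₁)
      ⟨max_lt (by linarith) (by linarith [ht₁.1]), ht₁.2⟩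
      (fun r hr => hderiv r ⟨(le_max_right _ _).trans_lt hr.1, hr.2⟩)
      (fun r hr => hα r ⟨(le_max_left _ _).trans_lt hr.1, by linarith [hr.2]⟩) hα0.symm
  have hmem : min (t₁ + d) T ∈ 𝒮 := by
    refine ⟨⟨le_min (by linarith) (by linarith), min_le_right _ _⟩,
      fun t => if t < S then G t t else α t, by simp [hS0, h0], fun t ht => ?_⟩
    have ht2 : t < t₁ + d := ht.2.trans_le (min_le_left _ _)
    rcases lt_or_ge t S with h | h
    · simp only [h, if_true]
      refine (hderiv t ⟨ht.1, h⟩).congr_of_eventuallyEq ?_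
      filter_upwards [Iio_mem_nhds h] with r hr
      simp only [mem_Iio.1 hr, if_true]
    · simp only [not_lt.2 h, if_false]
      have ht1 : t₁ < t := ht₁.2.trans_le h
      refine (hα t ⟨by linarith, ht2⟩).congr_of_eventuallyEq ?_
      filter_upwards [Ioi_mem_nhds ht1] with r hr
      rw [mem_Ioi] at hr
      split_ifs with hrS
      · exact heq ⟨max_lt (by linarith) (by linarith [ht₁.1]), hrS⟩
      · rfl
  have hle := le_csSup hbdd hmem
  have : S < min (t₁ + d) T := lt_min (by linarith) hlt
  linarith

end MaximalCurve

/-! ### Calculus for functions with continuous partial derivatives -/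

section Calculus

/-- Differentiation under the integral sign for a parameter in an open set. -/
theorem hasDerivAt_integral_of_continuousOn {f f' : ℝ → ℝ → ℝ} {U : Set ℝ} {a b t₀ : ℝ}
    (hU : IsOpen U) (ht₀ : t₀ ∈ U) (hf : ∀ t ∈ U, ContinuousOn (f t) (uIcc a b))
    (hf' : ContinuousOn (fun z : ℝ × ℝ => f' z.1 z.2) (U ×ˢ uIcc a b))
    (hd : ∀ t ∈ U, ∀ s ∈ uIcc a b, HasDerivAt (fun r => f r s) (f' t s) t) :
    HasDerivAt (fun t => ∫ s in a..b, f t s) (∫ s in a..b, f' t₀ s) t₀ := by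
  obtain ⟨ε, hε, hball⟩ := Metric.isOpen_iff.1 hU t₀ ht₀
  have hcb : closedBall t₀ (ε / 2) ⊆ U :=
    (closedBall_subset_ball (half_lt_self hε)).trans hball
  obtain ⟨C, hC⟩ := ((isCompact_closedBall t₀ (ε / 2)).prod
    (isCompact_uIcc (a := a) (b := b))).exists_bound_of_continuousOn
      (hf'.mono (prod_mono hcb Subset.rfl))
  have hsub : Ι a b ⊆ uIcc a b := uIoc_subset_uIcc
  refine (intervalIntegral.hasDerivAt_integral_of_dominated_loc_of_deriv_le (μ := volume)
    (F := f) (F' := f') (bound := fun _ => C)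
    (closedBall_mem_nhds t₀ (half_pos hε)) ?_ ?_ ?_ ?_ ?_ ?_).2
  · filter_upwards [hU.mem_nhds ht₀] with t ht
    exact ((hf t ht).mono hsub).aestronglyMeasurable measurableSet_uIoc
  · exact (hf t₀ ht₀).intervalIntegrable
  · have : ContinuousOn (f' t₀) (uIcc a b) :=
      hf'.comp (f := fun s => (t₀, s)) (by fun_prop) fun s hs => ⟨ht₀, hs⟩
    exact (this.mono hsub).aestronglyMeasurable measurableSet_uIoc
  · exact .of_forall fun s hs t ht => hC (t, s) ⟨ht, hsub hs⟩
  · exact intervalIntegrable_const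
  · exact .of_forall fun s hs t ht => hd t (hcb ht) s (hsub hs)

/-- A function of two real variables with continuous partial derivatives on an open set is strictly
differentiable there. -/
theorem hasStrictFDerivAt_of_partials {f f₁ f₂ : ℝ → ℝ → ℝ} {U : Set (ℝ × ℝ)} (hU : IsOpen U)
    (h₁ : ∀ z ∈ U, HasDerivAt (fun t => f t z.2) (f₁ z.1 z.2) z.1)
    (h₂ : ∀ z ∈ U, HasDerivAt (fun x => f z.1 x) (f₂ z.1 z.2) z.2)
    (c₁ : ContinuousOn (fun z : ℝ × ℝ => f₁ z.1 z.2) U)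
    (c₂ : ContinuousOn (fun z : ℝ × ℝ => f₂ z.1 z.2) U) {u : ℝ × ℝ} (hu : u ∈ U) :
    HasStrictFDerivAt (fun z : ℝ × ℝ => f z.1 z.2)
      ((ContinuousLinearMap.toSpanSingleton ℝ (f₁ u.1 u.2)).coprod
        (ContinuousLinearMap.toSpanSingleton ℝ (f₂ u.1 u.2))) u := by
  have hn := hU.mem_nhds hu
  refine hasStrictFDerivAt_uncurry_coprod (f := f)
    (f₁ := fun t x => ContinuousLinearMap.toSpanSingleton ℝ (f₁ t x))
    (f₂ := fun t x => ContinuousLinearMap.toSpanSingleton ℝ (f₂ t x)) ?_ ?_ ?_ ?_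
  · filter_upwards [hn] with v hv using (h₁ v hv).hasFDerivAt
  · filter_upwards [hn] with v hv using (h₂ v hv).hasFDerivAt
  · exact (ContinuousLinearMap.toSpanSingletonCLE (𝕜 := ℝ) (E := ℝ)).continuous.continuousAt.comp
      (f := fun z : ℝ × ℝ => f₁ z.1 z.2) (c₁.continuousAt hn)
  · exact (ContinuousLinearMap.toSpanSingletonCLE (𝕜 := ℝ) (E := ℝ)).continuous.continuousAt.comp
      (f := fun z : ℝ × ℝ => f₂ z.1 z.2) (c₂.continuousAt hn)

/-- Chain rule along a curve for a function of two variables with continuous partial derivatives. -/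
theorem hasDerivAt_comp_of_partials {f f₁ f₂ : ℝ → ℝ → ℝ} {U : Set (ℝ × ℝ)} (hU : IsOpen U)
    (h₁ : ∀ z ∈ U, HasDerivAt (fun t => f t z.2) (f₁ z.1 z.2) z.1)
    (h₂ : ∀ z ∈ U, HasDerivAt (fun x => f z.1 x) (f₂ z.1 z.2) z.2)
    (c₁ : ContinuousOn (fun z : ℝ × ℝ => f₁ z.1 z.2) U)
    (c₂ : ContinuousOn (fun z : ℝ × ℝ => f₂ z.1 z.2) U) {X : ℝ → ℝ} {v t : ℝ}
    (hu : (t, X t) ∈ U) (hX : HasDerivAt X v t) :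
    HasDerivAt (fun s => f s (X s)) (f₁ t (X t) + f₂ t (X t) * v) t := by
  have h := (hasStrictFDerivAt_of_partials hU h₁ h₂ c₁ c₂ hu).hasFDerivAt.comp_hasDerivAt
    (f := fun s => (s, X s)) t ((hasDerivAt_id t).prodMk hX)
  refine h.congr_deriv ?_
  simp [mul_comm]

/-- Derivative of an implicitly defined function of one variable. -/
theorem hasDerivAt_of_implicit {f f₁ f₂ : ℝ → ℝ → ℝ} {U : Set (ℝ × ℝ)} (hU : IsOpen U)
    (h₁ : ∀ z ∈ U, HasDerivAt (fun t => f t z.2) (f₁ z.1 z.2) z.1)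
    (h₂ : ∀ z ∈ U, HasDerivAt (fun x => f z.1 x) (f₂ z.1 z.2) z.2)
    (c₁ : ContinuousOn (fun z : ℝ × ℝ => f₁ z.1 z.2) U)
    (c₂ : ContinuousOn (fun z : ℝ × ℝ => f₂ z.1 z.2) U) {Z : ℝ → ℝ} {t η : ℝ}
    (hu : (t, Z t) ∈ U) (hne : f₂ t (Z t) ≠ 0) (hZ : ContinuousAt Z t)
    (hη : ∀ᶠ s in 𝓝 t, f s (Z s) = η) :
    HasDerivAt Z (-(f₁ t (Z t)) / f₂ t (Z t)) t := by
  have hn := hU.mem_nhds hu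
  set F₁ : ℝ → ℝ → ℝ →L[ℝ] ℝ := fun t x => ContinuousLinearMap.toSpanSingleton ℝ (f₁ t x)
  set F₂ : ℝ → ℝ → ℝ →L[ℝ] ℝ := fun t x => ContinuousLinearMap.toSpanSingleton ℝ (f₂ t x)
  have df₁ : ∀ᶠ v in 𝓝 (t, Z t), HasFDerivAt (f · v.2) (F₁ v.1 v.2) v.1 := by
    filter_upwards [hn] with v hv using (h₁ v hv).hasFDerivAt
  have df₂ : ∀ᶠ v in 𝓝 (t, Z t), HasFDerivAt (f v.1 ·) (F₂ v.1 v.2) v.2 := by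
    filter_upwards [hn] with v hv using (h₂ v hv).hasFDerivAt
  have cf₁ : ContinuousAt ↿F₁ (t, Z t) :=
    (ContinuousLinearMap.toSpanSingletonCLE (𝕜 := ℝ) (E := ℝ)).continuous.continuousAt.comp
      (f := fun z : ℝ × ℝ => f₁ z.1 z.2) (c₁.continuousAt hn)
  have cf₂ : ContinuousAt ↿F₂ (t, Z t) :=
    (ContinuousLinearMap.toSpanSingletonCLE (𝕜 := ℝ) (E := ℝ)).continuous.continuousAt.comp
      (f := fun z : ℝ × ℝ => f₂ z.1 z.2) (c₂.continuousAt hn)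
  set e : ℝ ≃L[ℝ] ℝ := ContinuousLinearEquiv.unitsEquivAut ℝ (Units.mk0 _ hne) with he
  have hinv : F₂ t (Z t) = (e : ℝ →L[ℝ] ℝ) := by
    ext; simp [F₂, he]
  have hi : (F₂ (t, Z t).1 (t, Z t).2).IsInvertible := ⟨e, hinv.symm⟩
  have hψ := (hasStrictFDerivAt_implicitFunctionOfBivariate df₁ df₂ cf₁ cf₂ hi).hasFDerivAt
  have hev := eventually_apply_eq_iff_implicitFunctionOfBivariate df₁ df₂ cf₁ cf₂ hi
  have hcurve : Tendsto (fun s => (s, Z s)) (𝓝 t) (𝓝 (t, Z t)) :=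
    (continuousAt_id.prodMk hZ : ContinuousAt (fun s => (s, Z s)) t)
  have hZψ : Z =ᶠ[𝓝 t] implicitFunctionOfBivariate df₁ df₂ cf₁ cf₂ hi := by
    filter_upwards [hcurve.eventually hev, hη] with s hs hsη
    exact (hs.1 (by rw [hsη]; exact hη.self_of_nhds.symm)).symm
  have h := (hψ.congr_of_eventuallyEq hZψ).hasDerivAt
  refine h.congr_deriv ?_
  have : (F₂ t (Z t)).inverse = (e.symm : ℝ →L[ℝ] ℝ) := by
    rw [hinv, ContinuousLinearMap.inverse_equiv]
  simp [this, F₁, he, div_eq_mul_inv]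

end Calculus

/-! ### The Lagrangian system as an ordinary differential equation -/

section LagrangianSystem

theorem abs_exp_sub_exp_le {a b M : ℝ} (ha : a ≤ M) (hb : b ≤ M) :
    |Real.exp a - Real.exp b| ≤ Real.exp M * |a - b| := by
  wlog h : b ≤ a generalizing a b
  · rw [abs_sub_comm, abs_sub_comm a b]
    exact this hb ha (le_of_not_ge h)
  rw [abs_of_nonneg (sub_nonneg.2 (Real.exp_le_exp.2 h)), abs_of_nonneg (sub_nonneg.2 h)]
  have h1 : Real.exp b = Real.exp a * Real.exp (b - a) := by rw [← Real.exp_add]; ring_nf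
  have h2 := Real.add_one_le_exp (b - a)
  have h3 : Real.exp a * (a - b) ≤ Real.exp M * (a - b) :=
    mul_le_mul_of_nonneg_right (Real.exp_le_exp.2 ha) (sub_nonneg.2 h)
  nlinarith [Real.exp_pos a]

/-- Logarithm of the position of the particle with logarithmic label `ζ`, if the logarithm of the
stretching is `L` and the particle `R` does not move. -/
def position (R : ℝ) (L : ℝ → ℝ) (ζ : ℝ) : ℝ := R + ∫ s in R..ζ, Real.exp (L s)

theorem hasDerivAt_position (R : ℝ) {L : ℝ → ℝ} (hL : Continuous L) (ζ : ℝ) :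
    HasDerivAt (position R L) (Real.exp (L ζ)) ζ :=
  (intervalIntegral.integral_hasDerivAt_right
    ((Real.continuous_exp.comp hL).intervalIntegrable _ _)
    (Real.continuous_exp.comp hL).stronglyMeasurable.stronglyMeasurableAtFilter
    (Real.continuous_exp.comp hL).continuousAt).const_add R

theorem continuous_position (R : ℝ) {L : ℝ → ℝ} (hL : Continuous L) : Continuous (position R L) :=
  continuous_iff_continuousAt.2 fun ζ => (hasDerivAt_position R hL ζ).continuousAt

variable {β l R : ℝ} {P w₀ : ℝ → ℝ}

theorem abs_integral_le_of_mem {l R ζ C : ℝ} {f : ℝ → ℝ} (hζ : ζ ∈ Icc l R) (hC : 0 ≤ C)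
    (hf : ∀ s, |f s| ≤ C) : |∫ s in R..ζ, f s| ≤ (R - l) * C := by
  have h := intervalIntegral.norm_integral_le_of_norm_le_const (a := R) (b := ζ) (f := f) (C := C)
    fun s _ => hf s
  rw [Real.norm_eq_abs] at h
  have h2 : |ζ - R| ≤ R - l := by
    rw [abs_sub_comm, abs_of_nonneg (by linarith [hζ.2])]; linarith [hζ.1]
  calc _ ≤ C * |ζ - R| := h
    _ ≤ C * (R - l) := by gcongr
    _ = _ := mul_comm _ _

theorem abs_position_le {L : ℝ →ᵇ ℝ} {B ζ : ℝ} (hL : ‖L‖ ≤ B) (hζ : ζ ∈ Icc l R) :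
    |position R L ζ| ≤ |R| + (R - l) * Real.exp B := by
  refine (abs_add_le _ _).trans (add_le_add_right ?_ _)
  refine abs_integral_le_of_mem hζ (Real.exp_pos B).le fun s => ?_
  rw [abs_of_pos (Real.exp_pos _), Real.exp_le_exp]
  exact ((le_abs_self _).trans (L.norm_coe_le_norm s)).trans hL

theorem abs_position_sub_le {L L' : ℝ →ᵇ ℝ} {B ζ : ℝ} (hL : ‖L‖ ≤ B) (hL' : ‖L'‖ ≤ B)
    (hζ : ζ ∈ Icc l R) :
    |position R L ζ - position R L' ζ| ≤ (R - l) * (Real.exp B * ‖L - L'‖) := by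
  have h : position R L ζ - position R L' ζ
      = ∫ s in R..ζ, (Real.exp (L s) - Real.exp (L' s)) := by
    have hi : ∀ M : ℝ →ᵇ ℝ, IntervalIntegrable (fun s => Real.exp (M s)) volume R ζ := fun M =>
      (Real.continuous_exp.comp M.continuous).intervalIntegrable _ _
    rw [intervalIntegral.integral_sub (hi L) (hi L')]
    simp only [position]
    ring
  rw [h]
  refine abs_integral_le_of_mem hζ (by positivity) fun s => ?_
  refine (abs_exp_sub_exp_le (M := B) (((le_abs_self _).trans (L.norm_coe_le_norm s)).trans hL)
    (((le_abs_self _).trans (L'.norm_coe_le_norm s)).trans hL')).trans ?_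
  gcongr
  exact (L - L').norm_coe_le_norm s

/-- The rate of change `P e ^ (-β Y)` of the vorticity along particle trajectories is bounded in
terms of the stretching. -/
theorem abs_source_le {L : ℝ →ᵇ ℝ} {B C : ℝ} (hβ : 0 ≤ β) (hPC : ∀ ζ, |P ζ| ≤ C)
    (hP0 : ∀ ζ, ζ ∉ Icc l R → P ζ = 0) (hL : ‖L‖ ≤ B) (ζ : ℝ) :
    |P ζ * Real.exp (-β * position R L ζ)|
      ≤ C * Real.exp (β * (|R| + (R - l) * Real.exp B)) := by
  have hC : 0 ≤ C := (abs_nonneg _).trans (hPC ζ)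
  by_cases hζ : ζ ∈ Icc l R
  · rw [abs_mul, abs_of_pos (Real.exp_pos _)]
    refine mul_le_mul (hPC ζ) (Real.exp_le_exp.2 ?_) (Real.exp_pos _).le hC
    nlinarith [neg_abs_le (position R L ζ), abs_position_le hL hζ]
  · rw [hP0 ζ hζ, zero_mul, abs_zero]; positivity

/-- Local Lipschitz continuity of the right-hand side. As `P` vanishes off `[l, R]`, only positions
of labels in this bounded interval matter, and these depend on `L` in a Lipschitz way in the
supremum norm. -/
theorem abs_source_sub_le {L L' : ℝ →ᵇ ℝ} {B C : ℝ} (hβ : 0 ≤ β) (hlR : l ≤ R)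
    (hPC : ∀ ζ, |P ζ| ≤ C) (hP0 : ∀ ζ, ζ ∉ Icc l R → P ζ = 0) (hL : ‖L‖ ≤ B) (hL' : ‖L'‖ ≤ B)
    (ζ : ℝ) :
    |P ζ * Real.exp (-β * position R L ζ) - P ζ * Real.exp (-β * position R L' ζ)|
      ≤ C * (Real.exp (β * (|R| + (R - l) * Real.exp B)) *
        (β * ((R - l) * Real.exp B))) * ‖L - L'‖ := by
  have hC : 0 ≤ C := (abs_nonneg _).trans (hPC ζ)
  have hRl : 0 ≤ R - l := sub_nonneg.2 hlR
  by_cases hζ : ζ ∈ Icc l R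
  · rw [← mul_sub, abs_mul, mul_assoc]
    have h1 := abs_exp_sub_exp_le (a := -β * position R L ζ) (b := -β * position R L' ζ)
      (M := β * (|R| + (R - l) * Real.exp B))
      (by nlinarith [neg_abs_le (position R L ζ), abs_position_le hL hζ])
      (by nlinarith [neg_abs_le (position R L' ζ), abs_position_le hL' hζ])
    rw [← mul_sub, abs_mul, abs_neg, abs_of_nonneg hβ] at h1
    have h2 := abs_position_sub_le hL hL' hζ
    gcongr
    · exact hPC ζ
    · refine h1.trans ?_
      rw [mul_assoc (Real.exp _)]
      refine mul_le_mul_of_nonneg_left ?_ (Real.exp_pos _).le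
      rw [mul_assoc β]
      refine mul_le_mul_of_nonneg_left ?_ hβ
      rw [mul_assoc]; exact h2
  · rw [hP0 ζ hζ]; simp only [zero_mul, sub_zero, abs_zero]; positivity

/-- The system `L_t = Ω`, `Ω_t = P e ^ (-β Y)`, `Y_ζ = e ^ L` satisfied by the logarithm `L` of the
stretching, the vorticity `Ω` and the logarithm `Y` of the position as functions of time and the
logarithmic label, for data `w₀`, `P` supported in `[l, R]`. -/
structure LagrangianSolution (β l R τ S : ℝ) (P w₀ : ℝ → ℝ) (L Ω : ℝ → ℝ →ᵇ ℝ) : Prop where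
  τ_pos : 0 < τ
  S_pos : 0 < S
  contDiff_P : ContDiff ℝ 1 P
  contDiff_w : ContDiff ℝ 1 w₀
  P_eq_zero : ∀ ζ, ζ ∉ Icc l R → P ζ = 0
  w_eq_zero : ∀ ζ, ζ ∉ Icc l R → w₀ ζ = 0
  L_zero : L 0 = 0
  Ω_zero : ∀ ζ, Ω 0 ζ = w₀ ζ
  hasDerivAt_L : ∀ t ∈ Ioo (-τ) S, HasDerivAt L (Ω t) t
  continuousOn_Ω : ContinuousOn Ω (Ioo (-τ) S)
  hasDerivAt_Ω : ∀ t ∈ Ioo (-τ) S, ∀ ζ,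
    HasDerivAt (fun s => Ω s ζ) (P ζ * Real.exp (-β * position R (L t) ζ)) t

/-- The Lagrangian system has a solution which lives up to a prescribed time, unless the time
integral of the supremum norm of the vorticity is unbounded. -/
theorem exists_lagrangianSolution (hβ : 0 ≤ β) (hlR : l ≤ R) (hP : ContDiff ℝ 1 P)
    (hw : ContDiff ℝ 1 w₀) (hP0 : ∀ ζ, ζ ∉ Icc l R → P ζ = 0)
    (hw0 : ∀ ζ, ζ ∉ Icc l R → w₀ ζ = 0) {T : ℝ} (hT : 0 < T) :
    ∃ (τ S : ℝ) (L Ω : ℝ → ℝ →ᵇ ℝ), S ≤ T ∧ LagrangianSolution β l R τ S P w₀ L Ω ∧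
      (S = T ∨ ∀ B : ℝ, ∃ t ∈ Ico 0 S, B < ∫ s in (0 : ℝ)..t, ‖Ω s‖) := by
  obtain ⟨C, hPC⟩ := (HasCompactSupport.intro isCompact_Icc hP0).exists_bound_of_continuous
    hP.continuous
  obtain ⟨D, hwD⟩ := (HasCompactSupport.intro isCompact_Icc hw0).exists_bound_of_continuous
    hw.continuous
  have hC : 0 ≤ C := (abs_nonneg _).trans (hPC 0)
  set N : (ℝ →ᵇ ℝ) → ℝ →ᵇ ℝ := fun L =>
    BoundedContinuousFunction.ofNormedAddCommGroup
      (fun ζ => P ζ * Real.exp (-β * position R L ζ))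
      (hP.continuous.mul (Real.continuous_exp.comp
        (continuous_const.mul (continuous_position R L.continuous))))
      (C * Real.exp (β * (|R| + (R - l) * Real.exp ‖L‖)))
      (abs_source_le hβ hPC hP0 le_rfl) with hN
  set W : ℝ →ᵇ ℝ := BoundedContinuousFunction.ofNormedAddCommGroup w₀ hw.continuous D hwD
  have hNapp : ∀ L ζ, N L ζ = P ζ * Real.exp (-β * position R L ζ) := fun L ζ => rfl
  have hLip : ∀ B : ℝ, ∃ K : ℝ≥0, LipschitzOnWith K
      (fun x : (ℝ →ᵇ ℝ) × (ℝ →ᵇ ℝ) => (x.2, N x.1)) (closedBall 0 B) := by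
    intro B
    set K : ℝ≥0 := (C * (Real.exp (β * (|R| + (R - l) * Real.exp B)) *
        (β * ((R - l) * Real.exp B)))).toNNReal with hK
    have hRl : 0 ≤ R - l := sub_nonneg.2 hlR
    have hKc : (K : ℝ) = C * (Real.exp (β * (|R| + (R - l) * Real.exp B)) *
        (β * ((R - l) * Real.exp B))) := Real.coe_toNNReal _ (by positivity)
    refine ⟨max 1 (K * 1), LipschitzWith.prod_snd.lipschitzOnWith.prodMk ?_⟩
    have hNL : LipschitzOnWith K N (closedBall 0 B) := by
      refine LipschitzOnWith.of_dist_le_mul fun L hL L' hL' => ?_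
      rw [mem_closedBall, dist_zero_right] at hL hL'
      rw [BoundedContinuousFunction.dist_le (by positivity)]
      intro ζ
      rw [Real.dist_eq, hNapp, hNapp, hKc, dist_eq_norm]
      exact abs_source_sub_le hβ hlR hPC hP0 hL hL' ζ
    refine hNL.comp LipschitzWith.prod_fst.lipschitzOnWith fun x hx => ?_
    rw [mem_closedBall, dist_zero_right] at hx ⊢
    exact (norm_fst_le x).trans hx
  obtain ⟨τ, hτ, S, hS, hST, γ, hγ0, hγ, halt⟩ := exists_maximal_solution hLip (0, W) hT
  have hdL : ∀ t ∈ Ioo (-τ) S, HasDerivAt (fun t => (γ t).1) (γ t).2 t := fun t ht =>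
    (ContinuousLinearMap.fst ℝ (ℝ →ᵇ ℝ) (ℝ →ᵇ ℝ)).hasFDerivAt.comp_hasDerivAt t (hγ t ht)
  have hdΩ : ∀ t ∈ Ioo (-τ) S, HasDerivAt (fun t => (γ t).2) (N (γ t).1) t := fun t ht =>
    (ContinuousLinearMap.snd ℝ (ℝ →ᵇ ℝ) (ℝ →ᵇ ℝ)).hasFDerivAt.comp_hasDerivAt t (hγ t ht)
  have hcΩ : ContinuousOn (fun t => (γ t).2) (Ioo (-τ) S) := fun t ht =>
    (hdΩ t ht).continuousAt.continuousWithinAt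
  have h0mem : ∀ t ∈ Ico 0 S, uIcc 0 t ⊆ Ioo (-τ) S := fun t ht s hs => by
    rw [uIcc_of_le ht.1] at hs
    exact ⟨by linarith [hs.1], hs.2.trans_lt ht.2⟩
  refine ⟨τ, S, fun t => (γ t).1, fun t => (γ t).2, hST,
    ⟨hτ, hS, hP, hw, hP0, hw0, by rw [hγ0], fun ζ => by rw [hγ0]; rfl, hdL, hcΩ,
      fun t ht ζ => ?_⟩, halt.imp_right fun halt B => ?_⟩
  · exact (BoundedContinuousFunction.evalCLM ℝ ζ).hasFDerivAt.comp_hasDerivAt t (hdΩ t ht)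
  · by_contra! hcon
    set M := C * Real.exp (β * (|R| + (R - l) * Real.exp B))
    have hM : 0 ≤ M := by positivity
    -- If `∫ ‖Ω‖` stays below `B`, so does `‖L‖`, because `L` starts at zero and has derivative `Ω`.
    -- The source is then at most `M`, and `Ω` grows at most linearly. The whole curve is bounded,
    -- contrary to the alternative.
    have hLB : ∀ t ∈ Ico 0 S, ‖(γ t).1‖ ≤ B := by
      intro t ht
      have h := intervalIntegral.integral_eq_sub_of_hasDerivAt
        (fun s hs => hdL s (h0mem t ht hs)) ((hcΩ.mono (h0mem t ht)).intervalIntegrable)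
      rw [hγ0, sub_zero] at h
      rw [← h]
      exact (intervalIntegral.norm_integral_le_integral_norm ht.1).trans (hcon t ht)
    have hΩB : ∀ t ∈ Ico 0 S, ‖(γ t).2‖ ≤ ‖W‖ + M * S := by
      intro t ht
      have h : ‖(γ t).2 - (γ 0).2‖ ≤ M * ‖t - 0‖ := by
        refine (convex_uIcc 0 t).norm_image_sub_le_of_norm_hasDerivWithin_le
          (f := fun s => (γ s).2) (f' := fun s => N (γ s).1)
          (fun s hs => (hdΩ s (h0mem t ht hs)).hasDerivWithinAt) (fun s hs => ?_)
          left_mem_uIcc right_mem_uIcc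
        rw [uIcc_of_le ht.1] at hs
        rw [BoundedContinuousFunction.norm_le hM]
        exact abs_source_le hβ hPC hP0 (hLB s ⟨hs.1, hs.2.trans_lt ht.2⟩)
      rw [hγ0, sub_zero, Real.norm_of_nonneg ht.1] at h
      have h2 : ‖(γ t).2‖ ≤ ‖W‖ + ‖(γ t).2 - W‖ := by
        simpa using norm_add_le W ((γ t).2 - W)
      have h3 : M * t ≤ M * S := mul_le_mul_of_nonneg_left ht.2.le hM
      dsimp only at h
      linarith
    obtain ⟨t, ht, hlt⟩ := halt (max B (‖W‖ + M * S))
    rw [Prod.norm_def] at hlt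
    exact absurd hlt (not_lt.2 (max_le_max (hLB t ht) (hΩB t ht)))

end LagrangianSystem

/-! ### Joint continuity in time and label -/

section Continuity

theorem continuous_position_uncurry (R : ℝ) :
    Continuous fun z : (ℝ →ᵇ ℝ) × ℝ => position R z.1 z.2 := by
  refine continuous_const.add
    (intervalIntegral.continuous_parametric_intervalIntegral_of_continuous
      (f := fun (z : (ℝ →ᵇ ℝ) × ℝ) s => Real.exp (z.1 s)) ?_ continuous_snd)
  have : Continuous fun p : ((ℝ →ᵇ ℝ) × ℝ) × ℝ => p.1.1 p.2 :=
    continuous_eval.comp (by fun_prop : Continuous fun p : ((ℝ →ᵇ ℝ) × ℝ) × ℝ => (p.1.1, p.2))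
  exact Real.continuous_exp.comp this

/-- The velocity, in the logarithmic variable, of the particle with label `ζ`. -/
def particleVelocity (R : ℝ) (L Ω : ℝ → ℝ) (ζ : ℝ) : ℝ := ∫ s in R..ζ, Real.exp (L s) * Ω s

theorem continuous_particleVelocity_uncurry (R : ℝ) :
    Continuous fun z : (ℝ →ᵇ ℝ) × (ℝ →ᵇ ℝ) × ℝ => particleVelocity R z.1 z.2.1 z.2.2 := by
  refine intervalIntegral.continuous_parametric_intervalIntegral_of_continuous
      (f := fun (z : (ℝ →ᵇ ℝ) × (ℝ →ᵇ ℝ) × ℝ) s => Real.exp (z.1 s) * z.2.1 s) ?_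
      (continuous_snd.comp continuous_snd)
  have h1 : Continuous fun p : ((ℝ →ᵇ ℝ) × (ℝ →ᵇ ℝ) × ℝ) × ℝ => p.1.1 p.2 :=
    continuous_eval.comp
      (by fun_prop : Continuous fun p : ((ℝ →ᵇ ℝ) × (ℝ →ᵇ ℝ) × ℝ) × ℝ => (p.1.1, p.2))
  have h2 : Continuous fun p : ((ℝ →ᵇ ℝ) × (ℝ →ᵇ ℝ) × ℝ) × ℝ => p.1.2.1 p.2 :=
    continuous_eval.comp
      (by fun_prop : Continuous fun p : ((ℝ →ᵇ ℝ) × (ℝ →ᵇ ℝ) × ℝ) × ℝ => (p.1.2.1, p.2))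
  exact (Real.continuous_exp.comp h1).mul h2

theorem hasDerivAt_particleVelocity (R : ℝ) {L Ω : ℝ → ℝ} (hL : Continuous L) (hΩ : Continuous Ω)
    (ζ : ℝ) : HasDerivAt (particleVelocity R L Ω) (Real.exp (L ζ) * Ω ζ) ζ := by
  have hc : Continuous fun s => Real.exp (L s) * Ω s := by fun_prop
  exact intervalIntegral.integral_hasDerivAt_right (hc.intervalIntegrable _ _)
    hc.stronglyMeasurable.stronglyMeasurableAtFilter hc.continuousAt

/-- The time integral of a jointly continuous function is jointly continuous. -/
theorem continuousOn_integral_of_continuousOn {K : ℝ → ℝ → ℝ} {a b : ℝ} (h0 : (0 : ℝ) ∈ Ioo a b)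
    (hK : ContinuousOn (fun z : ℝ × ℝ => K z.1 z.2) (Ioo a b ×ˢ univ)) :
    ContinuousOn (fun z : ℝ × ℝ => ∫ s in (0 : ℝ)..z.1, K s z.2) (Ioo a b ×ˢ univ) := by
  intro z hz
  obtain ⟨a', ha, ha'⟩ := exists_between (lt_min h0.1 hz.1.1)
  obtain ⟨b', hb', hb⟩ := exists_between (max_lt h0.2 hz.1.2)
  rw [lt_min_iff] at ha'
  rw [max_lt_iff] at hb'
  have hab : a' ≤ b' := by linarith [ha'.1, hb'.1]
  -- Clamping the time to `[a', b']` makes the integrand continuous everywhere without changing the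
  -- integral for times near `z.1`.
  have hcont : Continuous fun p : (ℝ × ℝ) × ℝ => K (projIcc a' b' hab p.2) p.1.2 := by
    refine hK.comp_continuous
      (f := fun p : (ℝ × ℝ) × ℝ => ((projIcc a' b' hab p.2 : ℝ), p.1.2)) ?_ fun p => ⟨?_, trivial⟩
    · exact (continuous_subtype_val.comp (continuous_projIcc.comp continuous_snd)).prodMk
        (by fun_prop)
    · exact ⟨ha.trans_le (projIcc a' b' hab p.2).2.1, (projIcc a' b' hab p.2).2.2.trans_lt hb⟩
  have h1 := intervalIntegral.continuous_parametric_intervalIntegral_of_continuous (μ := volume)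
    (a₀ := 0) (f := fun (z : ℝ × ℝ) s => K (projIcc a' b' hab s) z.2) hcont continuous_fst
  refine (h1.continuousAt.congr ?_).continuousWithinAt
  have hn : {p : ℝ × ℝ | p.1 ∈ Ioo a' b'} ∈ 𝓝 z :=
    continuous_fst.continuousAt (Ioo_mem_nhds ha'.2 hb'.2)
  filter_upwards [hn] with p hp
  refine intervalIntegral.integral_congr fun s hs => ?_
  have hs' : s ∈ Icc a' b' :=
    (ordConnected_Icc.uIcc_subset ⟨ha'.1.le, hb'.1.le⟩ ⟨hp.1.le, hp.2.le⟩) hs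
  simp only [projIcc_of_mem hab hs']

theorem eq_of_hasDerivAt_zero {f : ℝ → ℝ} {a b s t : ℝ} (hs : s ∈ Ioo a b) (ht : t ∈ Ioo a b)
    (h : ∀ r ∈ Ioo a b, HasDerivAt f 0 r) : f s = f t := by
  have := (convex_Ioo a b).norm_image_sub_le_of_norm_hasDerivWithin_le (C := 0)
    (fun r hr => (h r hr).hasDerivWithinAt) (fun r _ => by simp) ht hs
  rw [zero_mul] at this
  exact sub_eq_zero.1 (norm_le_zero_iff.1 this)

end Continuity

/-- The label of the particle which is at logarithmic position `η`. -/
def label (R : ℝ) (L : ℝ → ℝ) : ℝ → ℝ := Function.invFun (position R L)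

/-! ### The flow map and its inverse -/

namespace LagrangianSolution

variable {β l R τ S : ℝ} {P w₀ : ℝ → ℝ} {L Ω : ℝ → ℝ →ᵇ ℝ}

theorem zero_mem (h : LagrangianSolution β l R τ S P w₀ L Ω) : (0 : ℝ) ∈ Ioo (-τ) S :=
  ⟨neg_lt_zero.2 h.τ_pos, h.S_pos⟩

theorem uIcc_subset (h : LagrangianSolution β l R τ S P w₀ L Ω) {t : ℝ} (ht : t ∈ Ioo (-τ) S) :
    uIcc 0 t ⊆ Ioo (-τ) S := ordConnected_Ioo.uIcc_subset h.zero_mem ht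

theorem Ico_subset (h : LagrangianSolution β l R τ S P w₀ L Ω) : Ico 0 S ⊆ Ioo (-τ) S :=
  fun _ ht => ⟨h.zero_mem.1.trans_le ht.1, ht.2⟩

theorem isOpen_domain (τ S : ℝ) : IsOpen (Ioo (-τ) S ×ˢ (univ : Set ℝ)) := isOpen_Ioo.prod isOpen_univ

theorem continuousOn_L (h : LagrangianSolution β l R τ S P w₀ L Ω) : ContinuousOn L (Ioo (-τ) S) :=
  fun t ht => (h.hasDerivAt_L t ht).continuousAt.continuousWithinAt

theorem continuousOn_L_uncurry (h : LagrangianSolution β l R τ S P w₀ L Ω) :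
    ContinuousOn (fun z : ℝ × ℝ => L z.1 z.2) (Ioo (-τ) S ×ˢ univ) :=
  continuous_eval.comp_continuousOn ((h.continuousOn_L.comp continuousOn_fst fun _ hz => hz.1).prodMk
    continuousOn_snd)

theorem continuousOn_Ω_uncurry (h : LagrangianSolution β l R τ S P w₀ L Ω) :
    ContinuousOn (fun z : ℝ × ℝ => Ω z.1 z.2) (Ioo (-τ) S ×ˢ univ) :=
  continuous_eval.comp_continuousOn ((h.continuousOn_Ω.comp continuousOn_fst fun _ hz => hz.1).prodMk
    continuousOn_snd)

theorem continuousOn_position (h : LagrangianSolution β l R τ S P w₀ L Ω) :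
    ContinuousOn (fun z : ℝ × ℝ => position R (L z.1) z.2) (Ioo (-τ) S ×ˢ univ) :=
  (continuous_position_uncurry R).comp_continuousOn
    ((h.continuousOn_L.comp continuousOn_fst fun _ hz => hz.1).prodMk continuousOn_snd)

theorem continuousOn_particleVelocity (h : LagrangianSolution β l R τ S P w₀ L Ω) :
    ContinuousOn (fun z : ℝ × ℝ => particleVelocity R (L z.1) (Ω z.1) z.2)
      (Ioo (-τ) S ×ˢ univ) :=
  (continuous_particleVelocity_uncurry R).comp_continuousOn
    ((h.continuousOn_L.comp continuousOn_fst fun _ hz => hz.1).prodMk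
      ((h.continuousOn_Ω.comp continuousOn_fst fun _ hz => hz.1).prodMk continuousOn_snd))

theorem hasDerivAt_L_apply (h : LagrangianSolution β l R τ S P w₀ L Ω) {t : ℝ}
    (ht : t ∈ Ioo (-τ) S) (ζ : ℝ) : HasDerivAt (fun s => L s ζ) (Ω t ζ) t :=
  (BoundedContinuousFunction.evalCLM ℝ ζ : (ℝ →ᵇ ℝ) →L[ℝ] ℝ).hasFDerivAt.comp_hasDerivAt t (h.hasDerivAt_L t ht)

theorem Ω_eq_zero (h : LagrangianSolution β l R τ S P w₀ L Ω) {t : ℝ} (ht : t ∈ Ioo (-τ) S)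
    {ζ : ℝ} (hζ : ζ ∉ Icc l R) : Ω t ζ = 0 := by
  rw [eq_of_hasDerivAt_zero (f := fun s => Ω s ζ) ht h.zero_mem fun r hr => by
    simpa [h.P_eq_zero ζ hζ] using h.hasDerivAt_Ω r hr ζ, h.Ω_zero, h.w_eq_zero ζ hζ]

theorem L_eq_zero (h : LagrangianSolution β l R τ S P w₀ L Ω) {t : ℝ} (ht : t ∈ Ioo (-τ) S)
    {ζ : ℝ} (hζ : ζ ∉ Icc l R) : L t ζ = 0 := by
  rw [eq_of_hasDerivAt_zero (f := fun s => L s ζ) ht h.zero_mem fun r hr => by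
    simpa [h.Ω_eq_zero hr hζ] using h.hasDerivAt_L_apply hr ζ, h.L_zero]
  rfl

theorem hasDerivAt_position_time (h : LagrangianSolution β l R τ S P w₀ L Ω) {t : ℝ}
    (ht : t ∈ Ioo (-τ) S) (ζ : ℝ) :
    HasDerivAt (fun s => position R (L s) ζ) (particleVelocity R (L t) (Ω t) ζ) t := by
  refine (hasDerivAt_integral_of_continuousOn (f := fun t s => Real.exp (L t s))
    (f' := fun t s => Real.exp (L t s) * Ω t s) isOpen_Ioo ht
    (fun t _ => (Real.continuous_exp.comp (L t).continuous).continuousOn) ?_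
    fun t ht s _ => (h.hasDerivAt_L_apply ht s).exp).const_add R
  exact ((Real.continuous_exp.comp_continuousOn h.continuousOn_L_uncurry).mul
    h.continuousOn_Ω_uncurry).mono (prod_mono Subset.rfl (subset_univ _))

theorem position_zero (h : LagrangianSolution β l R τ S P w₀ L Ω) (ζ : ℝ) :
    position R (L 0) ζ = ζ := by
  simp [position, h.L_zero]

theorem position_of_ge (h : LagrangianSolution β l R τ S P w₀ L Ω) {t : ℝ} (ht : t ∈ Ioo (-τ) S)
    {ζ : ℝ} (hζ : R ≤ ζ) : position R (L t) ζ = ζ := by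
  have : ∫ s in R..ζ, Real.exp (L t s) = ∫ s in R..ζ, (1 : ℝ) := by
    refine intervalIntegral.integral_congr_ae (.of_forall fun s hs => ?_)
    rw [uIoc_of_le hζ] at hs
    rw [h.L_eq_zero ht fun hs' => not_lt.2 hs'.2 hs.1, Real.exp_zero]
  rw [position, this]; simp

theorem particleVelocity_of_ge (h : LagrangianSolution β l R τ S P w₀ L Ω) {t : ℝ}
    (ht : t ∈ Ioo (-τ) S) {ζ : ℝ} (hζ : R ≤ ζ) : particleVelocity R (L t) (Ω t) ζ = 0 := by
  refine intervalIntegral.integral_zero_ae (.of_forall fun s hs => ?_)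
  rw [uIoc_of_le hζ] at hs
  rw [h.Ω_eq_zero ht fun hs' => not_lt.2 hs'.2 hs.1, mul_zero]

theorem position_of_le (h : LagrangianSolution β l R τ S P w₀ L Ω) {t : ℝ} (ht : t ∈ Ioo (-τ) S)
    {ζ : ℝ} (hζ : ζ ≤ l) : position R (L t) ζ = position R (L t) l + (ζ - l) := by
  have hi : ∀ a b : ℝ, IntervalIntegrable (fun s => Real.exp (L t s)) volume a b := fun a b =>
    (Real.continuous_exp.comp (L t).continuous).intervalIntegrable _ _
  have : ∫ s in l..ζ, Real.exp (L t s) = ∫ s in l..ζ, (1 : ℝ) := by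
    rw [intervalIntegral.integral_symm, intervalIntegral.integral_symm ζ]
    congr 1
    -- The endpoint `l` belongs to `[l, R]`, where `L` is not known to vanish. It is discarded as a
    -- null set.
    rw [intervalIntegral.integral_of_le hζ, intervalIntegral.integral_of_le hζ,
      integral_Ioc_eq_integral_Ioo, integral_Ioc_eq_integral_Ioo]
    refine setIntegral_congr_fun measurableSet_Ioo fun s hs => ?_
    rw [h.L_eq_zero ht fun hs' => not_lt.2 hs'.1 hs.2, Real.exp_zero]
  rw [position, position, ← intervalIntegral.integral_add_adjacent_intervals (hi R l) (hi l ζ), this]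
  simp [add_assoc]

theorem strictMono_position (R : ℝ) (f : ℝ →ᵇ ℝ) : StrictMono (position R f) :=
  strictMono_of_hasDerivAt_pos (fun ζ => hasDerivAt_position R f.continuous ζ)
    fun _ => Real.exp_pos _

/-- Beyond `R` the flow map is the identity, and below `l` it is a translation, so it is unbounded
in both directions. -/
theorem surjective_position (h : LagrangianSolution β l R τ S P w₀ L Ω) {t : ℝ}
    (ht : t ∈ Ioo (-τ) S) : Function.Surjective (position R (L t)) := by
  refine (continuous_position R (L t).continuous).surjective ?_ ?_
  · refine tendsto_id.congr' ?_
    filter_upwards [eventually_ge_atTop R] with ζ hζ using (h.position_of_ge ht hζ).symm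
  · refine (tendsto_atBot_add_const_left _ (position R (L t) l - l) tendsto_id).congr' ?_
    filter_upwards [eventually_le_atBot l] with ζ hζ
    rw [h.position_of_le ht hζ, id]; ring

theorem position_label (h : LagrangianSolution β l R τ S P w₀ L Ω) {t : ℝ} (ht : t ∈ Ioo (-τ) S)
    (η : ℝ) : position R (L t) (label R (L t) η) = η :=
  Function.rightInverse_invFun (h.surjective_position ht) η

theorem label_position (R : ℝ) (f : ℝ →ᵇ ℝ) (ζ : ℝ) : label R f (position R f ζ) = ζ :=
  Function.leftInverse_invFun (strictMono_position R f).injective ζ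

theorem label_lt_iff (h : LagrangianSolution β l R τ S P w₀ L Ω) {t : ℝ} (ht : t ∈ Ioo (-τ) S)
    {η ζ : ℝ} : label R (L t) η < ζ ↔ η < position R (L t) ζ := by
  rw [← (strictMono_position R (L t)).lt_iff_lt, h.position_label ht]

theorem lt_label_iff (h : LagrangianSolution β l R τ S P w₀ L Ω) {t : ℝ} (ht : t ∈ Ioo (-τ) S)
    {η ζ : ℝ} : ζ < label R (L t) η ↔ position R (L t) ζ < η := by
  rw [← (strictMono_position R (L t)).lt_iff_lt, h.position_label ht]

/-- By monotonicity, `label < ζ` and `label > ζ` are strict inequalities between `η` and the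
position of `ζ`. Since the position is continuous in time, these are open conditions in `(t, η)`. -/
theorem continuousOn_label (h : LagrangianSolution β l R τ S P w₀ L Ω) :
    ContinuousOn (fun z : ℝ × ℝ => label R (L z.1) z.2) (Ioo (-τ) S ×ˢ univ) := by
  intro z hz
  have hn : ∀ᶠ z' in 𝓝 z, z' ∈ Ioo (-τ) S ×ˢ (univ : Set ℝ) := (isOpen_domain τ S).mem_nhds hz
  have hc : ∀ ζ : ℝ, ContinuousAt (fun z : ℝ × ℝ => position R (L z.1) ζ) z := fun ζ =>
    ContinuousAt.comp (f := fun z : ℝ × ℝ => (z.1, ζ))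
      (h.continuousOn_position.continuousAt ((isOpen_domain τ S).mem_nhds ⟨hz.1, trivial⟩))
      (by fun_prop)
  refine ContinuousAt.continuousWithinAt (tendsto_order.2 ⟨fun ζ hζ => ?_, fun ζ hζ => ?_⟩)
  · rw [h.lt_label_iff hz.1] at hζ
    filter_upwards [hn, (hc ζ).eventually_lt continuousAt_snd hζ] with z' hz' hlt
    exact (h.lt_label_iff hz'.1).2 hlt
  · replace hζ := (h.label_lt_iff hz.1).1 hζ
    filter_upwards [hn, continuousAt_snd.eventually_lt (hc ζ) hζ] with z' hz' hlt
    exact (h.label_lt_iff hz'.1).2 hlt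

theorem hasDerivAt_label_space (h : LagrangianSolution β l R τ S P w₀ L Ω) {t : ℝ}
    (ht : t ∈ Ioo (-τ) S) (η : ℝ) :
    HasDerivAt (label R (L t)) (Real.exp (L t (label R (L t) η)))⁻¹ η := by
  refine HasDerivAt.of_local_left_inverse ?_ (hasDerivAt_position R (L t).continuous _)
    (Real.exp_pos _).ne' (.of_forall fun η => h.position_label ht η)
  exact ContinuousAt.comp (f := fun η => (t, η))
    (h.continuousOn_label.continuousAt ((isOpen_domain τ S).mem_nhds ⟨ht, trivial⟩)) (by fun_prop)

theorem hasDerivAt_label_time (h : LagrangianSolution β l R τ S P w₀ L Ω) {t : ℝ}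
    (ht : t ∈ Ioo (-τ) S) (η : ℝ) :
    HasDerivAt (fun s => label R (L s) η)
      (-(particleVelocity R (L t) (Ω t) (label R (L t) η)) /
        Real.exp (L t (label R (L t) η))) t := by
  refine hasDerivAt_of_implicit (f := fun t ζ => position R (L t) ζ)
    (f₁ := fun t ζ => particleVelocity R (L t) (Ω t) ζ) (f₂ := fun t ζ => Real.exp (L t ζ))
    (η := η) (isOpen_domain τ S) (fun z hz => h.hasDerivAt_position_time hz.1 z.2)
    (fun z _ => hasDerivAt_position R (L z.1).continuous z.2) h.continuousOn_particleVelocity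
    (Real.continuous_exp.comp_continuousOn h.continuousOn_L_uncurry) ⟨ht, trivial⟩
    (Real.exp_pos _).ne' ?_ ?_
  · exact ContinuousAt.comp (f := fun s => (s, η))
      (h.continuousOn_label.continuousAt ((isOpen_domain τ S).mem_nhds ⟨ht, trivial⟩)) (by fun_prop)
  · filter_upwards [isOpen_Ioo.mem_nhds ht] with s hs using h.position_label hs η

/-- This formula supplies the regularity in the label. The equation was solved among functions that
are only continuous, but the position is differentiable in `ζ` with derivative `e^L`, so the
right-hand side can be differentiated. -/
theorem Ω_eq (h : LagrangianSolution β l R τ S P w₀ L Ω) {t : ℝ} (ht : t ∈ Ioo (-τ) S) (ζ : ℝ) :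
    Ω t ζ = w₀ ζ + P ζ * ∫ s in (0 : ℝ)..t, Real.exp (-β * position R (L s) ζ) := by
  have hc : ContinuousOn (fun s => P ζ * Real.exp (-β * position R (L s) ζ)) (uIcc 0 t) := by
    have : ContinuousOn (fun s => position R (L s) ζ) (uIcc 0 t) :=
      h.continuousOn_position.comp (f := fun s => (s, ζ)) (by fun_prop)
        fun s hs => ⟨h.uIcc_subset ht hs, trivial⟩
    fun_prop
  have := intervalIntegral.integral_eq_sub_of_hasDerivAt
    (fun s hs => h.hasDerivAt_Ω s (h.uIcc_subset ht hs) ζ) hc.intervalIntegrable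
  rw [intervalIntegral.integral_const_mul, h.Ω_zero] at this
  linarith

/-- The derivative of the vorticity with respect to the label. -/
def vorticityGradient (β R : ℝ) (P w₀ : ℝ → ℝ) (L : ℝ → ℝ →ᵇ ℝ) (t ζ : ℝ) : ℝ :=
  deriv w₀ ζ + (deriv P ζ * (∫ s in (0 : ℝ)..t, Real.exp (-β * position R (L s) ζ)) +
    P ζ * ∫ s in (0 : ℝ)..t,
      Real.exp (-β * position R (L s) ζ) * (-β * Real.exp (L s ζ)))

theorem hasDerivAt_Ω_label (h : LagrangianSolution β l R τ S P w₀ L Ω) {t : ℝ}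
    (ht : t ∈ Ioo (-τ) S) (ζ : ℝ) :
    HasDerivAt (Ω t) (vorticityGradient β R P w₀ L t ζ) ζ := by
  have h1 : HasDerivAt w₀ (deriv w₀ ζ) ζ :=
    (h.contDiff_w.differentiable one_ne_zero).differentiableAt.hasDerivAt
  have h2 : HasDerivAt P (deriv P ζ) ζ :=
    (h.contDiff_P.differentiable one_ne_zero).differentiableAt.hasDerivAt
  have hpos : ContinuousOn (fun z : ℝ × ℝ => position R (L z.2) z.1) (univ ×ˢ uIcc 0 t) :=
    h.continuousOn_position.comp (f := Prod.swap) continuous_swap.continuousOn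
      fun z hz => ⟨h.uIcc_subset ht hz.2, trivial⟩
  have hL : ContinuousOn (fun z : ℝ × ℝ => L z.2 z.1) (univ ×ˢ uIcc 0 t) :=
    h.continuousOn_L_uncurry.comp (f := Prod.swap) continuous_swap.continuousOn
      fun z hz => ⟨h.uIcc_subset ht hz.2, trivial⟩
  have h3 := hasDerivAt_integral_of_continuousOn
    (f := fun ζ s => Real.exp (-β * position R (L s) ζ))
    (f' := fun ζ s => Real.exp (-β * position R (L s) ζ) * (-β * Real.exp (L s ζ)))
    (a := 0) (b := t) isOpen_univ (mem_univ ζ)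
    (fun ζ _ => by
      have : ContinuousOn (fun s => position R (L s) ζ) (uIcc 0 t) :=
        hpos.comp (f := fun s => (ζ, s)) (by fun_prop) fun s hs => ⟨trivial, hs⟩
      fun_prop)
    ((continuousOn_const.mul hpos).rexp.mul (continuousOn_const.mul hL.rexp))
    fun ζ _ s _ => ((hasDerivAt_position R (L s).continuous ζ).const_mul (-β)).exp
  refine (h1.add (h2.mul h3)).congr_of_eventuallyEq (.of_forall fun ζ => h.Ω_eq ht ζ)

theorem continuousOn_vorticityGradient (h : LagrangianSolution β l R τ S P w₀ L Ω) :
    ContinuousOn (fun z : ℝ × ℝ => vorticityGradient β R P w₀ L z.1 z.2)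
      (Ioo (-τ) S ×ˢ univ) := by
  have hpos := h.continuousOn_position
  have hL := h.continuousOn_L_uncurry
  have h1 := continuousOn_integral_of_continuousOn
    (K := fun s ζ => Real.exp (-β * position R (L s) ζ)) h.zero_mem (by fun_prop)
  have h2 := continuousOn_integral_of_continuousOn
    (K := fun s ζ => Real.exp (-β * position R (L s) ζ) * (-β * Real.exp (L s ζ))) h.zero_mem
    (by fun_prop)
  have hw := h.contDiff_w.continuous_deriv le_rfl
  have hP := h.contDiff_P.continuous_deriv le_rfl
  have hP' := h.contDiff_P.continuous
  unfold vorticityGradient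
  fun_prop

theorem continuousOn_source (h : LagrangianSolution β l R τ S P w₀ L Ω) :
    ContinuousOn (fun z : ℝ × ℝ => P z.2 * Real.exp (-β * position R (L z.1) z.2))
      (Ioo (-τ) S ×ˢ univ) := by
  have hpos := h.continuousOn_position
  have hP' := h.contDiff_P.continuous
  fun_prop

end LagrangianSolution

/-- The function of time and position which takes the value `F t ζ` at the particle with label
`ζ`. -/
def eulerian (R : ℝ) (L : ℝ → ℝ →ᵇ ℝ) (F : ℝ → ℝ → ℝ) (t x : ℝ) : ℝ :=
  if 0 < x then F t (label R (L t) (Real.log x)) else 0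

theorem eulerian_of_pos (R : ℝ) (L : ℝ → ℝ →ᵇ ℝ) (F : ℝ → ℝ → ℝ) (t : ℝ) {x : ℝ} (hx : 0 < x) :
    eulerian R L F t x = F t (label R (L t) (Real.log x)) := if_pos hx

theorem eulerian_of_nonpos (R : ℝ) (L : ℝ → ℝ →ᵇ ℝ) (F : ℝ → ℝ → ℝ) (t : ℝ) {x : ℝ} (hx : x ≤ 0) :
    eulerian R L F t x = 0 := if_neg (not_lt.2 hx)

theorem eulerian_exp_position (R : ℝ) (L : ℝ → ℝ →ᵇ ℝ) (F : ℝ → ℝ → ℝ) (t ζ : ℝ) :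
    eulerian R L F t (Real.exp (position R (L t) ζ)) = F t ζ := by
  rw [eulerian_of_pos _ _ _ _ (Real.exp_pos _), Real.log_exp,
    LagrangianSolution.label_position]

/-- Values on the half-line are values at labels, and every label sits at some point of the
half-line, so both suprema agree. -/
theorem supNorm_eulerian (R : ℝ) (L Ω : ℝ → ℝ →ᵇ ℝ) (t : ℝ) :
    supNorm (eulerian R L (fun t => Ω t) t) = ‖Ω t‖ := by
  have hle : ∀ x : Ioi (0 : ℝ), |eulerian R L (fun t => Ω t) t x| ≤ ‖Ω t‖ := fun x => by
    rw [eulerian_of_pos _ _ _ _ x.2]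
    exact (Ω t).norm_coe_le_norm _
  have hbdd : BddAbove (range fun x : Ioi (0 : ℝ) => |eulerian R L (fun t => Ω t) t x|) :=
    ⟨‖Ω t‖, by rintro _ ⟨x, rfl⟩; exact hle x⟩
  refine le_antisymm (ciSup_le hle) ?_
  have h0 : 0 ≤ supNorm (eulerian R L (fun t => Ω t) t) :=
    (abs_nonneg _).trans (le_ciSup hbdd ⟨1, mem_Ioi.2 one_pos⟩)
  refine (BoundedContinuousFunction.norm_le h0).2 fun ζ => ?_
  have := le_ciSup hbdd ⟨Real.exp (position R (L t) ζ), Real.exp_pos _⟩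
  rwa [eulerian_exp_position] at this

/-- A continuous function vanishing far out has an integrable quotient by the variable. -/
theorem integrableOn_div_Ioi {w : ℝ → ℝ} (hw : Continuous w) {x M : ℝ} (hx : 0 < x)
    (hM : ∀ y, M < y → w y = 0) : IntegrableOn (fun y => w y / y) (Ioi x) := by
  have h1 : IntegrableOn (fun y => w y / y) (Icc x M) := by
    refine ContinuousOn.integrableOn_Icc (hw.continuousOn.div continuousOn_id fun y hy => ?_)
    exact (hx.trans_le hy.1).ne'
  have h2 : IntegrableOn (fun y => w y / y) (Ioi M) :=
    integrableOn_zero.congr_fun (fun y hy => by simp [hM y hy]) measurableSet_Ioi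
  exact (h1.union h2).mono_set fun y hy => by
    rcases le_or_gt y M with h | h
    · exact Or.inl ⟨le_of_lt hy, h⟩
    · exact Or.inr h

/-! ### Passage to Eulerian variables -/

namespace LagrangianSolution

variable {β l R τ S : ℝ} {P w₀ : ℝ → ℝ} {L Ω : ℝ → ℝ →ᵇ ℝ}

/-- A function of time and label, with continuous partial derivatives `F₁` and `F₂`, supported in
`[l, R]`. -/
structure LabelFunction (l R τ S : ℝ) (F F₁ F₂ : ℝ → ℝ → ℝ) : Prop where
  hasDerivAt_time : ∀ z ∈ Ioo (-τ) S ×ˢ (univ : Set ℝ),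
    HasDerivAt (fun t => F t z.2) (F₁ z.1 z.2) z.1
  hasDerivAt_label : ∀ z ∈ Ioo (-τ) S ×ˢ (univ : Set ℝ),
    HasDerivAt (fun x => F z.1 x) (F₂ z.1 z.2) z.2
  continuousOn_time : ContinuousOn (fun z : ℝ × ℝ => F₁ z.1 z.2) (Ioo (-τ) S ×ˢ univ)
  continuousOn_label : ContinuousOn (fun z : ℝ × ℝ => F₂ z.1 z.2) (Ioo (-τ) S ×ˢ univ)
  eq_zero : ∀ t ∈ Ioo (-τ) S, ∀ ζ, ζ ∉ Icc l R → F t ζ = 0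

theorem labelFunction_Ω (h : LagrangianSolution β l R τ S P w₀ L Ω) :
    LabelFunction l R τ S (fun t => Ω t) (fun t ζ => P ζ * Real.exp (-β * position R (L t) ζ))
      (vorticityGradient β R P w₀ L) where
  hasDerivAt_time z hz := h.hasDerivAt_Ω z.1 hz.1 z.2
  hasDerivAt_label z hz := h.hasDerivAt_Ω_label hz.1 z.2
  continuousOn_time := h.continuousOn_source
  continuousOn_label := h.continuousOn_vorticityGradient
  eq_zero _ ht _ hζ := h.Ω_eq_zero ht hζ

theorem labelFunction_P (h : LagrangianSolution β l R τ S P w₀ L Ω) :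
    LabelFunction l R τ S (fun _ => P) (fun _ _ => 0) (fun _ => deriv P) where
  hasDerivAt_time z _ := hasDerivAt_const z.1 (P z.2)
  hasDerivAt_label z _ :=
    (h.contDiff_P.differentiable one_ne_zero).differentiableAt.hasDerivAt
  continuousOn_time := continuousOn_const
  continuousOn_label := by
    have := h.contDiff_P.continuous_deriv le_rfl
    fun_prop
  eq_zero _ _ ζ hζ := h.P_eq_zero ζ hζ

section Eulerian

variable {F F₁ F₂ : ℝ → ℝ → ℝ}

theorem LabelFunction.continuousOn (hF : LabelFunction l R τ S F F₁ F₂) :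
    ContinuousOn (fun z : ℝ × ℝ => F z.1 z.2) (Ioo (-τ) S ×ˢ univ) := fun _ hz =>
  (hasStrictFDerivAt_of_partials (isOpen_domain τ S) hF.hasDerivAt_time hF.hasDerivAt_label
    hF.continuousOn_time hF.continuousOn_label hz).hasFDerivAt.continuousAt.continuousWithinAt

/-- The label of a particle is a continuous function of time and position. -/
theorem continuousAt_comp_label (h : LagrangianSolution β l R τ S P w₀ L Ω) {G : ℝ → ℝ → ℝ}
    (hG : ContinuousOn (fun z : ℝ × ℝ => G z.1 z.2) (Ioo (-τ) S ×ˢ univ)) {z : ℝ × ℝ}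
    (hz : z.1 ∈ Ioo (-τ) S) (hx : 0 < z.2) :
    ContinuousAt (fun z : ℝ × ℝ => G z.1 (label R (L z.1) (Real.log z.2))) z := by
  have h1 : ContinuousAt (fun z : ℝ × ℝ => label R (L z.1) (Real.log z.2)) z :=
    ContinuousAt.comp (f := fun z : ℝ × ℝ => (z.1, Real.log z.2))
      (h.continuousOn_label.continuousAt ((isOpen_domain τ S).mem_nhds ⟨hz, trivial⟩))
      (continuousAt_fst.prodMk (continuousAt_snd.log hx.ne'))
  exact ContinuousAt.comp (f := fun z : ℝ × ℝ => (z.1, label R (L z.1) (Real.log z.2)))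
      (hG.continuousAt ((isOpen_domain τ S).mem_nhds ⟨hz, trivial⟩)) (continuousAt_fst.prodMk h1)

theorem hasDerivAt_eulerian_space (h : LagrangianSolution β l R τ S P w₀ L Ω)
    (hF : LabelFunction l R τ S F F₁ F₂) {t x : ℝ} (ht : t ∈ Ioo (-τ) S) (hx : 0 < x) :
    HasDerivAt (eulerian R L F t)
      (F₂ t (label R (L t) (Real.log x)) *
        ((Real.exp (L t (label R (L t) (Real.log x))))⁻¹ * x⁻¹)) x := by
  have h1 := (h.hasDerivAt_label_space ht (Real.log x)).comp x (Real.hasDerivAt_log hx.ne')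
  have h2 := (hF.hasDerivAt_label (t, label R (L t) (Real.log x)) ⟨ht, trivial⟩).comp x h1
  refine h2.congr_of_eventuallyEq ?_
  filter_upwards [Ioi_mem_nhds hx] with y hy using eulerian_of_pos _ _ _ _ hy

theorem hasDerivAt_eulerian_time (h : LagrangianSolution β l R τ S P w₀ L Ω)
    (hF : LabelFunction l R τ S F F₁ F₂) {t x : ℝ} (ht : t ∈ Ioo (-τ) S) (hx : 0 < x) :
    HasDerivAt (fun s => eulerian R L F s x)
      (F₁ t (label R (L t) (Real.log x)) + F₂ t (label R (L t) (Real.log x)) *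
        (-(particleVelocity R (L t) (Ω t) (label R (L t) (Real.log x))) /
          Real.exp (L t (label R (L t) (Real.log x))))) t := by
  have h2 := hasDerivAt_comp_of_partials (isOpen_domain τ S) hF.hasDerivAt_time hF.hasDerivAt_label
    hF.continuousOn_time hF.continuousOn_label
    (X := fun s => label R (L s) (Real.log x)) ⟨ht, trivial⟩
    (h.hasDerivAt_label_time ht (Real.log x))
  exact h2.congr_of_eventuallyEq (.of_forall fun s => eulerian_of_pos _ _ _ _ hx)

theorem eulerian_eq_zero (h : LagrangianSolution β l R τ S P w₀ L Ω)
    (hF : LabelFunction l R τ S F F₁ F₂) {t x : ℝ} (ht : t ∈ Ioo (-τ) S)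
    (hx : x < Real.exp (position R (L t) l)) : eulerian R L F t x = 0 := by
  rcases le_or_gt x 0 with h0 | h0
  · exact eulerian_of_nonpos _ _ _ _ h0
  · rw [eulerian_of_pos _ _ _ _ h0]
    refine hF.eq_zero t ht _ fun hm => ?_
    rw [← Real.log_lt_iff_lt_exp h0, ← h.label_lt_iff ht] at hx
    exact not_lt.2 hm.1 hx

theorem isOpen_left_region (h : LagrangianSolution β l R τ S P w₀ L Ω) :
    IsOpen {z : ℝ × ℝ | z.1 ∈ Ioo (-τ) S ∧ z.2 < Real.exp (position R (L z.1) l)} := by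
  have hc : ContinuousOn (fun z : ℝ × ℝ => Real.exp (position R (L z.1) l) - z.2)
      (Ioo (-τ) S ×ˢ univ) := by
    have := h.continuousOn_position.comp (f := fun z : ℝ × ℝ => (z.1, l))
      (s := Ioo (-τ) S ×ˢ univ) (by fun_prop) fun z hz => ⟨hz.1, trivial⟩
    exact (Real.continuous_exp.comp_continuousOn this).sub continuousOn_snd
  convert hc.isOpen_inter_preimage (isOpen_domain τ S) isOpen_Ioi (t := Ioi 0) using 1
  ext z
  simp

/-- The support stays strictly to the right of the origin. Vanishing near every nearby point, rather
than only at it, makes both partial derivatives vanish there too, so the extension by zero is `C¹`.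
-/
theorem eulerian_eventually_zero (h : LagrangianSolution β l R τ S P w₀ L Ω)
    (hF : LabelFunction l R τ S F F₁ F₂) {z : ℝ × ℝ} (hz : z.1 ∈ Ioo (-τ) S) (hx : z.2 ≤ 0) :
    ∀ᶠ z' in 𝓝 z, ∀ᶠ z'' in 𝓝 z', eulerian R L F z''.1 z''.2 = 0 := by
  refine eventually_eventually_nhds.2 ?_
  filter_upwards [h.isOpen_left_region.mem_nhds ⟨hz, hx.trans_lt (Real.exp_pos _)⟩] with z' hz'
  exact h.eulerian_eq_zero hF hz'.1 hz'.2

theorem continuousOn_eulerian (h : LagrangianSolution β l R τ S P w₀ L Ω)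
    (hF : LabelFunction l R τ S F F₁ F₂) :
    ContinuousOn (fun z : ℝ × ℝ => eulerian R L F z.1 z.2) (Ioo (-τ) S ×ˢ univ) := by
  intro z hz
  refine ContinuousAt.continuousWithinAt ?_
  rcases le_or_gt z.2 0 with hx | hx
  · refine (continuousAt_const (y := (0 : ℝ))).congr ?_
    filter_upwards [h.eulerian_eventually_zero hF hz.1 hx] with z' hz' using hz'.self_of_nhds.symm
  · refine (h.continuousAt_comp_label hF.continuousOn hz.1 hx).congr ?_
    filter_upwards [continuousAt_snd (Ioi_mem_nhds hx)] with z' hz'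
    exact (eulerian_of_pos _ _ _ _ hz').symm

theorem continuousOn_deriv_eulerian (h : LagrangianSolution β l R τ S P w₀ L Ω)
    (hF : LabelFunction l R τ S F F₁ F₂) :
    ContinuousOn (fun z : ℝ × ℝ => deriv (eulerian R L F z.1) z.2) (Ioo (-τ) S ×ˢ univ) := by
  intro z hz
  refine ContinuousAt.continuousWithinAt ?_
  rcases le_or_gt z.2 0 with hx | hx
  · refine (continuousAt_const (y := (0 : ℝ))).congr ?_
    filter_upwards [h.eulerian_eventually_zero hF hz.1 hx] with z' hz'
    have hev : ∀ᶠ x in 𝓝 z'.2, eulerian R L F z'.1 x = 0 :=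
      (Continuous.prodMk_right z'.1).continuousAt.eventually (p := fun z => eulerian R L F z.1 z.2 = 0)
        hz'
    exact ((hasDerivAt_const z'.2 (0 : ℝ)).congr_of_eventuallyEq hev).deriv.symm
  · have h1 := h.continuousAt_comp_label (G := fun t ζ => F₂ t ζ * (Real.exp (L t ζ))⁻¹)
      (hF.continuousOn_label.mul ((Real.continuous_exp.comp_continuousOn
        h.continuousOn_L_uncurry).inv₀ fun _ _ => (Real.exp_pos _).ne')) hz.1 hx
    refine (h1.mul (continuousAt_snd.inv₀ hx.ne')).congr ?_
    filter_upwards [continuousAt_snd (Ioi_mem_nhds hx), (isOpen_domain τ S).mem_nhds hz]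
      with z' hz' hzD
    rw [(h.hasDerivAt_eulerian_space hF hzD.1 hz').deriv, Pi.mul_apply, Pi.inv_apply, mul_assoc]

theorem continuousOn_deriv_time_eulerian (h : LagrangianSolution β l R τ S P w₀ L Ω)
    (hF : LabelFunction l R τ S F F₁ F₂) :
    ContinuousOn (fun z : ℝ × ℝ => deriv (fun s => eulerian R L F s z.2) z.1)
      (Ioo (-τ) S ×ˢ univ) := by
  intro z hz
  refine ContinuousAt.continuousWithinAt ?_
  rcases le_or_gt z.2 0 with hx | hx
  · refine (continuousAt_const (y := (0 : ℝ))).congr ?_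
    filter_upwards [h.eulerian_eventually_zero hF hz.1 hx] with z' hz'
    have hev : ∀ᶠ s in 𝓝 z'.1, eulerian R L F s z'.2 = 0 :=
      (Continuous.prodMk_left z'.2).continuousAt.eventually (p := fun z => eulerian R L F z.1 z.2 = 0)
        hz'
    exact ((hasDerivAt_const z'.1 (0 : ℝ)).congr_of_eventuallyEq hev).deriv.symm
  · have h1 := h.continuousAt_comp_label
      (G := fun t ζ => F₁ t ζ + F₂ t ζ * (-(particleVelocity R (L t) (Ω t) ζ) / Real.exp (L t ζ)))
      (hF.continuousOn_time.add (hF.continuousOn_label.mul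
        (h.continuousOn_particleVelocity.neg.div (Real.continuous_exp.comp_continuousOn
        h.continuousOn_L_uncurry) fun _ _ => (Real.exp_pos _).ne'))) hz.1 hx
    refine h1.congr ?_
    filter_upwards [continuousAt_snd (Ioi_mem_nhds hx), (isOpen_domain τ S).mem_nhds hz]
      with z' hz' hzD
    rw [(h.hasDerivAt_eulerian_time hF hzD.1 hz').deriv]

theorem differentiableAt_eulerian_space (h : LagrangianSolution β l R τ S P w₀ L Ω)
    (hF : LabelFunction l R τ S F F₁ F₂) {t : ℝ} (ht : t ∈ Ioo (-τ) S) (x : ℝ) :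
    DifferentiableAt ℝ (eulerian R L F t) x := by
  rcases le_or_gt x 0 with hx | hx
  · have hev : ∀ᶠ y in 𝓝 x, eulerian R L F t y = 0 :=
      ((Continuous.prodMk_right t).continuousAt (x := x)).eventually
        (p := fun z => eulerian R L F z.1 z.2 = 0)
        (h.eulerian_eventually_zero hF (z := (t, x)) ht hx).self_of_nhds
    exact ((hasDerivAt_const x (0 : ℝ)).congr_of_eventuallyEq hev).differentiableAt
  · exact (h.hasDerivAt_eulerian_space hF ht hx).differentiableAt

theorem differentiableAt_eulerian_time (h : LagrangianSolution β l R τ S P w₀ L Ω)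
    (hF : LabelFunction l R τ S F F₁ F₂) {t : ℝ} (ht : t ∈ Ioo (-τ) S) (x : ℝ) :
    DifferentiableAt ℝ (fun s => eulerian R L F s x) t := by
  rcases le_or_gt x 0 with hx | hx
  · simp only [eulerian_of_nonpos _ _ _ _ hx]
    exact differentiableAt_const _
  · exact (h.hasDerivAt_eulerian_time hF ht hx).differentiableAt

theorem derivWithin_eulerian_time (h : LagrangianSolution β l R τ S P w₀ L Ω)
    (hF : LabelFunction l R τ S F F₁ F₂) {t : ℝ} (ht : t ∈ Ico 0 S) (x : ℝ) :
    derivWithin (fun s => eulerian R L F s x) (Ico 0 S) t = deriv (fun s => eulerian R L F s x) t :=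
  (h.differentiableAt_eulerian_time hF (h.Ico_subset ht) x).derivWithin
    (uniqueDiffOn_Ico 0 S t ht)

theorem inSolutionSpace_eulerian (h : LagrangianSolution β l R τ S P w₀ L Ω)
    (hF : LabelFunction l R τ S F F₁ F₂) : InSolutionSpace S (eulerian R L F) where
  contDiff_space t ht := by
    refine contDiff_one_iff_deriv.2
      ⟨fun x => h.differentiableAt_eulerian_space hF (h.Ico_subset ht) x, ?_⟩
    exact (h.continuousOn_deriv_eulerian hF).comp_continuous (Continuous.prodMk_right t)
      fun x => ⟨h.Ico_subset ht, trivial⟩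
  support_subset T' hT' := by
    have hsub : Icc 0 T' ⊆ Ioo (-τ) S := fun t ht => h.Ico_subset ⟨ht.1, ht.2.trans_lt hT'.2⟩
    have hc : ContinuousOn (fun t => position R (L t) l) (Icc 0 T') :=
      h.continuousOn_position.comp (f := fun t => (t, l)) (by fun_prop)
        fun t ht => ⟨hsub ht, trivial⟩
    obtain ⟨c, hc⟩ := isCompact_Icc.bddBelow_image hc
    refine ⟨Real.exp c, Real.exp R, Real.exp_pos _, fun t ht x hx => ?_⟩
    have hge : Real.exp (position R (L t) l) ≤ x := by
      by_contra! hlt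
      exact hx (h.eulerian_eq_zero hF (hsub ht) hlt)
    have hpos : 0 < x := (Real.exp_pos _).trans_le hge
    refine ⟨(Real.exp_le_exp.2 (hc (mem_image_of_mem _ ht))).trans hge, ?_⟩
    by_contra! hlt
    refine hx ?_
    rw [eulerian_of_pos _ _ _ _ hpos]
    refine hF.eq_zero t (hsub ht) _ fun hm => not_lt.2 hm.2 ?_
    rw [h.lt_label_iff (hsub ht), h.position_of_ge (hsub ht) le_rfl]
    exact (Real.lt_log_iff_exp_lt hpos).2 hlt
  continuous_self := (h.continuousOn_eulerian hF).mono (prod_mono h.Ico_subset Subset.rfl)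
  continuous_dx := (h.continuousOn_deriv_eulerian hF).mono (prod_mono h.Ico_subset Subset.rfl)
  differentiable_time x t ht :=
    (h.differentiableAt_eulerian_time hF (h.Ico_subset ht) x).differentiableWithinAt
  continuous_dt := ((h.continuousOn_deriv_time_eulerian hF).mono
    (prod_mono h.Ico_subset Subset.rfl)).congr fun z hz => h.derivWithin_eulerian_time hF hz.1 z.2

end Eulerian

/-- The particle velocity, as a function of the position `y`, is an antiderivative of `ω(y) / y`
that vanishes beyond `e^R`. This closes the loop: the flow built from `L` is the flow of the
nonlocal velocity. -/
theorem Q_eulerian (h : LagrangianSolution β l R τ S P w₀ L Ω) {t x : ℝ} (ht : t ∈ Ioo (-τ) S)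
    (hx : 0 < x) : Q (eulerian R L (fun t => Ω t) t) x =
      -particleVelocity R (L t) (Ω t) (label R (L t) (Real.log x)) := by
  have hd : ∀ y, 0 < y → HasDerivAt
      (fun y => particleVelocity R (L t) (Ω t) (label R (L t) (Real.log y)))
      (eulerian R L (fun t => Ω t) t y / y) y := by
    intro y hy
    have h1 := (h.hasDerivAt_label_space ht (Real.log y)).comp y (Real.hasDerivAt_log hy.ne')
    have h2 := (hasDerivAt_particleVelocity R (L t).continuous (Ω t).continuous _).comp y h1
    refine h2.congr_deriv ?_
    rw [eulerian_of_pos _ _ _ _ hy]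
    have := (Real.exp_pos (L t (label R (L t) (Real.log y)))).ne'
    simp only [Function.comp_apply]
    field_simp
  have hlab : ∀ y, Real.exp R < y → R < label R (L t) (Real.log y) := fun y hy => by
    rw [h.lt_label_iff ht, h.position_of_ge ht le_rfl]
    exact (Real.lt_log_iff_exp_lt ((Real.exp_pos R).trans hy)).2 hy
  have hcont : Continuous (eulerian R L (fun t => Ω t) t) := continuous_iff_continuousAt.2
    fun x => (h.differentiableAt_eulerian_space h.labelFunction_Ω ht x).continuousAt
  have hlim : Tendsto (fun y => particleVelocity R (L t) (Ω t) (label R (L t) (Real.log y))) atTop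
      (𝓝 0) := by
    refine tendsto_const_nhds.congr' ?_
    filter_upwards [eventually_gt_atTop (Real.exp R)] with y hy
    exact (h.particleVelocity_of_ge ht (hlab y hy).le).symm
  have hint := integrableOn_div_Ioi hcont hx (M := Real.exp R) fun y hy => by
    rw [eulerian_of_pos _ _ _ _ ((Real.exp_pos R).trans hy)]
    exact h.Ω_eq_zero ht fun hm => not_lt.2 hm.2 (hlab y hy)
  rw [Q, integral_Ioi_of_hasDerivAt_of_tendsto (hd x hx).continuousAt.continuousWithinAt
    (fun y hy => hd y (hx.trans hy)) hint hlim, zero_sub]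

theorem velocity_eulerian (h : LagrangianSolution β l R τ S P w₀ L Ω) {t x : ℝ}
    (ht : t ∈ Ioo (-τ) S) (hx : 0 < x) : velocity (eulerian R L (fun t => Ω t) t) x =
      x * particleVelocity R (L t) (Ω t) (label R (L t) (Real.log x)) := by
  rw [velocity, h.Q_eulerian ht hx, neg_mul_neg]

/-- The label is constant along trajectories, so the contributions of the label derivative `F₂`
cancel in the material derivative. -/
theorem transport_eulerian (h : LagrangianSolution β l R τ S P w₀ L Ω) {F F₁ F₂ : ℝ → ℝ → ℝ}
    (hF : LabelFunction l R τ S F F₁ F₂) {t x : ℝ} (ht : t ∈ Ico 0 S) (hx : 0 < x) :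
    derivWithin (fun s => eulerian R L F s x) (Ico 0 S) t +
      velocity (eulerian R L (fun t => Ω t) t) x * deriv (eulerian R L F t) x =
      F₁ t (label R (L t) (Real.log x)) := by
  have ht' := h.Ico_subset ht
  rw [h.derivWithin_eulerian_time hF ht, (h.hasDerivAt_eulerian_time hF ht' hx).deriv,
    (h.hasDerivAt_eulerian_space hF ht' hx).deriv, h.velocity_eulerian ht' hx]
  field_simp
  ring

/-- The Lagrangian solution yields a smooth solution of the original system. -/
theorem isSmoothSolution (h : LagrangianSolution β l R τ S P w₀ L Ω) {ω₀ ρ₀ : ℝ → ℝ}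
    (hω : ∀ x ≤ 0, ω₀ x = 0) (hρ : ∀ x ≤ 0, ρ₀ x = 0) (hωw : ∀ ζ, ω₀ (Real.exp ζ) = w₀ ζ)
    (hρP : ∀ ζ, ρ₀ (Real.exp ζ) = P ζ) :
    IsSmoothSolution β S ω₀ ρ₀ (eulerian R L fun t => Ω t) (eulerian R L fun _ => P) where
  mem_ω := h.inSolutionSpace_eulerian h.labelFunction_Ω
  mem_ρ := h.inSolutionSpace_eulerian h.labelFunction_P
  init_ω := by
    ext x
    rcases le_or_gt x 0 with hx | hx
    · rw [eulerian_of_nonpos _ _ _ _ hx, hω x hx]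
    · conv_lhs => rw [← Real.exp_log hx, ← h.position_zero (Real.log x), eulerian_exp_position,
        h.Ω_zero, ← hωw, Real.exp_log hx]
  init_ρ := by
    ext x
    rcases le_or_gt x 0 with hx | hx
    · rw [eulerian_of_nonpos _ _ _ _ hx, hρ x hx]
    · conv_lhs => rw [← Real.exp_log hx, ← h.position_zero (Real.log x), eulerian_exp_position,
        ← hρP, Real.exp_log hx]
  eq_ω t ht x hx := by
    rw [h.transport_eulerian h.labelFunction_Ω ht hx, eulerian_of_pos _ _ _ _ hx,
      h.position_label (h.Ico_subset ht), Real.rpow_def_of_pos hx, div_eq_mul_inv, ← Real.exp_neg]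
    congr 2; ring
  eq_ρ t ht x hx := h.transport_eulerian h.labelFunction_P ht hx

/-- The image of a particle label under the flow is a trajectory. -/
theorem isTrajectory (h : LagrangianSolution β l R τ S P w₀ L Ω) {A₀ : ℝ} (hA : 0 < A₀) :
    IsTrajectory S A₀ (eulerian R L fun t => Ω t)
      (fun t => Real.exp (position R (L t) (Real.log A₀))) where
  init := by rw [h.position_zero, Real.exp_log hA]
  hasDeriv t ht := by
    have ht' := h.Ico_subset ht
    rw [h.velocity_eulerian ht' (Real.exp_pos _), Real.log_exp, label_position]
    exact (h.hasDerivAt_position_time ht' _).exp.hasDerivWithinAt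

end LagrangianSolution

/-! ### Uniqueness and maximality -/

namespace InSolutionSpace

variable {T : ℝ} {f : ℝ → ℝ → ℝ}

/-- Derivative along a particle trajectory. -/
theorem hasDerivAt_comp (hf : InSolutionSpace T f) {X : ℝ → ℝ} {v t : ℝ} (ht : t ∈ Ioo 0 T)
    (hX : HasDerivAt X v t) :
    HasDerivAt (fun s => f s (X s))
      (derivWithin (fun s => f s (X t)) (Ico 0 T) t + v * deriv (f t) (X t)) t := by
  have hsub : Ioo 0 T ×ˢ (univ : Set ℝ) ⊆ Ico 0 T ×ˢ univ := prod_mono Ioo_subset_Ico_self Subset.rfl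
  rw [mul_comm v]
  refine hasDerivAt_comp_of_partials (f := f)
    (f₁ := fun t x => derivWithin (fun s => f s x) (Ico 0 T) t) (f₂ := fun t x => deriv (f t) x)
    (isOpen_Ioo.prod isOpen_univ) (fun z hz => ?_) (fun z hz => ?_) (hf.continuous_dt.mono hsub)
    (hf.continuous_dx.mono hsub) ⟨ht, trivial⟩ hX
  · exact (hf.differentiable_time z.2 z.1
      (Ioo_subset_Ico_self hz.1)).hasDerivWithinAt.hasDerivAt (Ico_mem_nhds hz.1.1 hz.1.2)
  · exact ((hf.contDiff_space z.1 (Ioo_subset_Ico_self hz.1)).differentiable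
      one_ne_zero).differentiableAt.hasDerivAt

/-- On a compact time interval the function and its spatial derivative are bounded and supported
in a compact subset of the half-line. -/
theorem exists_bounds (hf : InSolutionSpace T f) {T' : ℝ} (hT' : T' ∈ Ico 0 T) :
    ∃ a b C : ℝ, 0 < a ∧ ∀ t ∈ Icc 0 T', ∀ x,
      (x ∉ Icc a b → f t x = 0 ∧ deriv (f t) x = 0) ∧ |f t x| ≤ C ∧ |deriv (f t) x| ≤ C := by
  obtain ⟨a, b, ha, hab⟩ := hf.support_subset T' hT'
  have hsub : Icc 0 T' ×ˢ Icc a b ⊆ Ico 0 T ×ˢ univ :=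
    prod_mono (fun t ht => ⟨ht.1, ht.2.trans_lt hT'.2⟩) (subset_univ _)
  have hcomp : IsCompact (Icc 0 T' ×ˢ Icc a b) := isCompact_Icc.prod isCompact_Icc
  obtain ⟨C₁, h₁⟩ := hcomp.exists_bound_of_continuousOn (hf.continuous_self.mono hsub)
  obtain ⟨C₂, h₂⟩ := hcomp.exists_bound_of_continuousOn (hf.continuous_dx.mono hsub)
  have hzero : ∀ t ∈ Icc 0 T', ∀ x, x ∉ Icc a b → f t x = 0 := fun t ht x hx => by
    by_contra h
    exact hx (hab t ht h)
  have hzero' : ∀ t ∈ Icc 0 T', ∀ x, x ∉ Icc a b → deriv (f t) x = 0 := fun t ht x hx => by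
    have : f t =ᶠ[𝓝 x] fun _ => 0 := by
      filter_upwards [isClosed_Icc.isOpen_compl.mem_nhds hx] with y hy using hzero t ht y hy
    rw [this.deriv_eq, deriv_const]
  refine ⟨a, b, max 0 (max C₁ C₂), ha, fun t ht x => ⟨fun hx => ⟨hzero t ht x hx, hzero' t ht x hx⟩, ?_⟩⟩
  by_cases hx : x ∈ Icc a b
  · exact ⟨(h₁ (t, x) ⟨ht, hx⟩).trans (by simp), (h₂ (t, x) ⟨ht, hx⟩).trans (by simp)⟩
  · rw [hzero t ht x hx, hzero' t ht x hx]
    simp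

theorem continuousOn_comp (hf : InSolutionSpace T f) {X : ℝ → ℝ} {s : Set ℝ}
    (hs : s ⊆ Ico 0 T) (hX : ContinuousOn X s) : ContinuousOn (fun t => f t (X t)) s :=
  hf.continuous_self.comp (f := fun t => (t, X t)) (continuousOn_id.prodMk hX)
    fun _ ht => ⟨hs ht, trivial⟩

end InSolutionSpace

/-- The velocity depends continuously on the vorticity, uniformly on compact sets. -/
theorem abs_velocity_sub_le {w w' : ℝ → ℝ} {a b M x : ℝ} (ha : 0 < a) (hw : Continuous w)
    (hw' : Continuous w') (hb : ∀ y, b < y → w y = 0) (hb' : ∀ y, b < y → w' y = 0)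
    (hM : ∀ y, |w' y - w y| ≤ M) (hx : x ∈ Icc a b) :
    |velocity w x - velocity w' x| ≤ b * (M / a * (b - a)) := by
  have hx0 : 0 < x := ha.trans_le hx.1
  have hM0 : 0 ≤ M := (abs_nonneg _).trans (hM 0)
  have h1 : velocity w x - velocity w' x = x * ∫ y in Ioc x b, (w' y - w y) / y := by
    have : ∫ y in Ioc x b, (w' y - w y) / y = ∫ y in Ioi x, (w' y - w y) / y := by
      refine (setIntegral_eq_of_subset_of_forall_sdiff_eq_zero measurableSet_Ioi
        (fun y hy => hy.1) fun y hy => ?_).symm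
      have hy' : b < y := by
        by_contra! hle
        exact hy.2 ⟨hy.1, hle⟩
      rw [hb y hy', hb' y hy', sub_zero, zero_div]
    rw [this]
    simp only [sub_div]
    rw [integral_sub (integrableOn_div_Ioi hw' hx0 hb') (integrableOn_div_Ioi hw hx0 hb)]
    simp only [velocity, Q]
    ring
  have h2 : ‖∫ y in Ioc x b, (w' y - w y) / y‖ ≤ M / a * volume.real (Ioc x b) := by
    refine norm_setIntegral_le_of_norm_le_const (by simp) fun y hy => ?_
    have hy0 : 0 < y := hx0.trans hy.1
    rw [Real.norm_eq_abs, abs_div, abs_of_pos hy0]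
    have : a ≤ y := hx.1.trans hy.1.le
    gcongr
    exact hM y
  rw [Real.volume_real_Ioc_of_le hx.2, Real.norm_eq_abs] at h2
  rw [h1, abs_mul, abs_of_pos hx0]
  have h3 : M / a * (b - x) ≤ M / a * (b - a) := by
    have := hx.1
    gcongr
  have hb0 : 0 ≤ b := hx0.le.trans hx.2
  exact mul_le_mul hx.2 (h2.trans h3) (abs_nonneg _) hb0

/-- The exponential weight gains a factor one half: `2c ≤ K` makes `B / 2 * e^{Ks}` grow at least as
fast as `±f`. -/
theorem abs_le_half_mul_exp {f f' : ℝ → ℝ} {t c B K : ℝ} (ht : 0 ≤ t) (hB : 0 ≤ B)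
    (hcK : 2 * c ≤ K) (hf : ContinuousOn f (Icc 0 t)) (hd : ∀ s ∈ Ioo 0 t, HasDerivAt f (f' s) s)
    (hf' : ∀ s ∈ Ioo 0 t, |f' s| ≤ c * (B * Real.exp (K * s))) (h0 : f 0 = 0) :
    |f t| ≤ B / 2 * Real.exp (K * t) := by
  have key : ∀ σ : ℝ, |σ| = 1 → 0 ≤ B / 2 * Real.exp (K * t) - σ * f t := by
    intro σ hσ
    have hder : ∀ s ∈ Ioo 0 t, HasDerivAt (fun s => B / 2 * Real.exp (K * s) - σ * f s)
        (B / 2 * (Real.exp (K * s) * (K * 1)) - σ * f' s) s := fun s hs =>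
      (((hasDerivAt_id s).const_mul K).exp.const_mul (B / 2)).sub ((hd s hs).const_mul σ)
    have hmono : MonotoneOn (fun s => B / 2 * Real.exp (K * s) - σ * f s) (Icc 0 t) := by
      refine monotoneOn_of_deriv_nonneg (convex_Icc 0 t) (by fun_prop) ?_ ?_ <;>
        rw [interior_Icc]
      · exact fun s hs => (hder s hs).differentiableAt.differentiableWithinAt
      · intro s hs
        rw [(hder s hs).deriv]
        have h1 : σ * f' s ≤ c * (B * Real.exp (K * s)) := by
          refine (le_abs_self _).trans ?_
          rw [abs_mul, hσ, one_mul]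
          exact hf' s hs
        have h2 : 0 ≤ B * Real.exp (K * s) := by positivity
        nlinarith
    have := hmono ⟨le_rfl, ht⟩ ⟨ht, le_rfl⟩ ht
    simp only [h0, mul_zero, sub_zero, Real.exp_zero] at this
    linarith
  have h1 := key 1 (by simp)
  have h2 := key (-1) (by simp)
  rw [abs_le]
  constructor <;> linarith

/-- A family of trajectories of the velocity field of `ω` which covers the half-line at every
time. -/
structure IsFlow (S : ℝ) (ω X : ℝ → ℝ → ℝ) : Prop where
  pos : ∀ t ∈ Ico 0 S, ∀ ζ, 0 < X t ζ
  continuousOn : ∀ ζ, ContinuousOn (fun t => X t ζ) (Ico 0 S)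
  hasDerivAt : ∀ t ∈ Ioo 0 S, ∀ ζ, HasDerivAt (fun s => X s ζ) (velocity (ω t) (X t ζ)) t
  exists_eq : ∀ t ∈ Ico 0 S, ∀ x, 0 < x → ∃ ζ, X t ζ = x

/-- Two smooth solutions with the same data coincide on their common interval of existence. -/
theorem IsSmoothSolution.eq_of_isFlow {β S T : ℝ} {ω₀ ρ₀ : ℝ → ℝ} {ω ρ ω' ρ' X : ℝ → ℝ → ℝ}
    (hβ : 0 ≤ β) (h : IsSmoothSolution β S ω₀ ρ₀ ω ρ) (h' : IsSmoothSolution β T ω₀ ρ₀ ω' ρ')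
    (hX : IsFlow S ω X) {t : ℝ} (ht : t ∈ Ico 0 (min S T)) : ω' t = ω t ∧ ρ' t = ρ t := by
  have htS : t ∈ Ico 0 S := ⟨ht.1, ht.2.trans_le (min_le_left _ _)⟩
  have htT : t ∈ Ico 0 T := ⟨ht.1, ht.2.trans_le (min_le_right _ _)⟩
  obtain ⟨a₁, b₁, C₁, ha₁, h₁⟩ := h.mem_ω.exists_bounds htS
  obtain ⟨a₂, b₂, C₂, ha₂, h₂⟩ := h.mem_ρ.exists_bounds htS
  obtain ⟨a₃, b₃, C₃, ha₃, h₃⟩ := h'.mem_ω.exists_bounds htT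
  obtain ⟨a₄, b₄, C₄, ha₄, h₄⟩ := h'.mem_ρ.exists_bounds htT
  set a := min (min a₁ a₂) (min a₃ a₄)
  set b := max (max a (max b₁ b₂)) (max b₃ b₄)
  set C := max (max C₁ C₂) (max C₃ C₄)
  have ha : 0 < a := lt_min (lt_min ha₁ ha₂) (lt_min ha₃ ha₄)
  have hab : a ≤ b := (le_max_left _ _).trans (le_max_left _ _)
  have hout : ∀ s ∈ Icc 0 t, ∀ x, x ∉ Icc a b → ω s x = 0 ∧ ρ s x = 0 ∧ ω' s x = 0 ∧ ρ' s x = 0 ∧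
      deriv (ω' s) x = 0 ∧ deriv (ρ' s) x = 0 := by
    intro s hs x hx
    have e₁ : x ∉ Icc a₁ b₁ := fun hm => hx ⟨(by simp [a] : a ≤ a₁).trans hm.1, hm.2.trans (by simp [b])⟩
    have e₂ : x ∉ Icc a₂ b₂ := fun hm => hx ⟨(by simp [a] : a ≤ a₂).trans hm.1, hm.2.trans (by simp [b])⟩
    have e₃ : x ∉ Icc a₃ b₃ := fun hm => hx ⟨(by simp [a] : a ≤ a₃).trans hm.1, hm.2.trans (by simp [b])⟩
    have e₄ : x ∉ Icc a₄ b₄ := fun hm => hx ⟨(by simp [a] : a ≤ a₄).trans hm.1, hm.2.trans (by simp [b])⟩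
    exact ⟨((h₁ s hs x).1 e₁).1, ((h₂ s hs x).1 e₂).1, ((h₃ s hs x).1 e₃).1, ((h₄ s hs x).1 e₄).1,
      ((h₃ s hs x).1 e₃).2, ((h₄ s hs x).1 e₄).2⟩
  have hbd : ∀ s ∈ Icc 0 t, ∀ x, |ω s x| ≤ C ∧ |ρ s x| ≤ C ∧ |ω' s x| ≤ C ∧ |ρ' s x| ≤ C ∧
      |deriv (ω' s) x| ≤ C ∧ |deriv (ρ' s) x| ≤ C := by
    intro s hs x
    exact ⟨(h₁ s hs x).2.1.trans (by simp [C]), (h₂ s hs x).2.1.trans (by simp [C]),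
      (h₃ s hs x).2.1.trans (by simp [C]), (h₄ s hs x).2.1.trans (by simp [C]),
      (h₃ s hs x).2.2.trans (by simp [C]), (h₄ s hs x).2.2.trans (by simp [C])⟩
  have hC : 0 ≤ C := (abs_nonneg _).trans (hbd 0 ⟨le_rfl, ht.1⟩ 0).1
  -- The first term controls `(ρ' - ρ) / x^β`. The second controls the velocity difference times a
  -- spatial derivative bounded by `C`.
  set c := 1 / a ^ β + b * (1 / a * (b - a)) * C with hc_def
  have hb0 : 0 < b := ha.trans_le hab
  have hba : 0 ≤ b - a := sub_nonneg.2 hab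
  have hc1 : 0 ≤ 1 / a ^ β := by positivity
  have hc2 : 0 ≤ b * (1 / a * (b - a)) * C := by positivity
  set K := 2 * c
  have hKc : 2 * c ≤ K := le_rfl
  have hK : 0 ≤ K := by positivity
  have hcontX : ∀ ζ, ∀ s ∈ Icc 0 t, ContinuousOn (fun r => X r ζ) (Icc 0 s) := fun ζ s hs =>
    (hX.continuousOn ζ).mono fun r hr => ⟨hr.1, (hr.2.trans hs.2).trans_lt htS.2⟩
  have step : ∀ B : ℝ, 0 ≤ B →
      (∀ s ∈ Icc 0 t, ∀ x, |ω' s x - ω s x| ≤ B * Real.exp (K * s) ∧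
        |ρ' s x - ρ s x| ≤ B * Real.exp (K * s)) →
      ∀ s ∈ Icc 0 t, ∀ x, |ω' s x - ω s x| ≤ B / 2 * Real.exp (K * s) ∧
        |ρ' s x - ρ s x| ≤ B / 2 * Real.exp (K * s) := by
    intro B hB hyp s hs x
    have hsS : s ∈ Ico 0 S := ⟨hs.1, hs.2.trans_lt htS.2⟩
    have hsT : s ∈ Ico 0 T := ⟨hs.1, hs.2.trans_lt htT.2⟩
    rcases le_or_gt x 0 with hx | hx
    · have hx' : x ∉ Icc a b := fun hm => not_lt.2 hx (ha.trans_le hm.1)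
      obtain ⟨e1, e2, e3, e4, -, -⟩ := hout s hs x hx'
      rw [e1, e2, e3, e4, sub_zero, abs_zero]
      exact ⟨by positivity, by positivity⟩
    obtain ⟨ζ, rfl⟩ := hX.exists_eq s hsS x hx
    -- Along the flow of `ω`, the second solution sees the wrong velocity, which produces this error
    -- term. Outside `[a, b]` the derivative factor vanishes, so the velocities need comparison only
    -- inside.
    have hvel : ∀ r ∈ Ioo 0 s, ∀ g : ℝ → ℝ → ℝ, (∀ y, |deriv (g r) y| ≤ C) →
        (∀ y, y ∉ Icc a b → deriv (g r) y = 0) →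
        |(velocity (ω r) (X r ζ) - velocity (ω' r) (X r ζ)) * deriv (g r) (X r ζ)| ≤
          b * (1 / a * (b - a)) * C * (B * Real.exp (K * r)) := by
      intro r hr g hgC hg0
      have hrt : r ∈ Icc 0 t := ⟨hr.1.le, hr.2.le.trans hs.2⟩
      by_cases hm : X r ζ ∈ Icc a b
      · have hout' : ∀ y, b < y → y ∉ Icc a b := fun y hy hm => not_lt.2 hm.2 hy
        have := abs_velocity_sub_le (w := ω r) (w' := ω' r) (M := B * Real.exp (K * r)) ha
          (h.mem_ω.contDiff_space r ⟨hr.1.le, hr.2.trans hsS.2⟩).continuous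
          (h'.mem_ω.contDiff_space r ⟨hr.1.le, hr.2.trans hsT.2⟩).continuous
          (fun y hy => (hout r hrt y (hout' y hy)).1) (fun y hy => (hout r hrt y (hout' y hy)).2.2.1)
          (fun y => (hyp r hrt y).1) hm
        rw [abs_mul]
        calc _ ≤ b * (B * Real.exp (K * r) / a * (b - a)) * C :=
              mul_le_mul this (hgC _) (abs_nonneg _) (by positivity)
          _ = _ := by ring
      · rw [hg0 _ hm, mul_zero, abs_zero]; positivity
    constructor
    · refine abs_le_half_mul_exp (f := fun r => ω' r (X r ζ) - ω r (X r ζ))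
        (f' := fun r => (ρ' r (X r ζ) - ρ r (X r ζ)) / X r ζ ^ β +
          (velocity (ω r) (X r ζ) - velocity (ω' r) (X r ζ)) * deriv (ω' r) (X r ζ))
        hs.1 hB hKc ?_ (fun r hr => ?_) (fun r hr => ?_) ?_
      · exact (h'.mem_ω.continuousOn_comp (fun r hr => ⟨hr.1, hr.2.trans_lt hsT.2⟩)
          (hcontX ζ s hs)).sub (h.mem_ω.continuousOn_comp
          (fun r hr => ⟨hr.1, hr.2.trans_lt hsS.2⟩) (hcontX ζ s hs))
      · have hrS : r ∈ Ioo 0 S := ⟨hr.1, hr.2.trans hsS.2⟩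
        have hrT : r ∈ Ioo 0 T := ⟨hr.1, hr.2.trans hsT.2⟩
        have hp := hX.pos r (Ioo_subset_Ico_self hrS) ζ
        have d1 := h'.mem_ω.hasDerivAt_comp hrT (hX.hasDerivAt r hrS ζ)
        have d2 := h.mem_ω.hasDerivAt_comp hrS (hX.hasDerivAt r hrS ζ)
        have e1 := h'.eq_ω r (Ioo_subset_Ico_self hrT) _ hp
        have e2 := h.eq_ω r (Ioo_subset_Ico_self hrS) _ hp
        refine (d1.sub d2).congr_deriv ?_
        rw [sub_div, ← e1, ← e2]
        ring
      · have hrt : r ∈ Icc 0 t := ⟨hr.1.le, hr.2.le.trans hs.2⟩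
        have hp := hX.pos r ⟨hr.1.le, hr.2.trans hsS.2⟩ ζ
        have q1 : |(ρ' r (X r ζ) - ρ r (X r ζ)) / X r ζ ^ β| ≤
            1 / a ^ β * (B * Real.exp (K * r)) := by
          by_cases hm : X r ζ ∈ Icc a b
          · rw [abs_div, abs_of_pos (Real.rpow_pos_of_pos hp β), one_div_mul_eq_div]
            exact div_le_div₀ (by positivity) (hyp r hrt _).2 (by positivity)
              (Real.rpow_le_rpow ha.le hm.1 hβ)
          · obtain ⟨-, e2, -, e4, -, -⟩ := hout r hrt _ hm
            rw [e2, e4, sub_zero, zero_div, abs_zero]; positivity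
        have q2 := hvel r hr ω' (fun y => (hbd r hrt y).2.2.2.2.1)
          fun y hy => (hout r hrt y hy).2.2.2.2.1
        refine (abs_add_le _ _).trans ((add_le_add q1 q2).trans (le_of_eq ?_))
        rw [hc_def]; ring
      · simp only [h.init_ω, h'.init_ω, sub_self]
    · refine abs_le_half_mul_exp (f := fun r => ρ' r (X r ζ) - ρ r (X r ζ))
        (f' := fun r => (velocity (ω r) (X r ζ) - velocity (ω' r) (X r ζ)) *
          deriv (ρ' r) (X r ζ)) hs.1 hB hKc ?_ (fun r hr => ?_) (fun r hr => ?_) ?_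
      · exact (h'.mem_ρ.continuousOn_comp (fun r hr => ⟨hr.1, hr.2.trans_lt hsT.2⟩)
          (hcontX ζ s hs)).sub (h.mem_ρ.continuousOn_comp
          (fun r hr => ⟨hr.1, hr.2.trans_lt hsS.2⟩) (hcontX ζ s hs))
      · have hrS : r ∈ Ioo 0 S := ⟨hr.1, hr.2.trans hsS.2⟩
        have hrT : r ∈ Ioo 0 T := ⟨hr.1, hr.2.trans hsT.2⟩
        have hp := hX.pos r (Ioo_subset_Ico_self hrS) ζ
        have d1 := h'.mem_ρ.hasDerivAt_comp hrT (hX.hasDerivAt r hrS ζ)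
        have d2 := h.mem_ρ.hasDerivAt_comp hrS (hX.hasDerivAt r hrS ζ)
        have e1 := h'.eq_ρ r (Ioo_subset_Ico_self hrT) _ hp
        have e2 := h.eq_ρ r (Ioo_subset_Ico_self hrS) _ hp
        refine (d1.sub d2).congr_deriv ?_
        linear_combination e1 - e2
      · have hrt : r ∈ Icc 0 t := ⟨hr.1.le, hr.2.le.trans hs.2⟩
        have q2 := hvel r hr ρ' (fun y => (hbd r hrt y).2.2.2.2.2)
          fun y hy => (hout r hrt y hy).2.2.2.2.2
        refine q2.trans ?_
        have : 0 ≤ B * Real.exp (K * r) := by positivity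
        rw [hc_def, add_mul]
        linarith [mul_nonneg hc1 this]
      · simp only [h.init_ρ, h'.init_ρ, sub_self]
  -- Starting from the crude bound `2C`, each pass halves the weighted difference.
  have iter : ∀ n : ℕ, ∀ s ∈ Icc 0 t, ∀ x,
      |ω' s x - ω s x| ≤ 2 * C * (1 / 2) ^ n * Real.exp (K * s) ∧
        |ρ' s x - ρ s x| ≤ 2 * C * (1 / 2) ^ n * Real.exp (K * s) := by
    intro n
    induction n with
    | zero =>
      intro s hs x
      obtain ⟨f1, f2, f3, f4, -, -⟩ := hbd s hs x
      have he : 1 ≤ Real.exp (K * s) := Real.one_le_exp (mul_nonneg hK hs.1)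
      have h2 : 2 * C ≤ 2 * C * (1 / 2) ^ 0 * Real.exp (K * s) := by nlinarith
      exact ⟨(abs_sub _ _).trans (by linarith), (abs_sub _ _).trans (by linarith)⟩
    | succ n ih =>
      have := step _ (by positivity) ih
      intro s hs x
      rw [pow_succ, ← mul_assoc, mul_one_div]
      exact this s hs x
  have hlim : Tendsto (fun n : ℕ => 2 * C * (1 / 2) ^ n * Real.exp (K * t)) atTop (𝓝 0) := by
    have := ((tendsto_pow_atTop_nhds_zero_of_lt_one (r := (1 / 2 : ℝ)) (by norm_num)
      (by norm_num)).const_mul (2 * C)).mul_const (Real.exp (K * t))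
    simpa using this
  have hmem : t ∈ Icc 0 t := ⟨ht.1, le_rfl⟩
  refine ⟨funext fun x => ?_, funext fun x => ?_⟩
  · exact sub_eq_zero.1 (abs_nonpos_iff.1 (ge_of_tendsto' hlim fun n => (iter n t hmem x).1))
  · exact sub_eq_zero.1 (abs_nonpos_iff.1 (ge_of_tendsto' hlim fun n => (iter n t hmem x).2))

/-- A smooth solution along which the time integral of the supremum norm of the vorticity diverges
is maximal. -/
theorem IsSmoothSolution.isMaximalSolution {β S : ℝ} {ω₀ ρ₀ : ℝ → ℝ} {ω ρ X : ℝ → ℝ → ℝ}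
    (hβ : 0 ≤ β) (hS : 0 < S) (h : IsSmoothSolution β S ω₀ ρ₀ ω ρ) (hX : IsFlow S ω X)
    (hblow : Tendsto (fun t => ∫ s in (0 : ℝ)..t, supNorm (ω s)) (𝓝[<] S) atTop) :
    IsMaximalSolution β S ω₀ ρ₀ ω ρ where
  pos := hS
  isSolution := h
  maximal T ω' ρ' h' := by
    suffices hTS : T ≤ S from
      ⟨hTS, fun t ht => h.eq_of_isFlow hβ h' hX ⟨ht.1, by rw [min_eq_right hTS]; exact ht.2⟩⟩
    by_contra! hlt
    -- A solution living beyond `S` is bounded on `[0, S]` and equals `ω` before `S`, which would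
    -- bound the divergent integral.
    obtain ⟨_, _, C, _, hC⟩ := h'.mem_ω.exists_bounds (T' := S) ⟨hS.le, hlt⟩
    have hsup : ∀ t ∈ Ico 0 S, ‖supNorm (ω t)‖ ≤ C := by
      intro t ht
      rw [← (h.eq_of_isFlow hβ h' hX (t := t) (by rwa [min_eq_left hlt.le])).1]
      have hle : supNorm (ω' t) ≤ C := ciSup_le fun x => (hC t ⟨ht.1, ht.2.le⟩ x).2.1
      have h0 : 0 ≤ supNorm (ω' t) := Real.iSup_nonneg fun _ => abs_nonneg _
      rwa [Real.norm_of_nonneg h0]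
    have hev : ∀ᶠ t in 𝓝[<] S, ∫ s in (0 : ℝ)..t, supNorm (ω s) ≤ |C| * S := by
      filter_upwards [Ioo_mem_nhdsLT hS] with t ht
      have h1 : ‖∫ s in (0 : ℝ)..t, supNorm (ω s)‖ ≤ |C| * |t - 0| :=
        intervalIntegral.norm_integral_le_of_norm_le_const fun s hs => by
          rw [uIoc_of_le ht.1.le] at hs
          exact (hsup s ⟨hs.1.le, hs.2.trans_lt ht.2⟩).trans (le_abs_self C)
      rw [sub_zero, abs_of_pos ht.1] at h1
      exact (le_abs_self _).trans (h1.trans (by have := ht.2.le; gcongr))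
    obtain ⟨t, h1, h2⟩ := (hev.and (hblow.eventually_gt_atTop (|C| * S))).exists
    linarith

/-- A function with a maximum from the left at `t` has nonnegative derivative there. -/
theorem nonneg_of_hasDerivAt_of_eventually_le {f : ℝ → ℝ} {d t : ℝ} (hf : HasDerivAt f d t)
    (h : ∀ᶠ s in 𝓝[<] t, f s ≤ f t) : 0 ≤ d := by
  have h1 := (hasDerivWithinAt_iff_tendsto_slope' (s := Iio t) (by simp)).1 hf.hasDerivWithinAt
  refine ge_of_tendsto h1 ?_
  filter_upwards [h, self_mem_nhdsWithin] with s hs hst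
  rw [slope_def_field]
  exact div_nonneg_of_nonpos (sub_nonpos.2 hs) (sub_nonpos.2 (le_of_lt hst))

theorem le_add_mul_of_hasDerivAt_le {f f' : ℝ → ℝ} {t c : ℝ} (ht : 0 ≤ t)
    (hf : ∀ s ∈ Icc 0 t, HasDerivAt f (f' s) s) (hc : ∀ s ∈ Ico 0 t, f' s ≤ c) :
    f t ≤ f 0 + c * t := by
  have := (convex_Icc 0 t).image_sub_le_mul_sub_of_deriv_le (f := f) (C := c)
    (fun s hs => (hf s hs).continuousAt.continuousWithinAt)
    (fun s hs => (hf s (interior_subset hs)).differentiableAt.differentiableWithinAt)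
    (fun s hs => by
      rw [(hf s (interior_subset hs)).deriv]
      rw [interior_Icc] at hs
      exact hc s (Ioo_subset_Ico_self hs)) 0 ⟨le_rfl, ht⟩ t ⟨ht, le_rfl⟩ ht
  rw [sub_zero] at this
  linarith

theorem integral_exp_eq_position_sub (R : ℝ) (f : ℝ →ᵇ ℝ) (a b : ℝ) :
    ∫ s in a..b, Real.exp (f s) = position R f b - position R f a :=
  intervalIntegral.integral_eq_sub_of_hasDerivAt
    (fun s _ => hasDerivAt_position R f.continuous s)
    ((Real.continuous_exp.comp f.continuous).intervalIntegrable _ _)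

theorem integral_exp_mul_exp_position (R : ℝ) (f : ℝ →ᵇ ℝ) (a b : ℝ) {p : ℝ} (hp : p ≠ 0) :
    ∫ s in a..b, Real.exp (f s) * Real.exp (-p * position R f s) =
      (Real.exp (-p * position R f a) - Real.exp (-p * position R f b)) / p := by
  have hc := continuous_position R f.continuous
  have hd : ∀ s, HasDerivAt (fun s => -(Real.exp (-p * position R f s) / p))
      (Real.exp (f s) * Real.exp (-p * position R f s)) s := fun s => by
    refine ((((hasDerivAt_position R f.continuous s).const_mul (-p)).exp.div_const p).neg).congr_deriv
      ?_
    field_simp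
  rw [intervalIntegral.integral_eq_sub_of_hasDerivAt (fun s _ => hd s)
    (Continuous.intervalIntegrable (by fun_prop) _ _)]
  ring

/-! ### Blow-up and monotonicity along trajectories -/

namespace LagrangianSolution

variable {β l R τ S : ℝ} {P w₀ : ℝ → ℝ} {L Ω : ℝ → ℝ →ᵇ ℝ}

theorem isFlow (h : LagrangianSolution β l R τ S P w₀ L Ω) :
    IsFlow S (eulerian R L fun t => Ω t) (fun t ζ => Real.exp (position R (L t) ζ)) := by
  have hd : ∀ t ∈ Ico 0 S, ∀ ζ, HasDerivAt (fun s => Real.exp (position R (L s) ζ))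
      (velocity (eulerian R L (fun t => Ω t) t) (Real.exp (position R (L t) ζ))) t := by
    intro t ht ζ
    have ht' := h.Ico_subset ht
    rw [h.velocity_eulerian ht' (Real.exp_pos _), Real.log_exp, label_position]
    exact (h.hasDerivAt_position_time ht' _).exp
  exact ⟨fun _ _ _ => Real.exp_pos _, fun ζ t ht => (hd t ht ζ).continuousAt.continuousWithinAt,
    fun t ht ζ => hd t (Ioo_subset_Ico_self ht) ζ,
    fun t ht x hx => ⟨label R (L t) (Real.log x), by
      rw [h.position_label (h.Ico_subset ht), Real.exp_log hx]⟩⟩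

theorem tendsto_integral_supNorm (h : LagrangianSolution β l R τ S P w₀ L Ω)
    (hunb : ∀ B : ℝ, ∃ t ∈ Ico 0 S, B < ∫ s in (0 : ℝ)..t, ‖Ω s‖) :
    Tendsto (fun t => ∫ s in (0 : ℝ)..t, supNorm (eulerian R L (fun t => Ω t) s)) (𝓝[<] S)
      atTop := by
  simp only [supNorm_eulerian]
  refine tendsto_atTop.2 fun B => ?_
  obtain ⟨t₀, ht₀, hB⟩ := hunb B
  filter_upwards [Ioo_mem_nhdsLT ht₀.2] with t ht
  have hint : IntervalIntegrable (fun s => ‖Ω s‖) volume 0 t :=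
    ((h.continuousOn_Ω.mono (h.uIcc_subset (h.Ico_subset
      ⟨ht₀.1.trans ht.1.le, ht.2⟩))).norm).intervalIntegrable
  exact hB.le.trans (intervalIntegral.integral_mono_interval le_rfl ht₀.1 ht.1.le
    (.of_forall fun _ => norm_nonneg _) hint)

theorem le_Ω (h : LagrangianSolution β l R τ S P w₀ L Ω) (hP : ∀ ζ, 0 ≤ P ζ) {t : ℝ}
    (ht : t ∈ Ico 0 S) (ζ : ℝ) : w₀ ζ ≤ Ω t ζ := by
  rw [h.Ω_eq (h.Ico_subset ht)]
  exact le_add_of_nonneg_right (mul_nonneg (hP ζ)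
    (intervalIntegral.integral_nonneg ht.1 fun _ _ => (Real.exp_pos _).le))

theorem particleVelocity_nonpos (h : LagrangianSolution β l R τ S P w₀ L Ω) (hw : ∀ ζ, 0 ≤ w₀ ζ)
    (hP : ∀ ζ, 0 ≤ P ζ) {t : ℝ} (ht : t ∈ Ico 0 S) (ζ : ℝ) :
    particleVelocity R (L t) (Ω t) ζ ≤ 0 := by
  rcases le_or_gt R ζ with hζ | hζ
  · exact (h.particleVelocity_of_ge (h.Ico_subset ht) hζ).le
  · rw [particleVelocity, intervalIntegral.integral_symm, neg_nonpos]
    exact intervalIntegral.integral_nonneg hζ.le fun s _ =>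
      mul_nonneg (Real.exp_pos _).le ((hw s).trans (h.le_Ω hP ht s))

theorem position_antitone (h : LagrangianSolution β l R τ S P w₀ L Ω) (hw : ∀ ζ, 0 ≤ w₀ ζ)
    (hP : ∀ ζ, 0 ≤ P ζ) {s t : ℝ} (hs : 0 ≤ s) (hst : s ≤ t) (ht : t < S) (ζ : ℝ) :
    position R (L t) ζ ≤ position R (L s) ζ := by
  have hd : ∀ r ∈ Ico 0 S, HasDerivAt (fun s => position R (L s) ζ)
      (particleVelocity R (L r) (Ω r) ζ) r := fun r hr =>
    h.hasDerivAt_position_time (h.Ico_subset hr) ζ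
  refine antitoneOn_of_deriv_nonpos (convex_Ico 0 S)
    (fun r hr => (hd r hr).continuousAt.continuousWithinAt)
    (fun r hr => (hd r (interior_subset hr)).differentiableAt.differentiableWithinAt)
    (fun r hr => ?_) ⟨hs, hst.trans_lt ht⟩ ⟨hs.trans hst, ht⟩ hst
  rw [(hd r (interior_subset hr)).deriv]
  exact h.particleVelocity_nonpos hw hP (interior_subset hr) ζ

theorem position_le_label (h : LagrangianSolution β l R τ S P w₀ L Ω) (hw : ∀ ζ, 0 ≤ w₀ ζ)
    (hP : ∀ ζ, 0 ≤ P ζ) {t : ℝ} (ht : t ∈ Ico 0 S) (ζ : ℝ) : position R (L t) ζ ≤ ζ := by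
  simpa [h.position_zero] using h.position_antitone hw hP le_rfl ht.1 ht.2 ζ

/-- Particles move to the left, so one with `x ≥ 1` at time `t` had `x ≥ 1` at all earlier times.
The weight `e^{-βY}` was therefore at most one. -/
theorem Ω_le (h : LagrangianSolution β l R τ S P w₀ L Ω) (hβ : 0 ≤ β) (hw : ∀ ζ, 0 ≤ w₀ ζ)
    (hP : ∀ ζ, 0 ≤ P ζ) {m : ℝ} (hPm : ∀ ζ, P ζ ≤ m) {t ζ : ℝ} (ht : t ∈ Ico 0 S)
    (hY : 0 ≤ position R (L t) ζ) : Ω t ζ ≤ w₀ ζ + m * t := by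
  rw [h.Ω_eq (h.Ico_subset ht)]
  have h1 : ∫ s in (0 : ℝ)..t, Real.exp (-β * position R (L s) ζ) ≤ ∫ s in (0 : ℝ)..t, (1 : ℝ) := by
    have hc : ContinuousOn (fun s => position R (L s) ζ) (uIcc 0 t) :=
      h.continuousOn_position.comp (f := fun s => (s, ζ)) (by fun_prop)
        fun s hs => ⟨h.uIcc_subset (h.Ico_subset ht) hs, trivial⟩
    refine intervalIntegral.integral_mono_on ht.1
      (ContinuousOn.intervalIntegrable (by fun_prop)) intervalIntegrable_const fun s hs => ?_
    rw [Real.exp_le_one_iff]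
    nlinarith [h.position_antitone hw hP hs.1 hs.2 ht.2 ζ]
  have h0 : 0 ≤ ∫ s in (0 : ℝ)..t, Real.exp (-β * position R (L s) ζ) :=
    intervalIntegral.integral_nonneg ht.1 fun _ _ => (Real.exp_pos _).le
  simp only [intervalIntegral.integral_const, sub_zero, smul_eq_mul, mul_one] at h1
  have := mul_le_mul (hPm ζ) h1 h0 ((hP ζ).trans (hPm ζ))
  linarith

end LagrangianSolution

/-- The parameters for which suitably prepared data stay controlled. -/
structure Admissible (p q φ ψ δ m A₀ : ℝ) : Prop where
  A₀_pos : 0 < A₀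
  A₀_lt : A₀ < 1
  p_pos : 0 < p
  p_lt : p < q
  φ_pos : 0 < φ
  δ_pos : 0 < δ
  φ_lt : φ < ψ - δ
  m_pos : 0 < m
  upper_barrier : m < q * ψ * (φ * (min 1 (p * Real.log 2) / p))
  lower_barrier : p * φ * (ψ * (1 / q + Real.log 4)) < m⁻¹
  reachTime_mul_le : m * reachTime p φ A₀ ≤ δ
  displacement_le : ψ * Real.log 4 * reachTime p φ A₀ ≤ Real.log (3 / 2)

/-- The conditions on suitably prepared data in the logarithmic variable. -/
structure LogPrepared (p q φ ψ δ m α : ℝ) (P w₀ : ℝ → ℝ) : Prop where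
  w_nonneg : ∀ ζ, 0 ≤ w₀ ζ
  P_nonneg : ∀ ζ, 0 ≤ P ζ
  w_lt_exp : ∀ ζ ∈ Icc α 0, w₀ ζ < ψ * Real.exp (-q * ζ)
  exp_lt_w : ∀ ζ ∈ Icc α 0, φ * Real.exp (-p * ζ) < w₀ ζ
  w_lt : ∀ ζ ∈ Icc 0 (Real.log 4), w₀ ζ < ψ - δ
  lt_w : ∀ ζ ∈ Icc 0 (Real.log 3), φ < w₀ ζ
  P_le : ∀ ζ, P ζ ≤ m
  le_P : ∀ ζ ∈ Icc α (Real.log 2), m⁻¹ ≤ P ζ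

/-- The control conditions at a fixed time in terms of the labels in `[α, R]`. -/
def ControlledAt (p q φ ψ α R : ℝ) (L Ω : ℝ →ᵇ ℝ) : Prop :=
  ∀ ζ ∈ Icc α R,
    (position R L ζ ≤ 0 → φ * Real.exp (-p * position R L ζ) < Ω ζ ∧
      Ω ζ < ψ * Real.exp (-q * position R L ζ)) ∧
    (0 ≤ position R L ζ → Ω ζ < ψ) ∧
    (0 ≤ position R L ζ → position R L ζ ≤ Real.log 2 → φ < Ω ζ)

theorem log_two_lt_log_four : Real.log 2 < Real.log 4 := Real.log_lt_log (by norm_num) (by norm_num)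

theorem log_four_pos : 0 < Real.log 4 := Real.log_pos (by norm_num)

/-! ### Velocity bounds implied by the control conditions -/

section VelocityBounds

variable {p q φ ψ α ζ : ℝ} {L Ω : ℝ →ᵇ ℝ}

theorem intervalIntegrable_exp_mul (L Ω : ℝ →ᵇ ℝ) (a b : ℝ) :
    IntervalIntegrable (fun s => Real.exp (L s) * Ω s) volume a b :=
  Continuous.intervalIntegrable (by fun_prop) _ _

/-- The integral of the vorticity is split at the particles located at `x = 1` and `x = 2`. The
lower barrier gives `φ (e^{-pY} - 1) / p` on the first piece and `φ log 2` on the second; the last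
piece is nonnegative. -/
theorem ControlledAt.neg_particleVelocity_ge (h : ControlledAt p q φ ψ α (Real.log 4) L Ω)
    (hp : 0 < p) (hφ : 0 < φ) (hΩ : ∀ s, 0 ≤ Ω s) (hζ : α ≤ ζ)
    (hR : position (Real.log 4) L (Real.log 4) = Real.log 4)
    (hY : position (Real.log 4) L ζ ≤ 0)
    (hsurj : Function.Surjective (position (Real.log 4) L)) :
    φ * (min 1 (p * Real.log 2) / p) * Real.exp (-p * position (Real.log 4) L ζ) ≤
      -particleVelocity (Real.log 4) L Ω ζ := by
  set R := Real.log 4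
  have hmono := LagrangianSolution.strictMono_position R L
  obtain ⟨ζ₁, h₁⟩ := hsurj 0
  obtain ⟨ζ₂, h₂⟩ := hsurj (Real.log 2)
  have hlog2 : 0 < Real.log 2 := Real.log_pos (by norm_num)
  have l₁ : ζ ≤ ζ₁ := hmono.le_iff_le.1 (by rwa [h₁])
  have l₂ : ζ₁ ≤ ζ₂ := hmono.le_iff_le.1 (by rw [h₁, h₂]; exact hlog2.le)
  have l₃ : ζ₂ ≤ R := hmono.le_iff_le.1 (by rw [h₂, hR]; exact log_two_lt_log_four.le)
  have hi := intervalIntegrable_exp_mul L Ω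
  have hc := continuous_position R L.continuous
  have e₁ : φ * ((Real.exp (-p * position R L ζ) - 1) / p) ≤ ∫ s in ζ..ζ₁, Real.exp (L s) * Ω s := by
    have := integral_exp_mul_exp_position R L ζ ζ₁ hp.ne'
    rw [h₁, mul_zero, Real.exp_zero] at this
    rw [← this, ← intervalIntegral.integral_const_mul]
    refine intervalIntegral.integral_mono_on l₁ (Continuous.intervalIntegrable (by fun_prop) _ _)
      (hi _ _) fun s hs => ?_
    have hs0 : position R L s ≤ 0 := by rw [← h₁]; exact hmono.monotone hs.2
    have := (h s ⟨hζ.trans hs.1, hs.2.trans (l₂.trans l₃)⟩).1 hs0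
    rw [mul_left_comm]
    exact mul_le_mul_of_nonneg_left this.1.le (Real.exp_pos _).le
  have e₂ : φ * Real.log 2 ≤ ∫ s in ζ₁..ζ₂, Real.exp (L s) * Ω s := by
    have := integral_exp_eq_position_sub R L ζ₁ ζ₂
    rw [h₁, h₂, sub_zero] at this
    rw [← this, ← intervalIntegral.integral_const_mul]
    refine intervalIntegral.integral_mono_on l₂ (Continuous.intervalIntegrable (by fun_prop) _ _)
      (hi _ _) fun s hs => ?_
    have hs0 : 0 ≤ position R L s := by rw [← h₁]; exact hmono.monotone hs.1
    have hs2 : position R L s ≤ Real.log 2 := by rw [← h₂]; exact hmono.monotone hs.2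
    have := (h s ⟨hζ.trans (l₁.trans hs.1), hs.2.trans l₃⟩).2.2 hs0 hs2
    rw [mul_comm]
    exact mul_le_mul_of_nonneg_left this.le (Real.exp_pos _).le
  have e₃ : 0 ≤ ∫ s in ζ₂..R, Real.exp (L s) * Ω s :=
    intervalIntegral.integral_nonneg l₃ fun s _ => mul_nonneg (Real.exp_pos _).le (hΩ s)
  have hsum : -particleVelocity R L Ω ζ = (∫ s in ζ..ζ₁, Real.exp (L s) * Ω s) +
      (∫ s in ζ₁..ζ₂, Real.exp (L s) * Ω s) + ∫ s in ζ₂..R, Real.exp (L s) * Ω s := by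
    rw [intervalIntegral.integral_add_adjacent_intervals (hi _ _) (hi _ _),
      intervalIntegral.integral_add_adjacent_intervals (hi _ _) (hi _ _), particleVelocity,
      intervalIntegral.integral_symm, neg_neg]
  set E := Real.exp (-p * position R L ζ)
  have hE : 1 ≤ E := Real.one_le_exp (by nlinarith)
  set c := min 1 (p * Real.log 2)
  have hc1 : c ≤ 1 := min_le_left _ _
  have hc2 : c ≤ p * Real.log 2 := min_le_right _ _
  -- After multiplication by `p` the difference is `(1 - c)(E - 1) + (p log 2 - c) ≥ 0`. This is
  -- where the constant `b₀` comes from.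
  have key : c / p * E ≤ (E - 1) / p + Real.log 2 := by
    rw [div_mul_eq_mul_div, div_add' _ _ _ hp.ne']
    refine div_le_div_of_nonneg_right ?_ hp.le
    nlinarith
  have := mul_le_mul_of_nonneg_left key hφ.le
  rw [hsum]
  linarith

theorem ControlledAt.neg_particleVelocity_le (h : ControlledAt p q φ ψ α (Real.log 4) L Ω)
    (hζ : α ≤ ζ) (hR : position (Real.log 4) L (Real.log 4) = Real.log 4)
    (hζR : ζ ≤ Real.log 4) (hY : 0 ≤ position (Real.log 4) L ζ) (hψ : 0 ≤ ψ) :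
    -particleVelocity (Real.log 4) L Ω ζ ≤ ψ * Real.log 4 := by
  set R := Real.log 4
  have hmono := LagrangianSolution.strictMono_position R L
  have h1 : -particleVelocity R L Ω ζ ≤ ψ * (R - position R L ζ) := by
    have := integral_exp_eq_position_sub R L ζ R
    rw [hR] at this
    rw [particleVelocity, intervalIntegral.integral_symm, neg_neg, ← this,
      ← intervalIntegral.integral_const_mul]
    refine intervalIntegral.integral_mono_on hζR (intervalIntegrable_exp_mul L Ω _ _)
      (Continuous.intervalIntegrable (by fun_prop) _ _) fun s hs => ?_
    have := (h s ⟨hζ.trans hs.1, hs.2⟩).2.1 (hY.trans (hmono.monotone hs.1))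
    rw [mul_comm]
    exact mul_le_mul_of_nonneg_right this.le (Real.exp_pos _).le
  exact h1.trans (mul_le_mul_of_nonneg_left (by linarith) hψ)

/-- The upper barrier contributes `ψ (e^{-qY} - 1) / q` up to `x = 1`. The rest, up to `x = 4`,
contributes at most `ψ log 4`, which is absorbed because `e^{-qY} ≥ 1`. -/
theorem ControlledAt.neg_particleVelocity_le_exp (h : ControlledAt p q φ ψ α (Real.log 4) L Ω)
    (hq : 0 < q) (hζ : α ≤ ζ) (hR : position (Real.log 4) L (Real.log 4) = Real.log 4)
    (hY : position (Real.log 4) L ζ ≤ 0) (hψ : 0 ≤ ψ)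
    (hsurj : Function.Surjective (position (Real.log 4) L)) :
    -particleVelocity (Real.log 4) L Ω ζ ≤
      ψ * (1 / q + Real.log 4) * Real.exp (-q * position (Real.log 4) L ζ) := by
  obtain ⟨ζ₁, h₁⟩ := hsurj 0
  have hmono := LagrangianSolution.strictMono_position (Real.log 4) L
  have l₁ : ζ ≤ ζ₁ := hmono.le_iff_le.1 (by rwa [h₁])
  have l₂ : ζ₁ ≤ Real.log 4 := hmono.le_iff_le.1 (by rw [h₁, hR]; exact log_four_pos.le)
  have e₂ := h.neg_particleVelocity_le (hζ.trans l₁) hR l₂ h₁.ge hψ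
  set R := Real.log 4
  have hi := intervalIntegrable_exp_mul L Ω
  have hc := continuous_position R L.continuous
  have e₁ : ∫ s in ζ..ζ₁, Real.exp (L s) * Ω s ≤ ψ * ((Real.exp (-q * position R L ζ) - 1) / q) := by
    have := integral_exp_mul_exp_position R L ζ ζ₁ hq.ne'
    rw [h₁, mul_zero, Real.exp_zero] at this
    rw [← this, ← intervalIntegral.integral_const_mul]
    refine intervalIntegral.integral_mono_on l₁ (hi _ _)
      (Continuous.intervalIntegrable (by fun_prop) _ _) fun s hs => ?_
    have hs0 : position R L s ≤ 0 := by rw [← h₁]; exact hmono.monotone hs.2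
    have := (h s ⟨hζ.trans hs.1, hs.2.trans l₂⟩).1 hs0
    rw [mul_left_comm ψ]
    exact mul_le_mul_of_nonneg_left this.2.le (Real.exp_pos _).le
  have hsum : -particleVelocity R L Ω ζ = (∫ s in ζ..ζ₁, Real.exp (L s) * Ω s) +
      -particleVelocity R L Ω ζ₁ := by
    rw [particleVelocity, particleVelocity, intervalIntegral.integral_symm, neg_neg,
      intervalIntegral.integral_symm ζ₁ R, neg_neg,
      intervalIntegral.integral_add_adjacent_intervals (hi _ _) (hi _ _)]
  rw [hsum]
  set E := Real.exp (-q * position R L ζ)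
  have hE : 1 ≤ E := Real.one_le_exp (by nlinarith)
  have hR0 : 0 < R := log_four_pos
  have key : (E - 1) / q + R ≤ (1 / q + R) * E := by
    have h1 : (E - 1) / q = 1 / q * E - 1 / q := by ring
    have h2 : 0 ≤ 1 / q := by positivity
    nlinarith
  have := mul_le_mul_of_nonneg_left key hψ
  linarith

end VelocityBounds

theorem reachTime_pos {p q φ ψ δ m A₀ : ℝ} (ha : Admissible p q φ ψ δ m A₀) :
    0 < reachTime p φ A₀ := by
  have h1 := ha.p_pos
  have h2 := ha.φ_pos
  have h3 := ha.A₀_pos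
  have h4 : 0 < min 1 (p * Real.log 2) :=
    lt_min one_pos (mul_pos h1 (Real.log_pos (by norm_num)))
  unfold reachTime
  positivity

/-! ### The barrier argument -/

namespace LagrangianSolution

variable {β l τ S p q φ ψ δ m A₀ : ℝ} {P w₀ : ℝ → ℝ} {L Ω : ℝ → ℝ →ᵇ ℝ}

theorem controlledAt_zero (h : LagrangianSolution β l (Real.log 4) τ S P w₀ L Ω)
    (ha : Admissible p q φ ψ δ m A₀) (hd : LogPrepared p q φ ψ δ m (Real.log A₀) P w₀) :
    ControlledAt p q φ ψ (Real.log A₀) (Real.log 4) (L 0) (Ω 0) := by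
  intro ζ hζ
  rw [h.position_zero, h.Ω_zero]
  refine ⟨fun h0 => ⟨hd.exp_lt_w ζ ⟨hζ.1, h0⟩, hd.w_lt_exp ζ ⟨hζ.1, h0⟩⟩, fun h0 => ?_,
    fun h0 h2 => hd.lt_w ζ ⟨h0, h2.trans (Real.log_le_log (by norm_num) (by norm_num))⟩⟩
  linarith [hd.w_lt ζ ⟨h0, hζ.2⟩, ha.δ_pos]

/-- The particle started at `A₀` approaches the origin at least at the speed prescribed by the
lower barrier. -/
theorem exp_position_le (h : LagrangianSolution β l (Real.log 4) τ S P w₀ L Ω)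
    (ha : Admissible p q φ ψ δ m A₀) (hd : LogPrepared p q φ ψ δ m (Real.log A₀) P w₀) {t : ℝ}
    (ht : t ∈ Ico 0 S)
    (hC : ∀ s ∈ Ico 0 t, ControlledAt p q φ ψ (Real.log A₀) (Real.log 4) (L s) (Ω s)) :
    Real.exp (p * position (Real.log 4) (L t) (Real.log A₀)) ≤
      A₀ ^ p * (1 - t / reachTime p φ A₀) := by
  set α := Real.log A₀
  set b := min 1 (p * Real.log 2) / p with hb
  have hα : α < 0 := Real.log_neg ha.A₀_pos ha.A₀_lt
  -- The factor `e^{pY}` from the derivative of `A^p = e^{pY}` cancels the `e^{-pY}` of the velocity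
  -- bound, leaving a constant rate.
  have key := le_add_mul_of_hasDerivAt_le (c := -(p * (φ * b))) ht.1
    (f := fun s => Real.exp (p * position (Real.log 4) (L s) α))
    (fun s hs => ((h.hasDerivAt_position_time
      (h.Ico_subset ⟨hs.1, hs.2.trans_lt ht.2⟩) α).const_mul p).exp)
    fun s hs => by
      have hs' : s ∈ Ico 0 S := ⟨hs.1, hs.2.trans ht.2⟩
      have hY := h.position_le_label hd.w_nonneg hd.P_nonneg hs' α
      have h1 := (hC s hs).neg_particleVelocity_ge ha.p_pos ha.φ_pos
        (fun r => (hd.w_nonneg r).trans (h.le_Ω hd.P_nonneg hs' r)) le_rfl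
        (h.position_of_ge (h.Ico_subset hs') le_rfl) (hY.trans hα.le)
        (h.surjective_position (h.Ico_subset hs'))
      have h2 : Real.exp (p * position (Real.log 4) (L s) α) *
          Real.exp (-p * position (Real.log 4) (L s) α) = 1 := by
        rw [← Real.exp_add, neg_mul, add_neg_cancel, Real.exp_zero]
      have h3 := mul_le_mul_of_nonneg_left h1
        (mul_pos (Real.exp_pos (p * position (Real.log 4) (L s) α)) ha.p_pos).le
      have h4 : Real.exp (p * position (Real.log 4) (L s) α) * p *
          (φ * b * Real.exp (-p * position (Real.log 4) (L s) α)) = p * (φ * b) := by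
        linear_combination p * (φ * b) * h2
      rw [hb] at h4
      rw [h4] at h3
      linarith
  simp only [h.position_zero] at key
  have hpos : 0 < A₀ ^ p := Real.rpow_pos_of_pos ha.A₀_pos p
  rw [mul_comm p α, ← Real.rpow_def_of_pos ha.A₀_pos] at key
  refine key.trans (le_of_eq ?_)
  have e : A₀ ^ p * (t / reachTime p φ A₀) = φ * (min 1 (p * Real.log 2) / p) * p * t := by
    rw [reachTime, div_div_eq_mul_div, mul_div_cancel₀ _ hpos.ne', mul_comm]
  rw [mul_sub, e, hb]
  ring

theorem lt_reachTime (h : LagrangianSolution β l (Real.log 4) τ S P w₀ L Ω)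
    (ha : Admissible p q φ ψ δ m A₀) (hd : LogPrepared p q φ ψ δ m (Real.log A₀) P w₀) {t : ℝ}
    (ht : t ∈ Ico 0 S)
    (hC : ∀ s ∈ Ico 0 t, ControlledAt p q φ ψ (Real.log A₀) (Real.log 4) (L s) (Ω s)) :
    t < reachTime p φ A₀ := by
  have h1 := (Real.exp_pos _).trans_le (h.exp_position_le ha hd ht hC)
  have h2 := (pos_iff_pos_of_mul_pos h1).1 (Real.rpow_pos_of_pos ha.A₀_pos p)
  rwa [sub_pos, div_lt_one (reachTime_pos ha)] at h2

/-- A particle in `x ≥ 1` has moved little. -/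
theorem label_le (h : LagrangianSolution β l (Real.log 4) τ S P w₀ L Ω)
    (ha : Admissible p q φ ψ δ m A₀) (hd : LogPrepared p q φ ψ δ m (Real.log A₀) P w₀) {t ζ : ℝ}
    (ht : t ∈ Ico 0 S)
    (hC : ∀ s ∈ Ico 0 t, ControlledAt p q φ ψ (Real.log A₀) (Real.log 4) (L s) (Ω s))
    (hζ : ζ ≤ Real.log 4) (hY : 0 ≤ position (Real.log 4) (L t) ζ) :
    ζ ≤ position (Real.log 4) (L t) ζ + Real.log (3 / 2) := by
  have hψ : 0 < ψ := by linarith [ha.φ_pos, ha.φ_lt, ha.δ_pos]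
  have hα : Real.log A₀ < 0 := Real.log_neg ha.A₀_pos ha.A₀_lt
  have hζ0 : 0 ≤ ζ := hY.trans (h.position_le_label hd.w_nonneg hd.P_nonneg ht ζ)
  have key := le_add_mul_of_hasDerivAt_le (c := ψ * Real.log 4) ht.1
    (f := fun s => -position (Real.log 4) (L s) ζ)
    (fun s hs => (h.hasDerivAt_position_time
      (h.Ico_subset ⟨hs.1, hs.2.trans_lt ht.2⟩) ζ).neg)
    fun s hs => (hC s hs).neg_particleVelocity_le (hα.le.trans hζ0)
      (h.position_of_ge (h.Ico_subset ⟨hs.1, hs.2.trans ht.2⟩) le_rfl) hζ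
      (hY.trans (h.position_antitone hd.w_nonneg hd.P_nonneg hs.1 hs.2.le ht.2 ζ)) hψ.le
  simp only [h.position_zero] at key
  have h1 : ψ * Real.log 4 * t ≤ ψ * Real.log 4 * reachTime p φ A₀ :=
    mul_le_mul_of_nonneg_left (h.lt_reachTime ha hd ht hC).le (mul_pos hψ log_four_pos).le
  linarith [ha.displacement_le]

/-- The vorticity gains at most `m t < m T₁ ≤ δ`, which the initial margin `δ` absorbs. -/
theorem Ω_lt_of_nonneg (h : LagrangianSolution β l (Real.log 4) τ S P w₀ L Ω) (hβ : 0 ≤ β)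
    (ha : Admissible p q φ ψ δ m A₀) (hd : LogPrepared p q φ ψ δ m (Real.log A₀) P w₀) {t ζ : ℝ}
    (ht : t ∈ Ico 0 S)
    (hC : ∀ s ∈ Ico 0 t, ControlledAt p q φ ψ (Real.log A₀) (Real.log 4) (L s) (Ω s))
    (hζ : ζ ≤ Real.log 4) (hY : 0 ≤ position (Real.log 4) (L t) ζ) : Ω t ζ < ψ := by
  have hζ0 : 0 ≤ ζ := hY.trans (h.position_le_label hd.w_nonneg hd.P_nonneg ht ζ)
  have h1 := h.Ω_le hβ hd.w_nonneg hd.P_nonneg hd.P_le ht hY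
  have h2 := hd.w_lt ζ ⟨hζ0, hζ⟩
  have h3 : m * t ≤ m * reachTime p φ A₀ :=
    mul_le_mul_of_nonneg_left (h.lt_reachTime ha hd ht hC).le ha.m_pos.le
  linarith [ha.reachTime_mul_le]

/-- A particle now in `[1, 2]` started in `[1, 3]`, since it has moved by a factor of at most `3 /
2`, and its vorticity has not decreased. -/
theorem lt_Ω_of_nonneg (h : LagrangianSolution β l (Real.log 4) τ S P w₀ L Ω)
    (ha : Admissible p q φ ψ δ m A₀) (hd : LogPrepared p q φ ψ δ m (Real.log A₀) P w₀) {t ζ : ℝ}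
    (ht : t ∈ Ico 0 S)
    (hC : ∀ s ∈ Ico 0 t, ControlledAt p q φ ψ (Real.log A₀) (Real.log 4) (L s) (Ω s))
    (hζ : ζ ≤ Real.log 4) (hY : 0 ≤ position (Real.log 4) (L t) ζ)
    (hY' : position (Real.log 4) (L t) ζ ≤ Real.log 2) : φ < Ω t ζ := by
  have hζ0 : 0 ≤ ζ := hY.trans (h.position_le_label hd.w_nonneg hd.P_nonneg ht ζ)
  have h1 := h.label_le ha hd ht hC hζ hY
  have h2 : Real.log 2 + Real.log (3 / 2) = Real.log 3 := by
    rw [← Real.log_mul (by norm_num) (by norm_num)]; norm_num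
  exact (hd.lt_w ζ ⟨hζ0, by linarith⟩).trans_le (h.le_Ω hd.P_nonneg ht ζ)

/-- If the control conditions hold before time `t`, they persist at time `t`. -/
theorem controlledAt_of_forall_lt (h : LagrangianSolution β l (Real.log 4) τ S P w₀ L Ω)
    (hβ : 0 ≤ β) (hpq : p + q = β) (ha : Admissible p q φ ψ δ m A₀)
    (hd : LogPrepared p q φ ψ δ m (Real.log A₀) P w₀) {t : ℝ} (ht0 : 0 < t) (htS : t < S)
    (hC : ∀ s ∈ Ico 0 t, ControlledAt p q φ ψ (Real.log A₀) (Real.log 4) (L s) (Ω s)) :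
    ControlledAt p q φ ψ (Real.log A₀) (Real.log 4) (L t) (Ω t) := by
  have ht : t ∈ Ico 0 S := ⟨ht0.le, htS⟩
  have htD := h.Ico_subset ht
  intro ζ hζ
  refine ⟨fun hY => ?_, h.Ω_lt_of_nonneg hβ ha hd ht hC hζ.2, h.lt_Ω_of_nonneg ha hd ht hC hζ.2⟩
  have hlog2 : 0 < Real.log 2 := Real.log_pos (by norm_num)
  -- At `x = 1` the barriers equal `φ` and `ψ`, so the estimates for `x ≥ 1` apply. For `x < 1` the
  -- particle stays in `x < 1` for times slightly before `t`, where the strict barriers are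
  -- available.
  rcases hY.eq_or_lt with hY0 | hneg
  · rw [hY0, mul_zero, mul_zero, Real.exp_zero, mul_one, mul_one]
    exact ⟨h.lt_Ω_of_nonneg ha hd ht hC hζ.2 hY0.ge (hY0.le.trans hlog2.le),
      h.Ω_lt_of_nonneg hβ ha hd ht hC hζ.2 hY0.ge⟩
  have hp := ha.p_pos
  have hq : 0 < q := hp.trans ha.p_lt
  have hφ := ha.φ_pos
  have hψ : 0 < ψ := by linarith [ha.φ_pos, ha.φ_lt, ha.δ_pos]
  have hdY := h.hasDerivAt_position_time htD ζ
  have hdΩ := h.hasDerivAt_Ω t htD ζ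
  have hcV : ContinuousAt (fun s => particleVelocity (Real.log 4) (L s) (Ω s) ζ) t :=
    ContinuousAt.comp (f := fun s => (s, ζ))
      (h.continuousOn_particleVelocity.continuousAt ((isOpen_domain τ S).mem_nhds ⟨htD, trivial⟩))
      (by fun_prop)
  set Y := position (Real.log 4) (L t) ζ
  set V := particleVelocity (Real.log 4) (L t) (Ω t) ζ
  have hev : ∀ᶠ s in 𝓝[<] t, s ∈ Ico 0 t ∧ position (Real.log 4) (L s) ζ < 0 := by
    filter_upwards [Ico_mem_nhdsLT ht0,
      nhdsWithin_le_nhds (hdY.continuousAt.eventually (gt_mem_nhds hneg))] with s hs hs'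
    exact ⟨hs, hs'⟩
  have hexp : ∀ c : ℝ, Tendsto (fun s => Real.exp (c * position (Real.log 4) (L s) ζ)) (𝓝[<] t)
      (𝓝 (Real.exp (c * Y))) := fun c =>
    ((hdY.continuousAt.const_mul c).rexp).tendsto.mono_left nhdsWithin_le_nhds
  have hVlim := hcV.neg.tendsto.mono_left (nhdsWithin_le_nhds (s := Iio t))
  -- Control is known only before `t`, so the velocity bounds at `t` are limits of those at earlier
  -- times.
  have hVge : φ * (min 1 (p * Real.log 2) / p) * Real.exp (-p * Y) ≤ -V := by
    refine le_of_tendsto_of_tendsto ((hexp (-p)).const_mul _) hVlim ?_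
    filter_upwards [hev] with s hs
    have hsS : s ∈ Ico 0 S := ⟨hs.1.1, hs.1.2.trans htS⟩
    exact (hC s hs.1).neg_particleVelocity_ge hp hφ
      (fun r => (hd.w_nonneg r).trans (h.le_Ω hd.P_nonneg hsS r)) hζ.1
      (h.position_of_ge (h.Ico_subset hsS) le_rfl) hs.2.le
      (h.surjective_position (h.Ico_subset hsS))
  have hVle : -V ≤ ψ * (1 / q + Real.log 4) * Real.exp (-q * Y) := by
    refine le_of_tendsto_of_tendsto hVlim ((hexp (-q)).const_mul _) ?_
    filter_upwards [hev] with s hs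
    have hsS : s ∈ Ico 0 S := ⟨hs.1.1, hs.1.2.trans htS⟩
    exact (hC s hs.1).neg_particleVelocity_le_exp hq hζ.1
      (h.position_of_ge (h.Ico_subset hsS) le_rfl) hs.2.le hψ.le
      (h.surjective_position (h.Ico_subset hsS))
  -- Comparison with the particle now at `x = 1`, which started at most at `3 / 2`, shows that the
  -- label lies where `P ≥ 1/m`.
  have hζ2 : ζ ≤ Real.log 2 := by
    obtain ⟨ζ₁, h₁⟩ := h.surjective_position htD 0
    have hmono := strictMono_position (Real.log 4) (L t)
    have l₁ : ζ ≤ ζ₁ := hmono.le_iff_le.1 (by rw [h₁]; exact hY)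
    have l₂ : ζ₁ ≤ Real.log 4 := hmono.le_iff_le.1 (by
      rw [h₁, h.position_of_ge htD le_rfl]; exact log_four_pos.le)
    have l₃ := h.label_le ha hd ht hC l₂ h₁.ge
    rw [h₁, zero_add] at l₃
    exact l₁.trans (l₃.trans (Real.log_le_log (by norm_num) (by norm_num)))
  have hcancel : ∀ c : ℝ, Real.exp (-c * Y) * Real.exp (c * Y) = 1 := fun c => by
    rw [← Real.exp_add, neg_mul, neg_add_cancel, Real.exp_zero]
  have hcancel' : ∀ (s c : ℝ), Real.exp (-c * position (Real.log 4) (L s) ζ) *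
      Real.exp (c * position (Real.log 4) (L s) ζ) = 1 := fun s c => by
    rw [← Real.exp_add, neg_mul, neg_add_cancel, Real.exp_zero]
  have hβq : Real.exp (-β * Y) * Real.exp (q * Y) = Real.exp (-p * Y) := by
    rw [← Real.exp_add, ← hpq]; ring_nf
  have hβp : Real.exp (-β * Y) * Real.exp (p * Y) = Real.exp (-q * Y) := by
    rw [← Real.exp_add, ← hpq]; ring_nf
  have hEp := Real.exp_pos (-p * Y)
  have hEq := Real.exp_pos (-q * Y)
  constructor
  -- Lower barrier: `Ω e^{pY}` comes down to `φ` at time `t`, so its derivative is nonpositive. By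
  -- `lower_barrier` the source beats the transport term and the derivative is positive.
  · by_contra! hle
    have hdf := (hdΩ.mul (hdY.const_mul p).exp).neg
    have hle' : Ω t ζ * Real.exp (p * Y) ≤ φ := by
      have := mul_le_mul_of_nonneg_right hle (Real.exp_pos (p * Y)).le
      rwa [mul_assoc, hcancel, mul_one] at this
    have hlt : ∀ᶠ s in 𝓝[<] t, φ < Ω s ζ * Real.exp (p * position (Real.log 4) (L s) ζ) := by
      filter_upwards [hev] with s hs
      have := mul_lt_mul_of_pos_right ((hC s hs.1 ζ hζ).1 hs.2.le).1
        (Real.exp_pos (p * position (Real.log 4) (L s) ζ))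
      rwa [mul_assoc, hcancel', mul_one] at this
    have hge : φ ≤ Ω t ζ * Real.exp (p * Y) := by
      refine ge_of_tendsto ((hdΩ.mul (hdY.const_mul p).exp).continuousAt.tendsto.mono_left
        (nhdsWithin_le_nhds (s := Iio t))) ?_
      filter_upwards [hlt] with s hs using hs.le
    have heq := le_antisymm hle' hge
    have h0 := nonneg_of_hasDerivAt_of_eventually_le hdf (by
      filter_upwards [hlt] with s hs
      exact neg_le_neg (hle'.trans hs.le))
    have e : P ζ * Real.exp (-β * Y) * Real.exp (p * Y) +
        Ω t ζ * (Real.exp (p * Y) * (p * V)) = P ζ * Real.exp (-q * Y) + p * φ * V := by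
      linear_combination P ζ * hβp + p * V * heq
    rw [e] at h0
    have h1 := mul_le_mul_of_nonneg_right (hd.le_P ζ ⟨hζ.1, hζ2⟩) hEq.le
    have h2 := mul_le_mul_of_nonneg_left hVle (mul_pos hp hφ).le
    have h3 := mul_lt_mul_of_pos_right ha.lower_barrier hEq
    linarith
  -- Upper barrier: `Ω e^{qY}` rises to `ψ` at time `t`, so its derivative is nonnegative. By
  -- `upper_barrier` the transport term wins and the derivative is negative.
  · by_contra! hle
    have hdf := hdΩ.mul (hdY.const_mul q).exp
    have hle' : ψ ≤ Ω t ζ * Real.exp (q * Y) := by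
      have := mul_le_mul_of_nonneg_right hle (Real.exp_pos (q * Y)).le
      rwa [mul_assoc, hcancel, mul_one] at this
    have hlt : ∀ᶠ s in 𝓝[<] t, Ω s ζ * Real.exp (q * position (Real.log 4) (L s) ζ) < ψ := by
      filter_upwards [hev] with s hs
      have := mul_lt_mul_of_pos_right ((hC s hs.1 ζ hζ).1 hs.2.le).2
        (Real.exp_pos (q * position (Real.log 4) (L s) ζ))
      rwa [mul_assoc, hcancel', mul_one] at this
    have hge : Ω t ζ * Real.exp (q * Y) ≤ ψ := by
      refine le_of_tendsto (hdf.continuousAt.tendsto.mono_left (nhdsWithin_le_nhds (s := Iio t))) ?_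
      filter_upwards [hlt] with s hs using hs.le
    have heq := le_antisymm hge hle'
    have h0 := nonneg_of_hasDerivAt_of_eventually_le hdf (by
      filter_upwards [hlt] with s hs
      exact hs.le.trans hle')
    have e : P ζ * Real.exp (-β * Y) * Real.exp (q * Y) +
        Ω t ζ * (Real.exp (q * Y) * (q * V)) = P ζ * Real.exp (-p * Y) + q * ψ * V := by
      linear_combination P ζ * hβq + q * V * heq
    rw [e] at h0
    have h1 := mul_le_mul_of_nonneg_right (hd.P_le ζ) hEp.le
    have h2 := mul_le_mul_of_nonneg_left hVge (mul_pos hq hψ).le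
    have h3 := mul_lt_mul_of_pos_right ha.upper_barrier hEp
    linarith

/-- The control conditions hold as long as the solution exists. -/
theorem controlledAt (h : LagrangianSolution β l (Real.log 4) τ S P w₀ L Ω)
    (hβ : 0 ≤ β) (hpq : p + q = β) (ha : Admissible p q φ ψ δ m A₀)
    (hd : LogPrepared p q φ ψ δ m (Real.log A₀) P w₀) {t : ℝ} (ht : t ∈ Ico 0 S) :
    ControlledAt p q φ ψ (Real.log A₀) (Real.log 4) (L t) (Ω t) := by
  by_contra hbad
  set K : Set (ℝ × ℝ) := Icc 0 t ×ˢ Icc (Real.log A₀) (Real.log 4)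
  have hKD : K ⊆ Ioo (-τ) S ×ˢ univ := fun z hz =>
    ⟨h.Ico_subset ⟨hz.1.1, hz.1.2.trans_lt ht.2⟩, trivial⟩
  have hK : IsCompact K := isCompact_Icc.prod isCompact_Icc
  have hKc : IsClosed K := isClosed_Icc.prod isClosed_Icc
  have hY := h.continuousOn_position.mono hKD
  have hΩ := h.continuousOn_Ω_uncurry.mono hKD
  have hexp : ∀ a c : ℝ, ContinuousOn
      (fun z : ℝ × ℝ => a * Real.exp (c * position (Real.log 4) (L z.1) z.2)) K :=
    fun a c => by fun_prop
  have c₁ := hKc.isClosed_le hY (continuousOn_const (c := (0 : ℝ)))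
  have c₂ := hKc.isClosed_le (continuousOn_const (c := (0 : ℝ))) hY
  have c₃ := hKc.isClosed_le hY (continuousOn_const (c := Real.log 2))
  have c₄ := hKc.isClosed_le hΩ (hexp φ (-p))
  have c₅ := hKc.isClosed_le (hexp ψ (-q)) hΩ
  have c₆ := hKc.isClosed_le (continuousOn_const (c := ψ)) hΩ
  have c₇ := hKc.isClosed_le hΩ (continuousOn_const (c := φ))
  set B : Set (ℝ × ℝ) := {z ∈ K |
    ¬ ((position (Real.log 4) (L z.1) z.2 ≤ 0 →
        φ * Real.exp (-p * position (Real.log 4) (L z.1) z.2) < Ω z.1 z.2 ∧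
        Ω z.1 z.2 < ψ * Real.exp (-q * position (Real.log 4) (L z.1) z.2)) ∧
      (0 ≤ position (Real.log 4) (L z.1) z.2 → Ω z.1 z.2 < ψ) ∧
      (0 ≤ position (Real.log 4) (L z.1) z.2 →
        position (Real.log 4) (L z.1) z.2 ≤ Real.log 2 → φ < Ω z.1 z.2))} with hB
  -- The premises are closed conditions and the conclusions strict inequalities, so failure is a
  -- closed condition. By compactness there is a failure at an earliest time.
  have hBc : IsClosed B := by
    convert ((c₁.inter (c₄.union c₅)).union (c₂.inter c₆)).union ((c₂.inter c₃).inter c₇) using 1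
    ext z
    simp only [hB, mem_ofPred_eq, mem_union, mem_inter_iff, ← not_lt (b := Ω z.1 z.2),
      ← not_lt (a := Ω z.1 z.2)]
    tauto
  have hBne : B.Nonempty := by
    simp only [ControlledAt, not_forall] at hbad
    obtain ⟨ζ, hζ, hb⟩ := hbad
    exact ⟨(t, ζ), ⟨⟨ht.1, le_rfl⟩, hζ⟩, hb⟩
  obtain ⟨z, hz, hmin⟩ := (hK.of_isClosed_subset hBc fun z hz => hz.1).exists_isMinOn hBne
    continuousOn_fst
  have hlt : ∀ s ∈ Ico 0 z.1,
      ControlledAt p q φ ψ (Real.log A₀) (Real.log 4) (L s) (Ω s) := by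
    intro s hs ζ hζ
    by_contra hb
    exact not_lt.2 (hmin (show (s, ζ) ∈ B from ⟨⟨⟨hs.1, hs.2.le.trans hz.1.1.2⟩, hζ⟩, hb⟩)) hs.2
  refine hz.2 ?_
  rcases hz.1.1.1.eq_or_lt with h0 | h0
  · have : ControlledAt p q φ ψ (Real.log A₀) (Real.log 4) (L z.1) (Ω z.1) := by
      rw [← h0]
      exact h.controlledAt_zero ha hd
    exact this z.2 hz.1.2
  · exact h.controlledAt_of_forall_lt hβ hpq ha hd h0 (hz.1.1.2.trans_lt ht.2) hlt z.2 hz.1.2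

end LagrangianSolution

/-! ### Choice of parameters and of initial data -/

theorem exists_admissible {β m : ℝ} (hβ : 0 < β) (hm : 1 ≤ m) :
    ∃ A₀ p q φ ψ δ : ℝ, p + q = β ∧ p ≤ 1 ∧ φ < 1 ∧ 3 < ψ - δ ∧ Admissible p q φ ψ δ m A₀ := by
  have hm0 : 0 < m := one_pos.trans_le hm
  have hlog2 : 0 < Real.log 2 := Real.log_pos (by norm_num)
  have hlog2' : Real.log 2 < 1 := (Real.log_lt_sub_one_of_pos (by norm_num) (by norm_num)).trans_eq
    (by norm_num)
  have hlog4 := log_four_pos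
  -- `K` will be the product `φψ`, with `φ = K / (K + 4)` and `ψ = K + 4`. As `p log 2 ≤ 1`, the
  -- constant `b₀` is `log 2`, and `q ≥ 3β/4` gives `qψφ b₀ ≥ 3m > m`.
  set K := 4 * m / (β * Real.log 2) with hK
  have hK0 : 0 < K := by positivity
  -- With `p ≤ 1 / M` and `1/q ≤ 2/β`, the left side of the lower barrier condition is at most
  -- `1/(2m)`.
  set M := 2 * m * K * (2 / β + Real.log 4) with hM
  have hM0 : 0 < M := by positivity
  set p := min (min 1 (β / 4)) (1 / M)
  have hp : 0 < p := by positivity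
  have hp1 : p ≤ 1 := (min_le_left _ _).trans (min_le_left _ _)
  have hpβ : p ≤ β / 4 := (min_le_left _ _).trans (min_le_right _ _)
  have hpM : p ≤ 1 / M := min_le_right _ _
  have hφψ : K / (K + 4) * (K + 4) = K := div_mul_cancel₀ _ (by positivity)
  have hφ0 : 0 < K / (K + 4) := by positivity
  have hφ1 : K / (K + 4) < 1 := (div_lt_one (by positivity)).2 (by linarith)
  have hmin : min 1 (p * Real.log 2) = p * Real.log 2 := min_eq_right (by nlinarith)
  have hlog32 : 0 < Real.log (3 / 2) := Real.log_pos (by norm_num)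
  set D := K / (K + 4) * (min 1 (p * Real.log 2) / p) * p
  have hD : 0 < D := by
    have : 0 < min 1 (p * Real.log 2) := by rw [hmin]; positivity
    positivity
  -- Target for the reaching time, with `δ = 1`. It is met by taking `A₀` small, the other
  -- parameters being already fixed.
  set ε := min (1 / m) (Real.log (3 / 2) / ((K + 4) * Real.log 4))
  have hε : 0 < ε := by positivity
  have hlim : Tendsto (fun A : ℝ => A ^ p) (𝓝[>] 0) (𝓝 0) :=
    ((Real.continuous_rpow_const hp.le).tendsto' 0 0 (Real.zero_rpow hp.ne')).mono_left
      nhdsWithin_le_nhds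
  obtain ⟨A₀, hA, hA₀⟩ := ((hlim.eventually (gt_mem_nhds (mul_pos hε hD))).and
    (Ioo_mem_nhdsGT one_pos)).exists
  have hT : reachTime p (K / (K + 4)) A₀ < ε := by
    rw [reachTime, div_lt_iff₀ hD]; exact hA
  refine ⟨A₀, p, β - p, K / (K + 4), K + 4, 1, by ring, hp1, hφ1, by linarith, hA₀.1, hA₀.2, hp,
    by linarith, hφ0, one_pos, by linarith, hm0, ?_, ?_, ?_, ?_⟩
  · rw [hmin, mul_div_cancel_left₀ _ hp.ne']
    have e : (β - p) * (K + 4) * (K / (K + 4) * Real.log 2) = (β - p) * (K * Real.log 2) := by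
      linear_combination (β - p) * Real.log 2 * hφψ
    have e2 : β * (K * Real.log 2) = 4 * m := by rw [hK]; field_simp
    rw [e]
    nlinarith [mul_pos hK0 hlog2]
  · have hq : 1 / (β - p) ≤ 2 / β := by
      rw [div_le_div_iff₀ (by linarith) hβ]; linarith
    have e : p * (K / (K + 4)) * ((K + 4) * (1 / (β - p) + Real.log 4)) =
        p * (K * (1 / (β - p) + Real.log 4)) := by
      linear_combination p * (1 / (β - p) + Real.log 4) * hφψ
    rw [e]
    calc p * (K * (1 / (β - p) + Real.log 4)) ≤ 1 / M * (K * (2 / β + Real.log 4)) := by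
          have : 0 < 1 / (β - p) := one_div_pos.2 (by linarith)
          gcongr
      _ = m⁻¹ / 2 := by rw [hM]; field_simp
      _ < m⁻¹ := half_lt_self (inv_pos.2 hm0)
  · calc m * reachTime p (K / (K + 4)) A₀ ≤ m * (1 / m) :=
        mul_le_mul_of_nonneg_left (hT.le.trans (min_le_left _ _)) hm0.le
      _ = 1 := mul_one_div_cancel hm0.ne'
  · have hc : 0 < (K + 4) * Real.log 4 := by positivity
    calc (K + 4) * Real.log 4 * reachTime p (K / (K + 4)) A₀
        ≤ (K + 4) * Real.log 4 * (Real.log (3 / 2) / ((K + 4) * Real.log 4)) :=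
        mul_le_mul_of_nonneg_left (hT.le.trans (min_le_right _ _)) hc.le
      _ = _ := mul_div_cancel₀ _ hc.ne'

theorem exists_cutoff {a b d : ℝ} (hab : a < b) (hd : 0 < d) :
    ∃ f : ℝ → ℝ, ContDiff ℝ 1 f ∧ tsupport f ⊆ Icc (a - d) (b + d) ∧ (∀ x ∈ Icc a b, f x = 1) ∧
      (∀ x, 0 ≤ f x) ∧ ∀ x, f x ≤ 1 := by
  set f : ContDiffBump ((a + b) / 2) := ⟨(b - a) / 2, (b - a) / 2 + d, by linarith, by linarith⟩
  refine ⟨f, f.contDiff, ?_, fun x hx => f.one_of_mem_closedBall ?_, fun x => f.nonneg,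
    fun x => f.le_one⟩
  · rw [f.tsupport_eq, Real.closedBall_eq_Icc]
    refine Icc_subset_Icc ?_ ?_ <;> simp only [f] <;> linarith
  · rw [Real.closedBall_eq_Icc]
    refine ⟨?_, ?_⟩ <;> simp only [f] <;> linarith [hx.1, hx.2]

theorem memC1c_of_tsupport_subset {f : ℝ → ℝ} {a b : ℝ} (ha : 0 < a) (hf : ContDiff ℝ 1 f)
    (hs : tsupport f ⊆ Icc a b) : MemC1c f :=
  ⟨hf, isCompact_Icc.of_isClosed_subset (isClosed_tsupport f) hs,
    fun _ hx => ha.trans_le (hs hx).1⟩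

/-- The vorticity `3 x^{-p}`, cut off, lies between the barriers because `φ < 1` and `3 < ψ - δ`. On
`[1, 3]` it is at least `3 / x ≥ 1 > φ`, as `p ≤ 1`. The density is a plain cutoff. -/
theorem exists_suitablyPrepared {p q φ ψ δ m A₀ ε : ℝ} (ha : Admissible p q φ ψ δ m A₀)
    (hm : 1 ≤ m) (hp : p ≤ 1) (hφ : φ < 1) (hψ : 3 < ψ - δ) (hε : 0 < ε) (hεA : ε < A₀) :
    ∃ ω₀ ρ₀ : ℝ → ℝ, SuitablyPrepared p q φ ψ δ m A₀ ε ω₀ ρ₀ := by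
  have hA := ha.A₀_pos
  have hA1 := ha.A₀_lt
  -- Margin of the cutoffs: it does not pass `ε` on the left, nor `3 + 1` and `2 + 1` on the right.
  have hd : 0 < min 1 (A₀ - ε) := lt_min one_pos (sub_pos.2 hεA)
  have hd1 : min 1 (A₀ - ε) ≤ 1 := min_le_left _ _
  have hd2 : min 1 (A₀ - ε) ≤ A₀ - ε := min_le_right _ _
  obtain ⟨f, hf, hfs, hf1, hf0, hfle⟩ := exists_cutoff (by linarith : A₀ < 3) hd
  obtain ⟨g, hg, hgs, hg1, hg0, hgle⟩ := exists_cutoff (by linarith : A₀ < 2) hd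
  have hfs' : tsupport f ⊆ Icc ε 4 := hfs.trans (Icc_subset_Icc (by linarith) (by linarith))
  have hgs' : tsupport g ⊆ Icc ε 3 := hgs.trans (Icc_subset_Icc (by linarith) (by linarith))
  have hws : tsupport (fun x => f x * (3 * x ^ (-p))) ⊆ Icc ε 4 :=
    (tsupport_mul_subset_left (f := f)).trans hfs'
  have hw : ContDiff ℝ 1 (fun x => f x * (3 * x ^ (-p))) := by
    refine contDiff_iff_contDiffAt.2 fun x => ?_
    by_cases hx : x ∈ tsupport (fun x => f x * (3 * x ^ (-p)))
    swap
    · exact (contDiffAt_const (c := (0 : ℝ))).congr_of_eventuallyEq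
        (notMem_tsupport_iff_eventuallyEq.1 hx)
    have hx0 : x ≠ 0 := (hε.trans_le (hws hx).1).ne'
    exact hf.contDiffAt.mul (contDiffAt_const.mul (Real.contDiffAt_rpow_const_of_ne hx0))
  have hle3 : ∀ x, 1 ≤ x → f x * (3 * x ^ (-p)) ≤ 3 := fun x hx => by
    have h1 : x ^ (-p) ≤ 1 := Real.rpow_le_one_of_one_le_of_nonpos hx (by linarith [ha.p_pos])
    have h2 : 0 ≤ x ^ (-p) := Real.rpow_nonneg (by linarith) _
    nlinarith [hfle x, hf0 x]
  refine ⟨_, g, memC1c_of_tsupport_subset hε hw hws, memC1c_of_tsupport_subset hε hg hgs',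
    fun x hx => mul_nonneg (hf0 x) (by positivity), fun x _ => hg0 x, hws, hgs', ?_, ?_, ?_, ?_,
    fun x _ => (hgle x).trans hm, fun x hx => ?_⟩
  · intro x hx
    have hx0 : 0 < x := hA.trans_le hx.1
    have h1 : x ^ (-p) ≤ x ^ (-q) :=
      Real.rpow_le_rpow_of_exponent_ge hx0 hx.2 (by linarith [ha.p_lt])
    have h2 : 0 < x ^ (-q) := Real.rpow_pos_of_pos hx0 _
    have := ha.δ_pos
    simp only [hf1 x ⟨hx.1, by linarith [hx.2]⟩]
    nlinarith
  · exact fun x hx => (hle3 x hx.1).trans_lt hψ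
  · intro x hx
    have h2 : 0 < x ^ (-p) := Real.rpow_pos_of_pos (hA.trans_le hx.1) _
    simp only [hf1 x ⟨hx.1, by linarith [hx.2]⟩]
    nlinarith
  · intro x hx
    have hx0 : 0 < x := one_pos.trans_le hx.1
    have h1 : x ^ (-1 : ℝ) ≤ x ^ (-p) := Real.rpow_le_rpow_of_exponent_le hx.1 (by linarith)
    have h2 : 1 ≤ 3 * x ^ (-1 : ℝ) := by
      rw [Real.rpow_neg_one, ← div_eq_mul_inv, le_div_iff₀ hx0]
      linarith [hx.2]
    simp only [hf1 x ⟨by linarith [hx.1], hx.2⟩]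
    linarith
  · rw [hg1 x hx]
    exact inv_le_one_of_one_le₀ hm

theorem SuitablyPrepared.logPrepared {p q φ ψ δ m A₀ ε : ℝ} {ω₀ ρ₀ : ℝ → ℝ}
    (h : SuitablyPrepared p q φ ψ δ m A₀ ε ω₀ ρ₀) (hA : 0 < A₀) :
    LogPrepared p q φ ψ δ m (Real.log A₀) (fun ζ => ρ₀ (Real.exp ζ)) fun ζ => ω₀ (Real.exp ζ) := by
  have hlow : ∀ ζ, Real.log A₀ ≤ ζ → A₀ ≤ Real.exp ζ := fun ζ hζ => (Real.log_le_iff_le_exp hA).1 hζ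
  have hup : ∀ ζ c, 0 < c → ζ ≤ Real.log c → Real.exp ζ ≤ c := fun ζ c hc hζ =>
    (Real.le_log_iff_exp_le hc).1 hζ
  have hpow : ∀ ζ c : ℝ, Real.exp ζ ^ c = Real.exp (c * ζ) := fun ζ c => by
    rw [← Real.exp_mul, mul_comm]
  refine ⟨fun ζ => h.nonneg_ω _ (Real.exp_pos ζ), fun ζ => h.nonneg_ρ _ (Real.exp_pos ζ),
    fun ζ hζ => ?_, fun ζ hζ => ?_,
    fun ζ hζ => h.ω_lt _ ⟨Real.one_le_exp hζ.1, hup ζ 4 (by norm_num) hζ.2⟩,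
    fun ζ hζ => h.lt_ω _ ⟨Real.one_le_exp hζ.1, hup ζ 3 (by norm_num) hζ.2⟩,
    fun ζ => h.ρ_le _ (Real.exp_pos ζ),
    fun ζ hζ => h.le_ρ _ ⟨hlow ζ hζ.1, hup ζ 2 (by norm_num) hζ.2⟩⟩
  · rw [← hpow]
    exact h.ω_lt_pow _ ⟨hlow ζ hζ.1, Real.exp_le_one_iff.2 hζ.2⟩
  · rw [← hpow]
    exact h.pow_lt_ω _ ⟨hlow ζ hζ.1, Real.exp_le_one_iff.2 hζ.2⟩

theorem comp_exp_eq_zero {f : ℝ → ℝ} {a b : ℝ} (ha : 0 < a) (hb : 0 < b)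
    (hf : tsupport f ⊆ Icc a b) {ζ : ℝ} (hζ : ζ ∉ Icc (Real.log a) (Real.log b)) :
    f (Real.exp ζ) = 0 :=
  image_eq_zero_of_notMem_tsupport fun hm => hζ
    ⟨(Real.log_le_iff_le_exp ha).2 (hf hm).1, (Real.le_log_iff_exp_le hb).2 (hf hm).2⟩

/-- The control in labels covers the required positions: points to the right of `A(t)` have labels
at least `α` by monotonicity of the flow, points with `x ≥ 1` because particles move left, and `x ≤
3` keeps the label below the fixed particle `log 4`. -/
theorem LagrangianSolution.controlled {β l τ S p q φ ψ α : ℝ} {P w₀ : ℝ → ℝ} {L Ω : ℝ → ℝ →ᵇ ℝ}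
    (h : LagrangianSolution β l (Real.log 4) τ S P w₀ L Ω) (hα : α ≤ 0) (hw : ∀ ζ, 0 ≤ w₀ ζ)
    (hP : ∀ ζ, 0 ≤ P ζ)
    (hC : ∀ t ∈ Ico 0 S, ControlledAt p q φ ψ α (Real.log 4) (L t) (Ω t)) :
    Controlled p q φ ψ S (eulerian (Real.log 4) L fun t => Ω t)
      (fun t => Real.exp (position (Real.log 4) (L t) α)) := by
  have hlt : ∀ t ∈ Ico 0 S, ∀ x, 0 < x → x ≤ 3 →
      label (Real.log 4) (L t) (Real.log x) ≤ Real.log 4 := fun t ht x hx hx3 => by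
    refine ((h.label_lt_iff (h.Ico_subset ht)).2 ?_).le
    rw [h.position_of_ge (h.Ico_subset ht) le_rfl]
    exact Real.log_lt_log hx (by linarith)
  have hleft : ∀ t ∈ Ico 0 S, ∀ x ∈ Icc (Real.exp (position (Real.log 4) (L t) α)) 1,
      0 < x ∧ label (Real.log 4) (L t) (Real.log x) ∈ Icc α (Real.log 4) ∧ Real.log x ≤ 0 := by
    intro t ht x hx
    have hx0 := (Real.exp_pos _).trans_le hx.1
    refine ⟨hx0, ⟨?_, hlt t ht x hx0 (by linarith [hx.2])⟩, Real.log_nonpos hx0.le hx.2⟩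
    by_contra! hlt'
    rw [h.label_lt_iff (h.Ico_subset ht), Real.log_lt_iff_lt_exp hx0] at hlt'
    exact not_lt.2 hx.1 hlt'
  have hright : ∀ t ∈ Ico 0 S, ∀ x, 1 ≤ x → x ≤ 3 →
      label (Real.log 4) (L t) (Real.log x) ∈ Icc α (Real.log 4) := by
    intro t ht x hx1 hx3
    refine ⟨hα.trans ?_, hlt t ht x (by linarith) hx3⟩
    have := h.position_le_label hw hP ht (label (Real.log 4) (L t) (Real.log x))
    rw [h.position_label (h.Ico_subset ht)] at this
    exact (Real.log_nonneg hx1).trans this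
  refine ⟨fun t ht x hx => ?_, fun t ht x hx => ?_, fun t ht x hx => ?_, fun t ht x hx => ?_⟩
  · obtain ⟨hx0, hm, hx1⟩ := hleft t ht x hx
    have := (hC t ht _ hm).1
    rw [h.position_label (h.Ico_subset ht)] at this
    rw [eulerian_of_pos _ _ _ _ hx0, Real.rpow_def_of_pos hx0, mul_comm (Real.log x)]
    exact (this hx1).2
  · have := (hC t ht _ (hright t ht x hx.1 hx.2)).2.1
    rw [h.position_label (h.Ico_subset ht)] at this
    rw [eulerian_of_pos _ _ _ _ (by linarith [hx.1])]
    exact this (Real.log_nonneg hx.1)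
  · obtain ⟨hx0, hm, hx1⟩ := hleft t ht x hx
    have := (hC t ht _ hm).1
    rw [h.position_label (h.Ico_subset ht)] at this
    rw [eulerian_of_pos _ _ _ _ hx0, Real.rpow_def_of_pos hx0, mul_comm (Real.log x)]
    exact (this hx1).1
  · have := (hC t ht _ (hright t ht x hx.1 (by linarith [hx.2]))).2.2
    rw [h.position_label (h.Ico_subset ht)] at this
    have hx0 : 0 < x := by linarith [hx.1]
    rw [eulerian_of_pos _ _ _ _ hx0]
    exact this (Real.log_nonneg hx.1) (Real.log_le_log hx0 hx.2)

end NonlocalTransport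

end

theorem theorem2 (β : ℝ) (hβ : 0 < β) (m : ℝ) (hm : 1 ≤ m) :
    ∃ A₀ p q φ ψ δ : ℝ,
      0 < A₀ ∧ A₀ < 1 ∧ 0 < p ∧ p < q ∧ p + q = β ∧ 0 < φ ∧ 0 < δ ∧ φ < ψ - δ ∧
      ∀ ε : ℝ, 0 < ε → ε < A₀ →
        (∃ ω₀ ρ₀ : ℝ → ℝ, SuitablyPrepared p q φ ψ δ m A₀ ε ω₀ ρ₀) ∧
        ∀ ω₀ ρ₀ : ℝ → ℝ, SuitablyPrepared p q φ ψ δ m A₀ ε ω₀ ρ₀ →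
          ∃ (Ts : ℝ) (ω ρ : ℝ → ℝ → ℝ) (A : ℝ → ℝ),
            IsMaximalSolution β Ts ω₀ ρ₀ ω ρ ∧
            Tendsto (fun t => ∫ s in (0 : ℝ)..t, supNorm (ω s)) (𝓝[<] Ts) atTop ∧
            IsTrajectory Ts A₀ ω A ∧
            (∀ t ∈ Ico 0 Ts, 0 < A t) ∧
            Controlled p q φ ψ Ts ω A ∧
            (∀ t ∈ Ico 0 Ts, A t ^ p ≤ A₀ ^ p * (1 - t / reachTime p φ A₀)) ∧
            Ts ≤ reachTime p φ A₀ ∧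
            (IsSmoothSolution β (reachTime p φ A₀) ω₀ ρ₀ ω ρ →
              Tendsto A (𝓝[<] (reachTime p φ A₀)) (𝓝 0)) := by
  obtain ⟨A₀, p, q, φ, ψ, δ, hpq, hp1, hφ1, hψ3, ha⟩ := exists_admissible hβ hm
  refine ⟨A₀, p, q, φ, ψ, δ, ha.A₀_pos, ha.A₀_lt, ha.p_pos, ha.p_lt, hpq, ha.φ_pos, ha.δ_pos,
    ha.φ_lt, fun ε hε hεA => ⟨exists_suitablyPrepared ha hm hp1 hφ1 hψ3 hε hεA,
    fun ω₀ ρ₀ hprep => ?_⟩⟩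
  have hd := hprep.logPrepared ha.A₀_pos
  have hT1 := reachTime_pos ha
  have hα : Real.log A₀ < 0 := Real.log_neg ha.A₀_pos ha.A₀_lt
  have hlR : Real.log ε ≤ Real.log 4 := Real.log_le_log hε (by linarith [ha.A₀_lt])
  -- The prescribed time is `T₁ + 1`. Since control forces `S ≤ T₁`, the solution cannot reach it,
  -- and the blow-up branch of the alternative remains.
  obtain ⟨τ, S, L, Ω, hST, h, halt⟩ := exists_lagrangianSolution hβ.le hlR
    (hprep.mem_ρ.contDiff.comp Real.contDiff_exp) (hprep.mem_ω.contDiff.comp Real.contDiff_exp)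
    (fun ζ hζ => comp_exp_eq_zero hε (by norm_num)
      (hprep.supp_ρ.trans (Icc_subset_Icc_right (by norm_num))) hζ)
    (fun ζ hζ => comp_exp_eq_zero hε (by norm_num) hprep.supp_ω hζ)
    (add_pos hT1 one_pos)
  have hC := fun t ht => h.controlledAt hβ.le hpq ha hd (t := t) ht
  have hlt : ∀ t ∈ Ico 0 S, t < reachTime p φ A₀ := fun t ht =>
    h.lt_reachTime ha hd ht fun s hs => hC s ⟨hs.1, hs.2.trans ht.2⟩
  have hS : S ≤ reachTime p φ A₀ := by
    by_contra! hcon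
    exact lt_irrefl _ (hlt _ ⟨hT1.le, hcon⟩)
  have hunb := halt.resolve_left (by linarith)
  have hzero : ∀ {f : ℝ → ℝ}, MemC1c f → ∀ x ≤ 0, f x = 0 := fun hf x hx =>
    image_eq_zero_of_notMem_tsupport fun hm => not_lt.2 hx (hf.tsupport_subset hm)
  have hsol := h.isSmoothSolution (hzero hprep.mem_ω) (hzero hprep.mem_ρ) (fun _ => rfl) fun _ => rfl
  have hblow := h.tendsto_integral_supNorm hunb
  have hmax := hsol.isMaximalSolution hβ.le h.S_pos h.isFlow hblow
  have hreach : ∀ t ∈ Ico 0 S, Real.exp (position (Real.log 4) (L t) (Real.log A₀)) ^ p ≤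
      A₀ ^ p * (1 - t / reachTime p φ A₀) := fun t ht => by
    rw [← Real.exp_mul, mul_comm]
    exact h.exp_position_le ha hd ht fun s hs => hC s ⟨hs.1, hs.2.trans ht.2⟩
  refine ⟨S, _, _, _, hmax, hblow, h.isTrajectory ha.A₀_pos, fun t _ => Real.exp_pos _,
    h.controlled hα.le hd.w_nonneg hd.P_nonneg hC, hreach, hS, fun hs => ?_⟩
  -- Smoothness up to `T₁` gives `T₁ ≤ S` by maximality, so the bound on `A^p` holds up to `T₁`,
  -- where it tends to zero.
  have hSeq : S = reachTime p φ A₀ := hS.antisymm (hmax.maximal _ _ _ hs).1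
  set A : ℝ → ℝ := fun t => Real.exp (position (Real.log 4) (L t) (Real.log A₀))
  have hpow : Tendsto (fun t => A t ^ p) (𝓝[<] reachTime p φ A₀) (𝓝 0) := by
    have hlim : Tendsto (fun t => A₀ ^ p * (1 - t / reachTime p φ A₀)) (𝓝[<] reachTime p φ A₀)
        (𝓝 0) := by
      refine Tendsto.mono_left ?_ nhdsWithin_le_nhds
      refine Continuous.tendsto' (by fun_prop) _ _ ?_
      rw [div_self hT1.ne', sub_self, mul_zero]
    refine tendsto_of_tendsto_of_tendsto_of_le_of_le' tendsto_const_nhds hlim ?_ ?_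
    · exact .of_forall fun t => Real.rpow_nonneg (Real.exp_pos _).le _
    · filter_upwards [Ico_mem_nhdsLT hT1] with t ht
      exact hreach t (by rwa [hSeq])
  have hroot := hpow.rpow_const (p := p⁻¹) (Or.inr (inv_nonneg.2 ha.p_pos.le))
  rw [Real.zero_rpow (inv_ne_zero ha.p_pos.ne')] at hroot
  refine hroot.congr fun t => ?_
  exact Real.rpow_rpow_inv (Real.exp_pos _).le ha.p_pos.ne'
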